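/- Let $\mathbb{F}_q$ be a finite field with $q>2$ elements and put $N=q^2+q+1$. Fix an ordering $p_1,\dots,p_N$ of the points of $\mathbb{P}^2(\mathbb{F}_q)$ and affine representatives $p_1',\dots,p_N'\in\mathbb{F}_q^3\setminus\{0\}$. Let $C_{2,3}\subseteq\mathbb{F}_q^N$ be the projective Reed-Muller code consisting of all vectors $(f(p_1'),\dots,f(p_N'))$ with $f\in\mathbb{F}_q[x,y,z]$ homogeneous of degree $3$ (or zero), and let $$C_{2,3}^\perp=\Big\{y\in\mathbb{F}_q^N : \sum_{i=1}^N x_iy_i=0 \text{ for all } x\in C_{2,3}\Big\}$$ be its dual code. Let $\operatorname{wt}(c)$ be the number of nonzero coordinates of $c$, let $\operatorname{wt}(c_1,c_2)$ be the number of coordinates in which $c_1$ and $c_2$ are not both zero, and write $$W_{C_{2,3}^\perp}(X,Y)=\sum_{c\in C_{2,3}^\perp}X^{N-\operatorname{wt}(c)}Y^{\operatorname{wt}(c)}=\sum_{i=0}^{N}B^{2,3}_iX^{N-i}Y^i,$$ $$W^{[2]}_{C_{2,3}^\perp}(X,Y)=\sum_{c_1,c_2\in C_{2,3}^\perp}X^{N-\operatorname{wt}(c_1,c_2)}Y^{\operatorname{wt}(c_1,c_2)}=\sum_{i=0}^{N}B^{[2]}_iX^{N-i}Y^i.$$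 Let $$\begin{aligned} g_3(5)&=(q-1)^2,\\ g_3(6)&=(q^2+2q-5)(q-1)^2,\\ g_3(7)&=(q^4+2q^3-4q^2-12q+15)(q-1)^2,\\ g_3(8)&=(q^5+3q^4-2q^3-14q^2-7q+35)(q-1)^3,\\ g_3(9)&=(q^8+2q^7-6q^6-14q^5+14q^4+40q^3-112q+70)(q-1)^2, \end{aligned}$$ and $$I_9(q)=\frac{1}{9!}(q^6+2q^5-73q^4+344q^3-838q^2+1754q-2030)(q^2+q+1)(q+1)(q-1)^2(q-2)q^4.$$ Then $B^{[2]}_0=1$, $B^{[2]}_1=B^{[2]}_2=B^{[2]}_3=B^{[2]}_4=0$, and $$\begin{aligned} B^{[2]}_5&=2B^{2,3}_5+(q^2+q+1)\tbinom{q+1}{5}g_3(5),\\ B^{[2]}_6&=2B^{2,3}_6+(q^2+q+1)\tbinom{q+1}{6}g_3(6),\\ B^{[2]}_7&=2B^{2,3}_7+(q^2+q+1)\tbinom{q+1}{7}g_3(7),\\ B^{[2]}_8&=2B^{2,3}_8+(q^2+q+1)\tbinom{q+1}{8}g_3(8)+(q^5-q^2)\tbinom{q+1}{8}(q-1)^2+\tbinom{q^2+q+1}{2}\tbinom{q}{4}^2(q-1)^2,\\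 B^{[2]}_9&=2B^{2,3}_9+(q^2+q+1)\tbinom{q+1}{9}g_3(9)+2\tbinom{q^2+q+1}{2}\tbinom{q}{4}\tbinom{q}{5}(q^4-8q^2+12q-5)\\ &\quad+\tbinom{q^2+q+1}{2}\tbinom{q}{4}^2(q^4-5q^2+6q-2)+(q^5-q^2)\tbinom{q+1}{9}(q^4-11q^2+18q-8)+I_9(q)(q-1)^2. \end{aligned}$$ -/

import Mathlib

/-- The projective Reed-Muller code `C_{n,d}` attached to affine representatives
`v i ∈ K^{n+1}` of the points of projective `n`-space: the image of the evaluation map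
`f ↦ (f (v i))_i` on homogeneous polynomials of degree `d` in `n + 1` variables. -/
noncomputable def projReedMuller {K ι : Type*} [Field K] {n : ℕ} (d : ℕ)
    (v : ι → Fin (n + 1) → K) : Submodule K (ι → K) :=
  (MvPolynomial.homogeneousSubmodule (Fin (n + 1)) K d).map
    (LinearMap.pi fun i => (MvPolynomial.aeval (R := K) (v i)).toLinearMap)

/-- The dual code `C^⊥` for the standard bilinear form `⟨x, y⟩ = ∑ i, x i * y i`. -/
def dualCode {K ι : Type*} [Field K] [Fintype ι] (C : Submodule K (ι → K)) :
    Submodule K (ι → K) where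
  carrier := {y | ∀ x ∈ C, x ⬝ᵥ y = 0}
  zero_mem' := fun x _ => dotProduct_zero x
  add_mem' := fun {a b} ha hb x hx => by rw [dotProduct_add, ha x hx, hb x hx, add_zero]
  smul_mem' := fun c a ha x hx => by rw [dotProduct_smul, ha x hx, smul_zero]

open Classical in
/-- The weight of a pair: the number of coordinates in which `c₁` and `c₂` are not both zero. -/
noncomputable def pairWeight {K ι : Type*} [Field K] [Fintype ι] (c₁ c₂ : ι → K) : ℕ :=
  (Finset.univ.filter fun i => ¬(c₁ i = 0 ∧ c₂ i = 0)).card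

open Classical in
/-- The Hamming weight enumerator `W_C(X, Y) = ∑_{c ∈ C} X^{n - wt c} Y^{wt c}`, where `n` is the
length of the code, `X` is the variable `0` and `Y` is the variable `1`. -/
noncomputable def weightEnumerator {K ι : Type*} [Field K] [Fintype K] [Fintype ι]
    (C : Set (ι → K)) : MvPolynomial (Fin 2) ℚ :=
  ∑ c ∈ Finset.univ.filter (fun c : ι → K => c ∈ C),
    MvPolynomial.X 0 ^ (Fintype.card ι - hammingNorm c) * MvPolynomial.X 1 ^ hammingNorm c

open Classical in
/-- The second weight enumerator
`W^{[2]}_C(X, Y) = ∑_{c₁, c₂ ∈ C} X^{n - wt(c₁, c₂)} Y^{wt(c₁, c₂)}`. -/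
noncomputable def secondWeightEnumerator {K ι : Type*} [Field K] [Fintype K] [Fintype ι]
    (C : Set (ι → K)) : MvPolynomial (Fin 2) ℚ :=
  ∑ c₁ ∈ Finset.univ.filter (fun c : ι → K => c ∈ C),
    ∑ c₂ ∈ Finset.univ.filter (fun c : ι → K => c ∈ C),
      MvPolynomial.X 0 ^ (Fintype.card ι - pairWeight c₁ c₂) *
        MvPolynomial.X 1 ^ pairWeight c₁ c₂

/-- The quantities `g_3(m)`, used only for `5 ≤ m ≤ 9`: the number of ordered pairs of nonzero
codewords of `C_{2,3}^⊥` whose joint support is a given set of `m` collinear points. -/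
def g3 (q : ℚ) : ℕ → ℚ
  | 5 => (q - 1) ^ 2
  | 6 => (q ^ 2 + 2 * q - 5) * (q - 1) ^ 2
  | 7 => (q ^ 4 + 2 * q ^ 3 - 4 * q ^ 2 - 12 * q + 15) * (q - 1) ^ 2
  | 8 => (q ^ 5 + 3 * q ^ 4 - 2 * q ^ 3 - 14 * q ^ 2 - 7 * q + 35) * (q - 1) ^ 3
  | 9 => (q ^ 8 + 2 * q ^ 7 - 6 * q ^ 6 - 14 * q ^ 5 + 14 * q ^ 4 + 40 * q ^ 3
      - 112 * q + 70) * (q - 1) ^ 2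
  | _ => 0

/-- The rational number `I_9(q)`. -/
def I9 (q : ℚ) : ℚ :=
  1 / (Nat.factorial 9 : ℚ) *
    (q ^ 6 + 2 * q ^ 5 - 73 * q ^ 4 + 344 * q ^ 3 - 838 * q ^ 2 + 1754 * q - 2030) *
    (q ^ 2 + q + 1) * (q + 1) * (q - 1) ^ 2 * (q - 2) * q ^ 4

/-! A word lies in the dual code exactly when it is a linear relation among the evaluations of the
cubic forms at the points. A pair of words is the same thing with coefficients in `K × K`, and the
support of that relation is the joint support of the pair. Both enumerators therefore count
`W`-valued relations (`Rel`) by size of support, for `W = K` and `W = K × K`, and the count depends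
on `W` only through `Q = |W|`. If each support in a family carries `φ(Q)` relations, the family
contributes its size times `φ(q²) - 2φ(q)` to `B₂ - 2B`; this produces all the polynomials in `q` of
the statement.

Which sets of at most nine points are supports? Multiplying a relation of degree `d + e` by a form
of degree `e` gives a relation of degree `d` supported off the curve (`Rel.mul`). A nonzero relation
of degree `d` needs `d + 2` points (`Rel.card_supp_ge`), and one on at most `2d + 1` points is
collinear (`Rel.exists_line`). Removing a line or a conic rich in points leaves these types:
collinear sets; two lines with 4 + 4 or 5 + 4 private points, or 4 + 4 and the node; sets on a conic
with no four collinear; and nine points, no four collinear and no seven on a conic, that impose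
dependent conditions on cubics. The number of relations on each type follows from the dimension
count `natCard_rel` and inclusion-exclusion over subsets.

The first types are counted directly, there being `q⁵ - q²` nonsingular conics. The last (`baseFam`,
with count `I9`) rests on a Cayley-Bacharach theorem. Eight points with no four collinear and no
seven on a conic (`goodEight`) lie on a pencil of cubics without common component, and the pencil
has exactly one further base point, which is rational: either it is a new point, or it is infinitely
near to one of the eight, where some cubic of the pencil is then singular. The proof of
`exists_ninth_point` is by linkage: the eight points lie on a quartic `h` outside the ideal `(f, g)`
of the pencil, and two linear forms multiply `h` into `(f, g)`; their common zero is the ninth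
point.

Hence `#goodEight = 9 #baseFam + ∑ₚ #singularFam p` (`card_goodEight_eq`). The left side is an
inclusion-exclusion over lines and conics. The last term is found by projecting from the double
point `p`: a cubic singular at `p` is `z A(u) + B(u) = 0` with binary forms of degrees 2 and 3. Its
common factor splits off lines through `p`, and the rest is a rational curve given by a coprime
pair, so that the count reduces to one of coprime binary forms. -/

noncomputable section
open scoped Classical
open Finset
set_option linter.unusedSectionVars false
set_option linter.unusedFintypeInType false
set_option linter.unusedDecidableInType false

namespace PlaneCubics

/-- `v` lists one representative for each point of the projective plane over `K`. -/
structure PlaneReps {K ι : Type*} [Field K] (v : ι → Fin 3 → K) : Prop where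
  ne_zero : ∀ i, v i ≠ 0
  bijective : Function.Bijective fun i => Projectivization.mk K (v i) (ne_zero i)

/-! ### Incidence in the projective plane, with lines labelled by the points through the dot product
-/

section Plane

variable {K ι : Type*} [Field K] [Fintype ι] {v : ι → Fin 3 → K}

/-- The points on the line with coefficient vector `v j`. -/
def line (v : ι → Fin 3 → K) (j : ι) : Finset ι := univ.filter fun i => v j ⬝ᵥ v i = 0

lemma mem_line {i j : ι} : i ∈ line v j ↔ v j ⬝ᵥ v i = 0 := by simp [line]

lemma mem_line_comm {i j : ι} : i ∈ line v j ↔ j ∈ line v i := by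
  rw [mem_line, mem_line, dotProduct_comm]

namespace PlaneReps

lemma eq_of_smul (hv : PlaneReps v) {i j : ι} {c : K} (h : v i = c • v j) : i = j := by
  apply hv.bijective.1
  have hc : c ≠ 0 := by
    rintro rfl
    exact hv.ne_zero i (by simpa using h)
  exact (Projectivization.mk_eq_mk_iff' K _ _ _ _).2 ⟨c, h.symm⟩

lemma exists_smul (hv : PlaneReps v) {w : Fin 3 → K} (hw : w ≠ 0) :
    ∃ i, ∃ c : K, c ≠ 0 ∧ v i = c • w := by
  obtain ⟨i, hi⟩ := hv.bijective.2 (Projectivization.mk K w hw)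
  obtain ⟨c, hc⟩ := (Projectivization.mk_eq_mk_iff' K _ _ _ _).1 hi
  refine ⟨i, c, ?_, hc.symm⟩
  rintro rfl
  exact hv.ne_zero i (by simpa using hc.symm)

end PlaneReps

variable [Fintype K]

-- The order `n` of the projective plane satisfies `n² + n + 1 = q² + q + 1`, so it is `q`, and
-- every line has `n + 1` points.
open Configuration Configuration.ofField in
lemma card_line_aux (hv : PlaneReps v) :
    Fintype.card ι = Fintype.card K ^ 2 + Fintype.card K + 1 ∧
      ∀ j, (line v j).card = Fintype.card K + 1 := by
  let e : ι ≃ Projectivization K (Fin 3 → K) := Equiv.ofBijective _ hv.bijective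
  have : Fintype (Projectivization K (Fin 3 → K)) := Fintype.ofEquiv ι e
  have hc : Fintype.card ι = Fintype.card K ^ 2 + Fintype.card K + 1 := by
    rw [Fintype.card_congr e, ← Nat.card_eq_fintype_card,
      Projectivization.card_of_finrank K (Fin 3 → K) (n := 3) (by simp), Nat.card_eq_fintype_card]
    simp [Finset.sum_range_succ]
    ring
  have ho : ProjectivePlane.order (Projectivization K (Fin 3 → K))
      (Projectivization K (Fin 3 → K)) = Fintype.card K := by
    have h := ProjectivePlane.card_points (P := Projectivization K (Fin 3 → K))
      (Projectivization K (Fin 3 → K))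
    rw [← Fintype.card_congr e, hc] at h
    nlinarith
  refine ⟨hc, fun j => ?_⟩
  have h := ProjectivePlane.pointCount_eq (Projectivization K (Fin 3 → K)) (e j)
  rw [ho] at h
  rw [← h, pointCount, ← Fintype.card_coe, ← Nat.card_eq_fintype_card]
  refine Nat.card_congr (e.subtypeEquiv fun i => ?_)
  rw [mem_iff, mem_line]
  exact (dotProduct_comm (v j) (v i)).congr_left.trans
    (Projectivization.orthogonal_mk (hv.ne_zero i) (hv.ne_zero j)).symm

lemma card_points (hv : PlaneReps v) :
    Fintype.card ι = Fintype.card K ^ 2 + Fintype.card K + 1 := (card_line_aux hv).1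

lemma card_line (hv : PlaneReps v) (j : ι) : (line v j).card = Fintype.card K + 1 :=
  (card_line_aux hv).2 j

open Configuration.ofField in
lemma line_unique (hv : PlaneReps v) {i i' j j' : ι} (hij : i ∈ line v j) (hij' : i ∈ line v j')
    (hi'j : i' ∈ line v j) (hi'j' : i' ∈ line v j') : i = i' ∨ j = j' := by
  rw [mem_line, dotProduct_comm] at *
  have := eq_or_eq_of_orthogonal
    ((Projectivization.orthogonal_mk (hv.ne_zero i) (hv.ne_zero j)).2 hij)
    ((Projectivization.orthogonal_mk (hv.ne_zero i') (hv.ne_zero j)).2 hi'j)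
    ((Projectivization.orthogonal_mk (hv.ne_zero i) (hv.ne_zero j')).2 hij')
    ((Projectivization.orthogonal_mk (hv.ne_zero i') (hv.ne_zero j')).2 hi'j')
  exact this.imp (fun h => hv.bijective.1 h) (fun h => hv.bijective.1 h)

/-- Two linear conditions on three coefficients: a matrix with a zero third row has a nontrivial
kernel. -/
lemma exists_line_through (hv : PlaneReps v) (i i' : ι) :
    ∃ j, i ∈ line v j ∧ i' ∈ line v j := by
  obtain ⟨w, hw, h1, h2⟩ : ∃ w : Fin 3 → K, w ≠ 0 ∧ v i ⬝ᵥ w = 0 ∧ v i' ⬝ᵥ w = 0 := by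
    obtain ⟨w, hw, h⟩ := Matrix.exists_mulVec_eq_zero_iff.2
      (show (Matrix.of ![v i, v i', 0]).det = 0 from
        Matrix.det_eq_zero_of_row_eq_zero 2 (fun j => by simp))
    exact ⟨w, hw, by simpa [Matrix.mulVec] using congrFun h 0,
      by simpa [Matrix.mulVec] using congrFun h 1⟩
  obtain ⟨j, c, -, hc⟩ := hv.exists_smul hw
  refine ⟨j, ?_, ?_⟩ <;> rw [mem_line, hc, dotProduct_comm] <;> simp [h1, h2]

/-- Incidence is symmetric in its two labels, so the line joining the points `j` and `j'` is
labelled by the common point of the lines `j` and `j'`. -/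
lemma card_line_inter (hv : PlaneReps v) {j j' : ι} (h : j ≠ j') :
    (line v j ∩ line v j').card = 1 := by
  obtain ⟨i, hi, hi'⟩ := exists_line_through hv j j'
  rw [card_eq_one]
  refine ⟨i, eq_singleton_iff_unique_mem.2 ⟨?_, fun k hk => ?_⟩⟩
  · exact mem_inter.2 ⟨mem_line_comm.1 hi, mem_line_comm.1 hi'⟩
  · rw [mem_inter] at hk
    exact (line_unique hv hk.1 hk.2 (mem_line_comm.1 hi) (mem_line_comm.1 hi')).resolve_right h

lemma exists_line_separating (hv : PlaneReps v) {i i' : ι} (h : i ≠ i') :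
    ∃ j, i ∉ line v j ∧ i' ∈ line v j := by
  by_contra! hc
  have h1 : line v i' ⊆ line v i ∩ line v i' := fun j hj =>
    mem_inter.2 ⟨by
      by_contra hji
      exact hc j (fun hh => hji (mem_line_comm.1 hh)) (mem_line_comm.1 hj), hj⟩
  have h2 := card_le_card h1
  rw [card_line_inter hv h, card_line hv] at h2
  have := Fintype.one_lt_card (α := K)
  omega

lemma exists_notMem_line (hv : PlaneReps v) (i : ι) : ∃ j, i ∉ line v j := by
  by_contra! hc
  have h1 : (univ : Finset ι) ⊆ line v i := fun j _ => mem_line_comm.1 (hc j)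
  have h2 := card_le_card h1
  rw [card_line hv, card_univ, card_points hv] at h2
  have := Fintype.one_lt_card (α := K)
  nlinarith

end Plane

/-! ### Relations among evaluations of forms, and their residuals off a curve -/

section Forms

variable {K ι W : Type*} [Field K] [Fintype ι] [AddCommGroup W] [Module K W] {v : ι → Fin 3 → K}

/-- The listed points at which a ternary form vanishes. -/
def zeros (v : ι → Fin 3 → K) (f : MvPolynomial (Fin 3) K) : Finset ι :=
  univ.filter fun i => MvPolynomial.eval (v i) f = 0

lemma mem_zeros {f : MvPolynomial (Fin 3) K} {i : ι} :
    i ∈ zeros v f ↔ MvPolynomial.eval (v i) f = 0 := by simp [zeros]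

/-- The linear form with a given coefficient vector. -/
def lin (a : Fin 3 → K) : MvPolynomial (Fin 3) K := ∑ k, MvPolynomial.C (a k) * MvPolynomial.X k

lemma eval_lin (a w : Fin 3 → K) : MvPolynomial.eval w (lin a) = a ⬝ᵥ w := by
  simp [lin, dotProduct]

lemma isHomogeneous_lin (a : Fin 3 → K) : (lin a).IsHomogeneous 1 :=
  MvPolynomial.IsHomogeneous.sum _ _ _ fun _ _ => MvPolynomial.isHomogeneous_C_mul_X _ _

lemma zeros_lin (j : ι) : zeros v (lin (v j)) = line v j := by
  ext i; rw [mem_zeros, mem_line, eval_lin]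

lemma lin_ne_zero {a : Fin 3 → K} (ha : a ≠ 0) : lin a ≠ 0 := by
  intro h
  apply ha
  ext k
  have := congrArg (MvPolynomial.eval (Pi.single k 1)) h
  simpa [eval_lin] using this

/-- `c` is a linear relation with coefficients in `W` among the evaluations of the ternary forms
of degree `d` at the listed points. -/
def Rel (v : ι → Fin 3 → K) (d : ℕ) (c : ι → W) : Prop :=
  ∀ f : MvPolynomial (Fin 3) K, f.IsHomogeneous d → ∑ i, MvPolynomial.eval (v i) f • c i = 0

/-- The support of a vector. -/
def supp (c : ι → W) : Finset ι := univ.filter fun i => c i ≠ 0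

lemma mem_supp {c : ι → W} {i : ι} : i ∈ supp c ↔ c i ≠ 0 := by simp [supp]

lemma supp_eq_empty {c : ι → W} : supp c = ∅ ↔ c = 0 := by
  simp [Finset.ext_iff, mem_supp, funext_iff]

/-- The engine of all classifications: a lower degree is paid for by erasing the points of the curve
`f = 0` from the support. -/
lemma Rel.mul {d e : ℕ} {c : ι → W} (h : Rel v (d + e) c) {f : MvPolynomial (Fin 3) K}
    (hf : f.IsHomogeneous e) : Rel v d fun i => MvPolynomial.eval (v i) f • c i := by
  intro g hg
  simpa [mul_smul] using h (g * f) (hg.mul hf)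

lemma supp_mul (c : ι → W) (f : MvPolynomial (Fin 3) K) :
    supp (fun i => MvPolynomial.eval (v i) f • c i) = supp c \ zeros v f := by
  ext i
  simp [mem_supp, mem_zeros, and_comm]

variable [Fintype K]

/-- Given two points of the support, a line through one and not the other removes at least one point
and leaves a nonzero relation of degree one less. -/
lemma Rel.card_supp_ge (hv : PlaneReps v) {d : ℕ} {c : ι → W} (h : Rel v d c) (hc : c ≠ 0) :
    d + 2 ≤ (supp c).card := by
  induction d generalizing c with
  | zero =>
    by_contra! hlt
    have h1 := h 1 (MvPolynomial.isHomogeneous_one _ _)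
    obtain ⟨i, hi⟩ := nonempty_iff_ne_empty.2 (mt supp_eq_empty.1 hc)
    have hs : supp c = {i} := by
      apply eq_singleton_iff_unique_mem.2 ⟨hi, fun j hj => ?_⟩
      exact (card_le_one.1 (by omega)) j hj i hi
    have h2 : ∑ j, MvPolynomial.eval (v j) (1 : MvPolynomial (Fin 3) K) • c j = c i := by
      rw [Finset.sum_eq_single i] <;> simp
      intro j hj
      by_contra hcj
      exact hj (by simpa [hs] using mem_supp.2 hcj)
    exact mem_supp.1 hi (h2.symm.trans h1)
  | succ d ih =>
    obtain ⟨i, hi⟩ := nonempty_iff_ne_empty.2 (mt supp_eq_empty.1 hc)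
    have key : ∀ j, i ∉ line v j → d + 2 ≤ (supp c \ line v j).card := by
      intro j hj
      have h1 := ih (h.mul (isHomogeneous_lin (v j))) (by
        rw [Ne, ← supp_eq_empty, supp_mul, zeros_lin, ← Ne, ← nonempty_iff_ne_empty]
        exact ⟨i, mem_sdiff.2 ⟨hi, hj⟩⟩)
      rwa [supp_mul, zeros_lin] at h1
    obtain ⟨j₀, hj₀⟩ := exists_notMem_line hv i
    have h0 := (key j₀ hj₀).trans (card_le_card sdiff_subset)
    obtain ⟨i', hi', hne⟩ := exists_mem_ne (show 1 < (supp c).card by omega) i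
    obtain ⟨j, hj, hj'⟩ := exists_line_separating hv hne.symm
    have h2 : (supp c \ line v j).card < (supp c).card :=
      card_lt_card (Finset.ssubset_iff_subset_ne.2 ⟨sdiff_subset, fun he => by
        have := he ▸ hi'
        exact (mem_sdiff.1 this).2 hj'⟩)
    have := key j hj
    omega

lemma Rel.eq_zero (hv : PlaneReps v) {d : ℕ} {c : ι → W} (h : Rel v d c)
    (hc : (supp c).card ≤ d + 1) : c = 0 := by
  by_contra hne
  have := h.card_supp_ge hv hne
  omega

/-- Removing the points on a curve from the support of a relation. -/
lemma Rel.card_sdiff_ge (hv : PlaneReps v) {d e : ℕ} {c : ι → W} (h : Rel v (d + e) c)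
    {f : MvPolynomial (Fin 3) K} (hf : f.IsHomogeneous e) (hns : ¬ supp c ⊆ zeros v f) :
    d + 2 ≤ (supp c \ zeros v f).card := by
  rw [← supp_mul]
  apply (h.mul hf).card_supp_ge hv
  rw [Ne, ← supp_eq_empty, supp_mul, sdiff_eq_empty_iff_subset]
  exact hns

lemma exists_max_line (hv : PlaneReps v) (S : Finset ι) :
    ∃ j, ∀ j', (S ∩ line v j').card ≤ (S ∩ line v j).card := by
  have : Nonempty ι := by
    rw [← Fintype.card_pos_iff, card_points hv]; omega
  obtain ⟨j, -, hj⟩ := exists_max_image univ (fun j => (S ∩ line v j).card) univ_nonempty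
  exact ⟨j, fun j' => hj j' (mem_univ _)⟩

lemma two_le_of_max_line (hv : PlaneReps v) {S : Finset ι} {j : ι}
    (hj : ∀ j', (S ∩ line v j').card ≤ (S ∩ line v j).card) (hS : 2 ≤ S.card) :
    2 ≤ (S ∩ line v j).card := by
  obtain ⟨a, ha, b, hb, hab⟩ := one_lt_card.1 hS
  obtain ⟨j', h1, h2⟩ := exists_line_through hv a b
  refine le_trans ?_ (hj j')
  exact one_lt_card.2 ⟨a, mem_inter.2 ⟨ha, h1⟩, b, mem_inter.2 ⟨hb, h2⟩, hab⟩

/-- A relation in degree `d` supported on at most `2 d + 1` points is supported on a line. -/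
lemma Rel.exists_line (hv : PlaneReps v) {d : ℕ} {c : ι → W} (h : Rel v d c)
    (hc : (supp c).card ≤ 2 * d + 1) : ∃ j, supp c ⊆ line v j := by
  induction d generalizing c with
  | zero =>
    obtain ⟨j, -⟩ := exists_max_line hv (supp c)
    have := h.eq_zero hv (by omega)
    exact ⟨j, by simp [supp_eq_empty.2 this]⟩
  | succ d ih =>
    obtain ⟨j, hj⟩ := exists_max_line hv (supp c)
    refine ⟨j, ?_⟩
    by_contra hns
    have hcard := card_inter_add_card_sdiff (supp c) (line v j)
    have h1 := Rel.card_sdiff_ge hv h (isHomogeneous_lin (v j)) (by rwa [zeros_lin])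
    rw [zeros_lin] at h1
    have h2 := two_le_of_max_line hv hj (by omega)
    obtain ⟨j', hj'⟩ := ih (h.mul (isHomogeneous_lin (v j))) (by
      rw [supp_mul, zeros_lin]; omega)
    rw [supp_mul, zeros_lin] at hj'
    -- The residual has at least `d + 2` points and lies on `j'`. By maximality `j` then has as
    -- many, which makes at least `2 d + 4` points, one more than allowed.
    have h3 : (supp c \ line v j).card ≤ (supp c ∩ line v j').card :=
      card_le_card fun x hx => mem_inter.2 ⟨(mem_sdiff.1 hx).1, hj' hx⟩
    have h4 := hj j'
    omega

end Forms

/-! ### Dimension of the space of ternary forms -/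

section Dimension

variable (K : Type*) [Field K]

/-- The space of ternary forms of degree `d`. -/
abbrev Form (d : ℕ) : Submodule K (MvPolynomial (Fin 3) K) :=
  MvPolynomial.homogeneousSubmodule (Fin 3) K d

instance (d : ℕ) : FiniteDimensional K (Form K d) :=
  Module.Finite.iff_fg.2 (MvPolynomial.homogeneousSubmodule_fg (Fin 3) K d)

lemma finrank_form (d : ℕ) : Module.finrank K (Form K d) = (d + 2).choose 2 := by
  have h : Form K d = MvPolynomial.restrictSupport K {m : Fin 3 →₀ ℕ | m.degree = d} :=
    MvPolynomial.homogeneousSubmodule_eq_finsupp_supported (σ := Fin 3) (R := K) d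
  rw [h, Module.finrank_eq_nat_card_basis (MvPolynomial.basisRestrictSupport K _)]
  have h2 : {m : Fin 3 →₀ ℕ | m.degree = d} =
      (Finset.finsuppAntidiag (univ : Finset (Fin 3)) d : Set (Fin 3 →₀ ℕ)) := by
    ext m
    simp [Finset.mem_finsuppAntidiag, Finsupp.degree_eq_sum]
  rw [h2, Nat.card_coe_set_eq, Set.ncard_coe_finset]
  rw [Finset.card_finsuppAntidiag_nat_eq_choose]
  simp
  rw [Nat.add_comm, ← Nat.choose_symm_add]

end Dimension

/-! ### Conditions imposed by point sets, and the number of relations on a curve -/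

section Evaluation

variable {K ι W : Type*} [Field K] [Fintype ι] [AddCommGroup W] [Module K W] {v : ι → Fin 3 → K}

/-- Evaluation of the forms of degree `d` at the points of `T`. -/
def evalOn (v : ι → Fin 3 → K) (d : ℕ) (T : Finset ι) : Form K d →ₗ[K] (T → K) :=
  (LinearMap.pi fun i : T => (MvPolynomial.aeval (R := K) (v i)).toLinearMap) ∘ₗ (Form K d).subtype

lemma evalOn_apply (d : ℕ) (T : Finset ι) (f : Form K d) (i : T) :
    evalOn v d T f i = MvPolynomial.eval (v i) f := by
  simp [evalOn, MvPolynomial.aeval_eq_eval]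

lemma sum_eq_sum_coe {T : Finset ι} {g : ι → W} (h : ∀ i, i ∉ T → g i = 0) :
    ∑ i, g i = ∑ i : T, g i := by
  rw [Finset.sum_coe_sort T g]
  exact (Finset.sum_subset (subset_univ _) fun i _ hi => h i hi).symm

/-- A linear functional on `K^T` that kills the image of evaluation is the same thing as a relation
supported on `T`. -/
lemma evalOn_surjective {d : ℕ} {T : Finset ι}
    (h : ∀ c : ι → K, Rel v d c → supp c ⊆ T → c = 0) :
    Function.Surjective (evalOn v d T) := by
  rw [← LinearMap.dualMap_injective_iff, injective_iff_map_eq_zero]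
  intro φ hφ
  let c : ι → K := fun i => if hi : i ∈ T then φ (Pi.single ⟨i, hi⟩ 1) else 0
  have hc0 : ∀ i, i ∉ T → c i = 0 := fun i hi => by simp [c, hi]
  have hcT : ∀ i : T, c i = φ (Pi.single i 1) := fun i => by simp [c]
  have hc : c = 0 := by
    apply h c
    · intro f hf
      have := LinearMap.congr_fun hφ ⟨f, hf⟩
      rw [LinearMap.dualMap_apply, ← Finset.univ_sum_single (evalOn v d T ⟨f, hf⟩), map_sum] at this
      have h1 : ∀ i : T, φ (Pi.single i (evalOn v d T ⟨f, hf⟩ i)) =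
          MvPolynomial.eval (v i) f * φ (Pi.single i 1) := fun i => by
        rw [← evalOn_apply d T ⟨f, hf⟩ i, ← smul_eq_mul, ← map_smul, ← Pi.single_smul, smul_eq_mul,
          mul_one]
      rw [sum_eq_sum_coe (T := T) (fun i hi => by simp [hc0 i hi])]
      simpa only [hcT, h1, smul_eq_mul, LinearMap.zero_apply] using this
    · intro i hi
      by_contra hiT
      exact mem_supp.1 hi (hc0 i hiT)
  apply LinearMap.pi_ext'
  intro i
  ext
  simpa [hcT] using congrFun hc i

/-- The forms of degree `d` vanishing at the points of `T`. -/
def vanishing (v : ι → Fin 3 → K) (d : ℕ) (T : Finset ι) : Submodule K (MvPolynomial (Fin 3) K) :=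
  (LinearMap.ker (evalOn v d T)).map (Form K d).subtype

lemma mem_vanishing {d : ℕ} {T : Finset ι} {f : MvPolynomial (Fin 3) K} :
    f ∈ vanishing v d T ↔ f.IsHomogeneous d ∧ ∀ i ∈ T, MvPolynomial.eval (v i) f = 0 := by
  simp only [vanishing, Submodule.mem_map, LinearMap.mem_ker, funext_iff, evalOn_apply]
  constructor
  · rintro ⟨g, hg, rfl⟩
    exact ⟨g.2, fun i hi => hg ⟨i, hi⟩⟩
  · rintro ⟨hf, h⟩
    exact ⟨⟨f, hf⟩, fun i => h i i.2, rfl⟩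

instance (d : ℕ) (T : Finset ι) : FiniteDimensional K (vanishing v d T) := by
  unfold vanishing; infer_instance

lemma finrank_vanishing_add (d : ℕ) (T : Finset ι) :
    Module.finrank K (LinearMap.range (evalOn v d T)) + Module.finrank K (vanishing v d T) =
      (d + 2).choose 2 := by
  rw [vanishing, Submodule.finrank_map_subtype_eq, LinearMap.finrank_range_add_finrank_ker,
    finrank_form]

lemma finrank_vanishing_ge (d : ℕ) (T : Finset ι) :
    (d + 2).choose 2 ≤ T.card + Module.finrank K (vanishing v d T) := by
  rw [← finrank_vanishing_add (v := v) d T]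
  gcongr
  simpa using (LinearMap.range (evalOn v d T)).finrank_le

lemma finrank_vanishing {d : ℕ} {T : Finset ι}
    (h : ∀ c : ι → K, Rel v d c → supp c ⊆ T → c = 0) :
    T.card + Module.finrank K (vanishing v d T) = (d + 2).choose 2 := by
  rw [← finrank_vanishing_add (v := v) d T, LinearMap.range_eq_top.2 (evalOn_surjective h)]
  simp

lemma exists_ne_zero_of_card_lt {d : ℕ} {T : Finset ι} (h : T.card < (d + 2).choose 2) :
    ∃ f : MvPolynomial (Fin 3) K, f ≠ 0 ∧ f.IsHomogeneous d ∧ T ⊆ zeros v f := by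
  have h1 := finrank_vanishing_ge (v := v) d T
  obtain ⟨⟨f, hf⟩, hne⟩ := (Module.finrank_pos_iff_exists_ne_zero (R := K)
    (M := vanishing v d T)).1 (by omega)
  rw [mem_vanishing] at hf
  exact ⟨f, fun h0 => hne (Subtype.ext h0), hf.1, fun i hi => mem_zeros.2 (hf.2 i hi)⟩

lemma supp_subset_sdiff {c : ι → W} {S J : Finset ι} (hc : supp c ⊆ S) (hJ : ∀ j : J, c j = 0) :
    supp c ⊆ S \ J := fun i hi =>
  mem_sdiff.2 ⟨hc hi, fun hiJ => mem_supp.1 hi (hJ ⟨i, hiJ⟩)⟩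

/-- If `S` lies on a curve of degree `e`, any set `J` of coordinates whose complement in `S`
supports no relation, of the size predicted by the dimension count, parametrises the relations
supported on `S`. -/
lemma natCard_rel {d e : ℕ} {g : MvPolynomial (Fin 3) K}
    (hg : g.IsHomogeneous e) (hg0 : g ≠ 0) {S J : Finset ι} (hS : S ⊆ zeros v g) (hJS : J ⊆ S)
    (hK : ∀ c : ι → K, Rel v (d + e) c → supp c ⊆ S \ J → c = 0)
    (hW : ∀ c : ι → W, Rel v (d + e) c → supp c ⊆ S \ J → c = 0)
    (hcard : J.card + (d + e + 2).choose 2 ≤ S.card + (d + 2).choose 2) :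
    Nat.card {c : ι → W // Rel v (d + e) c ∧ supp c ⊆ S} = Nat.card W ^ J.card := by
  let ext : (S → K) → ι → K := fun c i => if hi : i ∈ S then c ⟨i, hi⟩ else 0
  have ext_coe : ∀ (c : S → K) (i : S), ext c i = c i := fun c i => by simp [ext]
  have ext_notMem : ∀ (c : S → K) (i : ι), i ∉ S → ext c i = 0 := fun c i hi => by simp [ext, hi]
  have ext_supp : ∀ c : S → K, supp (ext c) ⊆ S := fun c i hi => by
    by_contra hiS
    exact mem_supp.1 hi (ext_notMem c i hiS)
  let ψ : (S → K) →ₗ[K] Module.Dual K (Form K (d + e)) :=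
    (evalOn v (d + e) S).dualMap ∘ₗ (dotProductEquiv K S).toLinearMap
  have hψ : ∀ (c : S → K) (f : Form K (d + e)),
      ψ c f = ∑ i, MvPolynomial.eval (v i) f.1 • ext c i := by
    intro c f
    rw [sum_eq_sum_coe (T := S) (fun i hi => by simp [ext_notMem c i hi])]
    simp [ψ, dotProduct, evalOn_apply, ext_coe, mul_comm]
  have hker : ∀ c : S → K, c ∈ LinearMap.ker ψ → Rel v (d + e) (ext c) := by
    intro c hc f hf
    rw [← hψ c ⟨f, hf⟩, LinearMap.mem_ker.1 hc, LinearMap.zero_apply]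
  let μ : Form K d →ₗ[K] Form K (d + e) :=
    ((LinearMap.mulRight K g).comp (Form K d).subtype).codRestrict _ fun k => k.2.mul hg
  have hμ : Function.Injective μ := by
    intro k k' h
    have : k.1 * g = k'.1 * g := congrArg Subtype.val h
    exact Subtype.ext (mul_right_cancel₀ hg0 this)
  -- Multiples of `g` vanish on `S`, which bounds the rank of the conditions from above and so the
  -- space of relations from below, by `J.card`. Restriction to `J` is injective on relations, which
  -- gives the matching upper bound.
  have hrange : LinearMap.range ψ ≤ (LinearMap.range μ).dualAnnihilator := by
    rintro _ ⟨c, rfl⟩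
    rw [Submodule.mem_dualAnnihilator]
    rintro _ ⟨k, rfl⟩
    rw [hψ]
    refine Finset.sum_eq_zero fun i _ => ?_
    by_cases hi : i ∈ S
    · have : MvPolynomial.eval (v i) g = 0 := mem_zeros.1 (hS hi)
      have hμv : (μ k).1 = k.1 * g := rfl
      simp [hμv, this]
    · simp [ext_notMem c i hi]
  have h1 := Submodule.finrank_mono hrange
  have h2 := Subspace.finrank_add_finrank_dualAnnihilator_eq (LinearMap.range μ)
  have h3 := LinearMap.finrank_range_add_finrank_ker ψ
  rw [LinearMap.finrank_range_of_inj hμ, finrank_form, finrank_form] at h2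
  rw [Module.finrank_fintype_fun_eq_card, Fintype.card_coe] at h3
  let ρ : LinearMap.ker ψ →ₗ[K] (J → K) :=
    (LinearMap.funLeft K K fun j : J => (⟨j, hJS j.2⟩ : S)) ∘ₗ (LinearMap.ker ψ).subtype
  have hρ : ∀ (c : LinearMap.ker ψ) (j : J), ρ c j = ext c.1 j := fun c j => (ext_coe c.1 ⟨j, hJS j.2⟩).symm
  have hρi : Function.Injective ρ := by
    rw [injective_iff_map_eq_zero]
    intro c hc
    have : ext c.1 = 0 := hK _ (hker _ c.2) (supp_subset_sdiff (ext_supp _) fun j => by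
      rw [← hρ, hc]; rfl)
    apply Subtype.ext
    funext i
    rw [← ext_coe c.1 i, this]; rfl
  have hρs : Function.Surjective ρ := by
    rw [← LinearMap.range_eq_top]
    apply Submodule.eq_top_of_finrank_eq
    apply le_antisymm (Submodule.finrank_le _)
    rw [LinearMap.finrank_range_of_inj hρi, Module.finrank_fintype_fun_eq_card, Fintype.card_coe]
    omega
  -- The scalar relations dual to the coordinates in `J`. A `W`-valued relation is their combination
  -- with coefficients its values on `J`, so that the count is a power of the size of `W`.
  choose b hb using fun j : J => hρs (Pi.single j 1)
  have hbij : Function.Bijective (fun (c : {c : ι → W // Rel v (d + e) c ∧ supp c ⊆ S}) (j : J) =>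
      c.1 j) := by
    constructor
    · intro c c' h
      have h0 : c.1 - c'.1 = 0 := by
        apply hW
        · intro f hf
          simp [smul_sub, c.2.1 f hf, c'.2.1 f hf]
        · apply supp_subset_sdiff
          · intro i hi
            by_contra hiS
            have h1 : c.1 i = 0 := by
              by_contra h
              exact hiS (c.2.2 (mem_supp.2 h))
            have h2 : c'.1 i = 0 := by
              by_contra h
              exact hiS (c'.2.2 (mem_supp.2 h))
            exact mem_supp.1 hi (by simp [h1, h2])
          · intro j
            simpa [sub_eq_zero] using congrFun h j
      exact Subtype.ext (sub_eq_zero.1 h0)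
    · intro w
      refine ⟨⟨fun i => ∑ j, ext (b j) i • w j, ?_, ?_⟩, ?_⟩
      · intro f hf
        simp_rw [Finset.smul_sum, smul_smul]
        rw [Finset.sum_comm]
        refine Finset.sum_eq_zero fun j _ => ?_
        rw [← Finset.sum_smul]
        have := hker _ (b j).2 f hf
        simp only [smul_eq_mul] at this
        rw [this, zero_smul]
      · intro i hi
        by_contra hiS
        exact mem_supp.1 hi (Finset.sum_eq_zero fun j _ => by rw [ext_notMem _ _ hiS, zero_smul])
      · ext j
        simp only
        rw [Finset.sum_eq_single j]
        · rw [← hρ, hb]; simp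
        · intro j' _ hne
          rw [← hρ, hb]; simp [hne.symm]
        · simp
  rw [Nat.card_eq_of_bijective _ hbij, Nat.card_fun, Nat.card_eq_fintype_card (α := J),
    Fintype.card_coe]

end Evaluation

/-! ### Classification of the supports of relations on cubics with at most nine points -/

section Supports

variable {K ι W : Type*} [Field K] [Fintype K] [Fintype ι] [AddCommGroup W] [Module K W]
  {v : ι → Fin 3 → K}

/-- No four points of `T` are collinear. -/
def NoFour (v : ι → Fin 3 → K) (T : Finset ι) : Prop := ∀ j, (T ∩ line v j).card ≤ 3

/-- No five points of `T` are collinear. -/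
def NoFive (v : ι → Fin 3 → K) (T : Finset ι) : Prop := ∀ j, (T ∩ line v j).card ≤ 4

/-- No seven points of `T` lie on a conic. -/
def NoSeven (v : ι → Fin 3 → K) (T : Finset ι) : Prop :=
  ∀ f : MvPolynomial (Fin 3) K, f ≠ 0 → f.IsHomogeneous 2 → (T ∩ zeros v f).card ≤ 6

/-- The points of `T` lie on a conic. -/
def OnConic (v : ι → Fin 3 → K) (T : Finset ι) : Prop :=
  ∃ f : MvPolynomial (Fin 3) K, f ≠ 0 ∧ f.IsHomogeneous 2 ∧ T ⊆ zeros v f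

/-- The points of `T` lie on a line. -/
def OnLine (v : ι → Fin 3 → K) (T : Finset ι) : Prop := ∃ j, T ⊆ line v j

/-- `T` consists of `a` points on the line `j` only, `b` points on the line `j'` only, and
possibly the common point of the two lines. -/
def PairType (v : ι → Fin 3 → K) (j j' : ι) (a b : ℕ) (T : Finset ι) : Prop :=
  T ⊆ line v j ∪ line v j' ∧ (T \ line v j').card = a ∧ (T \ line v j).card = b

lemma NoFour.noFive {T : Finset ι} (h : NoFour v T) : NoFive v T := fun j => (h j).trans (by simp)

lemma NoFive.mono {S T : Finset ι} (h : NoFive v T) (hS : S ⊆ T) : NoFive v S := fun j =>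
  (card_le_card (inter_subset_inter_right hS)).trans (h j)

lemma zeros_mul (f g : MvPolynomial (Fin 3) K) : zeros v (f * g) = zeros v f ∪ zeros v g := by
  ext i; simp [mem_zeros]

lemma onConic_of_subset_lines (hv : PlaneReps v) {T : Finset ι} {j j' : ι}
    (h : T ⊆ line v j ∪ line v j') : OnConic v T :=
  ⟨lin (v j) * lin (v j'), mul_ne_zero (lin_ne_zero (hv.ne_zero j)) (lin_ne_zero (hv.ne_zero j')),
    (isHomogeneous_lin _).mul (isHomogeneous_lin _), by rwa [zeros_mul, zeros_lin, zeros_lin]⟩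

lemma PairType.card {j j' : ι} {a b : ℕ} {T : Finset ι} (h : PairType v j j' a b T) :
    T.card = a + b + (T ∩ (line v j ∩ line v j')).card := by
  obtain ⟨h1, rfl, rfl⟩ := h
  have : T = (T \ line v j') ∪ ((T \ line v j) ∪ (T ∩ (line v j ∩ line v j'))) := by
    ext i
    have := @h1 i
    simp only [mem_union, mem_sdiff, mem_inter] at *
    tauto
  conv_lhs => rw [this]
  rw [card_union_of_disjoint, card_union_of_disjoint, add_assoc]
  all_goals
    rw [disjoint_left]
    intro i
    have := @h1 i
    simp only [mem_union, mem_sdiff, mem_inter] at *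
    tauto

lemma PairType.symm {j j' : ι} {a b : ℕ} {T : Finset ι} (h : PairType v j j' a b T) :
    PairType v j' j b a T := ⟨by rw [union_comm]; exact h.1, h.2.2, h.2.1⟩

lemma PairType.card_inter_left {j j' : ι} {a b : ℕ} {T : Finset ι} (h : PairType v j j' a b T) :
    (T ∩ line v j).card + b = T.card := by
  rw [← h.2.2, card_inter_add_card_sdiff]

lemma PairType.card_inter_right {j j' : ι} {a b : ℕ} {T : Finset ι} (h : PairType v j j' a b T) :
    (T ∩ line v j').card + a = T.card := by
  rw [← h.2.1, card_inter_add_card_sdiff]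

lemma card_inter_line_le_two (hv : PlaneReps v) {T : Finset ι} {j j' k : ι}
    (h : T ⊆ line v j ∪ line v j') (hk : k ≠ j) (hk' : k ≠ j') : (T ∩ line v k).card ≤ 2 := by
  have : T ∩ line v k ⊆ (line v k ∩ line v j) ∪ (line v k ∩ line v j') := by
    intro i hi
    have := @h i
    simp only [mem_union, mem_inter] at *
    tauto
  refine (card_le_card this).trans ((card_union_le _ _).trans ?_)
  rw [card_line_inter hv hk, card_line_inter hv hk']

lemma PairType.noFive (hv : PlaneReps v) {j j' : ι} {a b : ℕ} {T : Finset ι}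
    (h : PairType v j j' a b T) (ha : T.card ≤ a + 4) (hb : T.card ≤ b + 4) : NoFive v T := by
  intro k
  by_cases hk : k = j
  · subst hk; have := h.card_inter_left; omega
  by_cases hk' : k = j'
  · subst hk'; have := h.card_inter_right; omega
  exact (card_inter_line_le_two hv h.1 hk hk').trans (by simp)

/-- Seven is `2 · 3 + 1`, so the support is collinear; it then has at most four points, fewer than
the five that a relation of degree three needs. -/
lemma Rel.eq_zero_of_noFive (hv : PlaneReps v) {c : ι → W} (h : Rel v 3 c) {S : Finset ι}
    (hS : NoFive v S) (hcard : S.card ≤ 7) (hc : supp c ⊆ S) : c = 0 := by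
  obtain ⟨j, hj⟩ := h.exists_line hv ((card_le_card hc).trans hcard)
  exact h.eq_zero hv ((card_le_card (subset_inter hc hj)).trans (hS j))

/-- A relation on cubics with at most nine points, not all collinear but with four collinear, is
supported on two lines. -/
lemma Rel.exists_pairType (hv : PlaneReps v) {c : ι → W} (h : Rel v 3 c)
    (hcard : (supp c).card ≤ 9) (hl : ¬ OnLine v (supp c)) (h4 : ¬ NoFour v (supp c)) :
    ∃ j j', j ≠ j' ∧ (((supp c).card = 8 ∧ PairType v j j' 4 4 (supp c)) ∨
      ((supp c).card = 9 ∧ PairType v j j' 5 4 (supp c)) ∨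
      ((supp c).card = 9 ∧ PairType v j j' 4 4 (supp c))) := by
  obtain ⟨j, hj⟩ := exists_max_line hv (supp c)
  have ha : 4 ≤ (supp c ∩ line v j).card := by
    by_contra hlt
    exact h4 fun j' => (hj j').trans (by omega)
  have hns : ¬ supp c ⊆ line v j := fun hs => hl ⟨j, hs⟩
  have hcd := card_inter_add_card_sdiff (supp c) (line v j)
  -- Off the richest line there remain at least `2 + 2` and at most `9 - 4 = 2 · 2 + 1` points
  -- carrying a relation of degree two, hence collinear points.
  have h1 := Rel.card_sdiff_ge (d := 2) hv h (isHomogeneous_lin (v j)) (by rwa [zeros_lin])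
  rw [zeros_lin] at h1
  obtain ⟨j', hj'⟩ := Rel.exists_line (d := 2) hv (h.mul (isHomogeneous_lin (v j))) (by
    rw [supp_mul, zeros_lin]; omega)
  rw [supp_mul, zeros_lin] at hj'
  have hne : j ≠ j' := by
    rintro rfl
    apply hns
    intro i hi
    by_contra hij
    exact hij (hj' (mem_sdiff.2 ⟨hi, hij⟩))
  have hU : supp c ⊆ line v j ∪ line v j' := by
    intro i hi
    by_cases hij : i ∈ line v j
    · exact mem_union_left _ hij
    · exact mem_union_right _ (hj' (mem_sdiff.2 ⟨hi, hij⟩))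
  have hP : PairType v j j' (supp c \ line v j').card (supp c \ line v j).card (supp c) :=
    ⟨hU, rfl, rfl⟩
  have e1 := hP.card
  have e2 := hP.card_inter_right
  have e3 := hj j'
  have e4 : (supp c ∩ (line v j ∩ line v j')).card ≤ 1 :=
    (card_le_card inter_subset_right).trans (card_line_inter hv hne).le
  refine ⟨j, j', hne, ?_⟩
  -- Since `j` is a richest line, the fifth private point of type 5 + 4 lies on `j`.
  obtain ⟨s1, s2⟩ | ⟨s1, s2, s3⟩ | ⟨s1, s2, s3⟩ :
      ((supp c \ line v j').card = 4 ∧ (supp c \ line v j).card = 4) ∨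
      ((supp c \ line v j').card = 5 ∧ (supp c \ line v j).card = 4 ∧ (supp c).card = 9) ∨
      ((supp c \ line v j').card = 4 ∧ (supp c \ line v j).card = 4 ∧ (supp c).card = 9) := by
    omega
  · rw [s1, s2] at hP
    have : (supp c).card = 8 ∨ (supp c).card = 9 := by omega
    exact this.elim (fun h => Or.inl ⟨h, hP⟩) fun h => Or.inr (Or.inr ⟨h, hP⟩)
  · rw [s1, s2] at hP
    exact Or.inr (Or.inl ⟨s3, hP⟩)
  · rw [s1, s2] at hP
    exact Or.inr (Or.inr ⟨s3, hP⟩)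

lemma not_onLine_of_noFive {T : Finset ι} (h : NoFive v T) (hT : 5 ≤ T.card) : ¬ OnLine v T := by
  rintro ⟨j, hj⟩
  have := h j
  rw [inter_eq_left.2 hj] at this
  omega

/-- A conic containing seven points of the support of a relation on cubics with at most nine
points contains all of them, if no four are collinear. -/
lemma Rel.noSeven_or_onConic (hv : PlaneReps v) {c : ι → W} (h : Rel v 3 c)
    (hcard : (supp c).card ≤ 9) : OnConic v (supp c) ∨ NoSeven v (supp c) := by
  by_contra! hc
  apply hc.2
  intro f hf0 hf
  have h1 := Rel.card_sdiff_ge (d := 1) hv h hf (fun hs => hc.1 ⟨f, hf0, hf, hs⟩)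
  have := card_inter_add_card_sdiff (supp c) (zeros v f)
  omega

/-- With four collinear points the set lies on two lines. With three but not four, the five points
off that line carry a relation of degree two and would be collinear. With no three, a conic through
five of the points must contain all, since otherwise the remaining three would carry a relation of
degree one and be collinear. -/
lemma Rel.onConic_of_card_eq_eight (hv : PlaneReps v) {c : ι → W} (h : Rel v 3 c)
    (hcard : (supp c).card = 8) (hl : ¬ OnLine v (supp c)) :
    NoFive v (supp c) ∧ OnConic v (supp c) := by
  by_cases h4 : NoFour v (supp c)
  · refine ⟨h4.noFive, ?_⟩
    obtain ⟨j, hj⟩ := exists_max_line hv (supp c)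
    have hns : ¬ supp c ⊆ line v j := fun hs => hl ⟨j, hs⟩
    have hcd := card_inter_add_card_sdiff (supp c) (line v j)
    by_cases h3 : 3 ≤ (supp c ∩ line v j).card
    · obtain ⟨j', hj'⟩ := Rel.exists_line (d := 2) hv (h.mul (isHomogeneous_lin (v j))) (by
        rw [supp_mul, zeros_lin]; omega)
      rw [supp_mul, zeros_lin] at hj'
      have h1 := card_le_card (subset_inter (sdiff_subset (s := supp c) (t := line v j)) hj')
      have h5 := h4 j'
      have h6 := h4 j
      omega
    · obtain ⟨T, hT, hT5⟩ := exists_subset_card_eq (show 5 ≤ (supp c).card by omega)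
      obtain ⟨f, hf0, hf, hTf⟩ := exists_ne_zero_of_card_lt (v := v) (d := 2) (T := T)
        (by rw [hT5]; decide)
      refine ⟨f, hf0, hf, ?_⟩
      by_contra hns'
      have h1 := Rel.card_sdiff_ge (d := 1) hv h hf hns'
      have h5 : (supp c \ zeros v f).card ≤ 3 := by
        have := card_le_card (subset_inter hT hTf)
        have := card_inter_add_card_sdiff (supp c) (zeros v f)
        omega
      obtain ⟨k, hk⟩ := Rel.exists_line (d := 1) hv (h.mul hf) (by rw [supp_mul]; omega)
      rw [supp_mul] at hk
      have h6 := card_le_card (subset_inter (sdiff_subset (s := supp c) (t := zeros v f)) hk)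
      have := hj k
      omega
  · obtain ⟨j, j', hne, h8 | h9 | h9⟩ := h.exists_pairType hv (by omega) hl h4
    · exact ⟨h8.2.noFive hv (by omega) (by omega), onConic_of_subset_lines hv h8.2.1⟩
    · omega
    · omega

end Supports

/-! ### The number of relations with a given support -/

section Counting

variable {K ι : Type*} [Field K] [Fintype K] [Fintype ι] {v : ι → Fin 3 → K}

variable (v) (W : Type*) [AddCommGroup W] [Module K W] [Fintype W]

/-- The number of `W`-valued relations on cubics with support `S`. -/
def relCount (S : Finset ι) : ℕ := (univ.filter fun c : ι → W => Rel v 3 c ∧ supp c = S).card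

lemma sum_relCount (P : Finset ι → Prop) :
    ∑ S ∈ univ.filter P, relCount v W S =
      (univ.filter fun c : ι → W => Rel v 3 c ∧ P (supp c)).card := by
  rw [card_eq_sum_card_fiberwise (f := supp) (t := univ.filter P) (fun c hc => by simp_all)]
  refine Finset.sum_congr rfl fun S hS => ?_
  rw [relCount, filter_filter]
  congr 1
  ext c
  simp only [mem_filter, mem_univ, true_and] at *
  constructor
  · rintro ⟨h, rfl⟩; exact ⟨⟨h, hS⟩, rfl⟩
  · rintro ⟨⟨h, -⟩, rfl⟩; exact ⟨h, rfl⟩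

/-- Links exact supports to the linear count of `natCard_rel`; `relCount` is then solved for by
subtracting the proper subsets. -/
lemma sum_powerset_relCount (S : Finset ι) :
    ∑ T ∈ S.powerset, relCount v W T = Nat.card {c : ι → W // Rel v 3 c ∧ supp c ⊆ S} := by
  rw [Nat.card_eq_fintype_card, Fintype.card_subtype]
  refine (Finset.sum_congr ?_ fun _ _ => rfl).trans
    ((sum_relCount v W (fun T => T ⊆ S)).trans ?_)
  · ext T; simp
  · congr

variable {v W}

lemma relCount_eq_zero {S : Finset ι} (h : ∀ c : ι → W, Rel v 3 c → supp c ≠ S) :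
    relCount v W S = 0 := by
  rw [relCount, card_eq_zero, filter_eq_empty_iff]
  exact fun c _ hc => h c hc.1 hc.2

lemma relCount_empty : relCount v W ∅ = 1 := by
  rw [relCount, card_eq_one]
  refine ⟨0, ?_⟩
  ext c
  simp only [mem_filter, mem_univ, true_and, mem_singleton, supp_eq_empty]
  constructor
  · exact fun h => h.2
  · rintro rfl
    exact ⟨fun f _ => by simp, rfl⟩

lemma relCount_eq_zero_of_noFive (hv : PlaneReps v) {S : Finset ι} (h : NoFive v S)
    (h0 : S.Nonempty) (hS : S.card ≤ 7) : relCount v W S = 0 := by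
  refine relCount_eq_zero fun c hc hs => ?_
  have := hc.eq_zero_of_noFive hv h hS hs.le
  rw [supp_eq_empty.2 this] at hs
  exact h0.ne_empty hs.symm

lemma relCount_eq_zero_of_card_le_four (hv : PlaneReps v) {S : Finset ι}
    (h0 : S.Nonempty) (hS : S.card ≤ 4) : relCount v W S = 0 :=
  relCount_eq_zero_of_noFive hv (fun _ => (card_le_card inter_subset_left).trans hS) h0 (by omega)

/-- The number of words of weight `m` and full support in the dual of a Reed-Solomon code of length
`m` and dimension four over an alphabet of size `Q`. -/
def mdsCount (Q : ℤ) : ℕ → ℤ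
  | 0 => 1
  | 5 => Q - 1
  | 6 => Q ^ 2 - 1 - 6 * (Q - 1)
  | 7 => Q ^ 3 - 1 - 7 * (Q ^ 2 - 1 - 6 * (Q - 1)) - 21 * (Q - 1)
  | 8 => Q ^ 4 - 1 - 8 * (Q ^ 3 - 1 - 7 * (Q ^ 2 - 1 - 6 * (Q - 1)) - 21 * (Q - 1))
      - 28 * (Q ^ 2 - 1 - 6 * (Q - 1)) - 56 * (Q - 1)
  | 9 => Q ^ 5 - 1
      - 9 * (Q ^ 4 - 1 - 8 * (Q ^ 3 - 1 - 7 * (Q ^ 2 - 1 - 6 * (Q - 1)) - 21 * (Q - 1))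
      - 28 * (Q ^ 2 - 1 - 6 * (Q - 1)) - 56 * (Q - 1))
      - 36 * (Q ^ 3 - 1 - 7 * (Q ^ 2 - 1 - 6 * (Q - 1)) - 21 * (Q - 1))
      - 84 * (Q ^ 2 - 1 - 6 * (Q - 1)) - 126 * (Q - 1)
  | _ => 0

/-- Cubics restricted to a line form a space of dimension `10 - 6 = 4`, and any four points impose
independent conditions. -/
lemma sum_powerset_relCount_onLine (hv : PlaneReps v) {S : Finset ι} (hl : OnLine v S)
    (hS : 4 ≤ S.card) :
    ∑ T ∈ S.powerset, relCount v W T = Fintype.card W ^ (S.card - 4) := by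
  obtain ⟨j, hj⟩ := hl
  obtain ⟨J, hJS, hJ⟩ := exists_subset_card_eq (show S.card - 4 ≤ S.card by omega)
  have h4 : (S \ J).card = 4 := by rw [card_sdiff_of_subset hJS]; omega
  rw [sum_powerset_relCount, ← hJ, ← Nat.card_eq_fintype_card]
  apply natCard_rel (d := 2) (e := 1) (isHomogeneous_lin (v j)) (lin_ne_zero (hv.ne_zero j))
    (by rwa [zeros_lin]) hJS
  · exact fun c hc hs => hc.eq_zero hv ((card_le_card hs).trans h4.le)
  · exact fun c hc hs => hc.eq_zero hv ((card_le_card hs).trans h4.le)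
  · simp [Nat.choose]; omega

/-- Every subset of a collinear set is collinear, so the count depends only on the size and obeys
the recursion unfolded in `mdsCount`. -/
lemma relCount_onLine (hv : PlaneReps v) {S : Finset ι} (hl : OnLine v S) (hS : S.card ≤ 9) :
    (relCount v W S : ℤ) = mdsCount (Fintype.card W) S.card := by
  induction hm : S.card using Nat.strong_induction_on generalizing S with
  | _ m ih =>
    subst hm
    rcases S.eq_empty_or_nonempty with rfl | hne
    · simp [relCount_empty, mdsCount]
    by_cases h4 : S.card ≤ 4
    · rw [relCount_eq_zero_of_card_le_four hv hne h4]
      have := card_pos.2 hne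
      generalize S.card = m at *
      interval_cases m <;> simp [mdsCount]
    have h1 := sum_powerset_relCount_onLine (W := W) hv hl (by omega)
    rw [← Finset.sum_erase_add _ _ (mem_powerset_self S)] at h1
    -- The guard gives a function of `T.card` that vanishes on `S`, so `S` can be put back and the
    -- sum becomes one over binomial coefficients.
    have h2 : ∀ T ∈ S.powerset.erase S, (relCount v W T : ℤ) =
        if T.card < S.card then mdsCount (Fintype.card W) T.card else 0 := by
      intro T hT
      rw [mem_erase, mem_powerset] at hT
      have hlt := card_lt_card (hT.2.ssubset_of_ne hT.1)
      rw [if_pos hlt]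
      exact ih _ hlt (hl.imp fun j hj => hT.2.trans hj) (by omega) rfl
    have h3 := congrArg (Nat.cast (R := ℤ)) h1
    push_cast at h3
    rw [Finset.sum_congr rfl h2, Finset.sum_erase _ (by simp),
      Finset.sum_powerset_apply_card
        (fun m => if m < S.card then mdsCount (Fintype.card W) m else 0)] at h3
    generalize S.card = m at *
    have : 5 ≤ m := by omega
    interval_cases m <;> simp [Finset.sum_range_succ, mdsCount, Nat.choose] at h3 ⊢ <;>
      linear_combination h3

/-- Cubics restricted to a conic have dimension `10 - 3 = 7`, so eight points carry a line of
relations. Proper nonempty subsets carry none, as at most seven points with no five collinear are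
independent. -/
lemma relCount_of_onConic_eight (hv : PlaneReps v) {S : Finset ι} (h5 : NoFive v S)
    (hc : OnConic v S) (hS : S.card = 8) : (relCount v W S : ℤ) = Fintype.card W - 1 := by
  obtain ⟨g, hg0, hg, hSg⟩ := hc
  obtain ⟨J, hJS, hJ⟩ := exists_subset_card_eq (show 1 ≤ S.card by omega)
  have h7 : (S \ J).card = 7 := by rw [card_sdiff_of_subset hJS]; omega
  have h1 := sum_powerset_relCount v W S
  rw [natCard_rel (d := 1) (e := 2) hg hg0 hSg hJS
    (fun c hc hs => hc.eq_zero_of_noFive hv (h5.mono sdiff_subset) h7.le hs)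
    (fun c hc hs => hc.eq_zero_of_noFive hv (h5.mono sdiff_subset) h7.le hs)
    (by simp [Nat.choose]; omega), hJ, pow_one, Nat.card_eq_fintype_card] at h1
  have hne : S ≠ ∅ := by rintro rfl; simp at hS
  rw [← Finset.sum_subset (s₁ := {∅, S})] at h1
  · rw [sum_pair hne.symm, relCount_empty] at h1
    rw [← h1]; push_cast; ring
  · simp [insert_subset_iff]
  · intro T hT hT'
    rw [mem_powerset] at hT
    simp only [mem_insert, mem_singleton, not_or] at hT'
    have := card_lt_card (hT.ssubset_of_ne hT'.2)
    exact relCount_eq_zero_of_noFive hv (h5.mono hT) (nonempty_iff_ne_empty.2 hT'.1) (by omega)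

/-- Nine points against the same dimension seven leave a plane of relations, provided that seven
suitable points are independent; `J` is the complement of those seven. -/
lemma sum_powerset_relCount_nine {S J : Finset ι} (hv : PlaneReps v) (hc : OnConic v S)
    (hS : S.card = 9) (hJS : J ⊆ S) (hJ : J.card = 2) (h5 : NoFive v (S \ J)) :
    ∑ T ∈ S.powerset, relCount v W T = Fintype.card W ^ 2 := by
  obtain ⟨g, hg0, hg, hSg⟩ := hc
  have h7 : (S \ J).card = 7 := by rw [card_sdiff_of_subset hJS]; omega
  rw [sum_powerset_relCount, natCard_rel (d := 1) (e := 2) hg hg0 hSg hJS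
    (fun c hc hs => hc.eq_zero_of_noFive hv h5 h7.le hs)
    (fun c hc hs => hc.eq_zero_of_noFive hv h5 h7.le hs)
    (by simp [Nat.choose]; omega), hJ, Nat.card_eq_fintype_card]

lemma sum_powerset_nine {S : Finset ι} (hS : S.card = 9) (f : Finset ι → ℤ) :
    ∑ T ∈ S.powerset, f T =
      ∑ T ∈ S.powerset.filter (fun T => T.card ≤ 7), f T + ∑ i ∈ S, f (S.erase i) + f S := by
  have h8 : ∑ i ∈ S, f (S.erase i) = ∑ T ∈ S.powerset.filter (fun T => T.card = 8), f T := by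
    refine Finset.sum_bij (fun i _ => S.erase i) ?_ ?_ ?_ ?_
    · intro i hi
      simp [erase_subset, card_erase_of_mem hi, hS]
    · intro i hi k hk h
      exact erase_injOn S hi hk h
    · intro T hT
      rw [mem_filter, mem_powerset] at hT
      have : (S \ T).card = 1 := by rw [card_sdiff_of_subset hT.1]; omega
      obtain ⟨i, hi⟩ := card_eq_one.1 this
      have hiS : i ∈ S \ T := by simp [hi]
      refine ⟨i, (mem_sdiff.1 hiS).1, ?_⟩
      rw [erase_eq, ← hi, Finset.sdiff_sdiff_eq_self hT.1]
    · simp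
  have h9 : f S = ∑ T ∈ S.powerset.filter (fun T => T.card = 9), f T := by
    rw [← powersetCard_eq_filter, ← hS, powersetCard_self, sum_singleton]
  rw [h8, h9, ← sum_union, ← sum_union]
  · congr 1
    ext T
    simp only [mem_union, mem_filter, mem_powerset, ← and_or_left]
    constructor
    · intro h
      have := card_le_card h
      exact ⟨h, by omega⟩
    · exact fun h => h.1
  · rw [disjoint_left]; simp only [mem_union, mem_filter]; intros; omega
  · rw [disjoint_left]; simp only [mem_filter]; intros; omega

/-- From `Q²` are removed the zero relation and the `Q - 1` relations on each of the nine subsets of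
eight points. -/
lemma relCount_of_onConic_nine (hv : PlaneReps v) {S : Finset ι} (h4 : NoFour v S)
    (hc : OnConic v S) (hS : S.card = 9) :
    (relCount v W S : ℤ) = (Fintype.card W : ℤ) ^ 2 - 1 - 9 * (Fintype.card W - 1) := by
  obtain ⟨J, hJS, hJ⟩ := exists_subset_card_eq (show 2 ≤ S.card by omega)
  have h1 := congrArg (Nat.cast (R := ℤ)) (sum_powerset_relCount_nine (W := W) hv hc hS hJS hJ
    (h4.noFive.mono sdiff_subset))
  push_cast at h1
  rw [sum_powerset_nine hS, Finset.sum_eq_single ∅, relCount_empty] at h1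
  · rw [Finset.sum_congr rfl (fun i hi => relCount_of_onConic_eight hv
      (h4.noFive.mono (erase_subset i S)) (hc.imp fun g hg =>
        ⟨hg.1, hg.2.1, (erase_subset i S).trans hg.2.2⟩)
      (by rw [card_erase_of_mem hi, hS])), sum_const, hS] at h1
    simp at h1
    linear_combination h1
  · intro T hT hT0
    rw [mem_filter, mem_powerset] at hT
    rw [relCount_eq_zero_of_noFive hv (h4.noFive.mono hT.1) (nonempty_iff_ne_empty.2 hT0) hT.2]
    simp
  · simp

/-- A support of at most seven points would contain five collinear ones, and one of eight points
would lie on a conic. -/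
lemma Rel.supp_eq_of_noSeven {W : Type*} [AddCommGroup W] [Module K W] (hv : PlaneReps v)
    {S : Finset ι} (h4 : NoFour v S)
    (h7 : NoSeven v S) (hS : S.card ≤ 9) {c : ι → W} (hc : Rel v 3 c) (hc0 : c ≠ 0)
    (hs : supp c ⊆ S) : supp c = S ∧ S.card = 9 := by
  have h8 : 8 ≤ (supp c).card := by
    by_contra hlt
    exact hc0 (hc.eq_zero_of_noFive hv (h4.noFive.mono hs) (by omega) subset_rfl)
  have h9 : 9 ≤ (supp c).card := by
    by_contra hlt
    obtain ⟨-, f, hf0, hf, hcf⟩ := hc.onConic_of_card_eq_eight hv (by omega)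
      (not_onLine_of_noFive (h4.noFive.mono hs) (by omega))
    have h1 := h7 f hf0 hf
    have h2 := card_le_card (subset_inter hs hcf)
    omega
  have := card_le_card hs
  exact ⟨eq_of_subset_of_card_le hs (by omega), by omega⟩

/-- Nonzero relations have full support, so a relation is determined by its value at one point, and
multiples of one scalar relation realise every value. -/
lemma relCount_of_noSeven (hv : PlaneReps v) {S : Finset ι} (h4 : NoFour v S) (h7 : NoSeven v S)
    (hS : S.card = 9) (hr : ∃ c : ι → K, c ≠ 0 ∧ Rel v 3 c ∧ supp c ⊆ S) :
    (relCount v W S : ℤ) = Fintype.card W - 1 := by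
  obtain ⟨c, hc0, hc, hcS⟩ := hr
  have hcS := (hc.supp_eq_of_noSeven hv h4 h7 hS.le hc0 hcS).1
  obtain ⟨p, hp⟩ : S.Nonempty := card_pos.1 (by omega)
  have hcp : c p ≠ 0 := mem_supp.1 (hcS ▸ hp)
  have key : relCount v W S = (univ.erase (0 : W)).card := by
    refine card_bij (fun b _ => b p) ?_ ?_ ?_
    · intro b hb
      rw [mem_filter] at hb
      exact mem_erase.2 ⟨mem_supp.1 (hb.2.2 ▸ hp), mem_univ _⟩
    · intro b hb b' hb' h
      rw [mem_filter] at hb hb'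
      by_contra hne
      have hsub : supp (b - b') ⊆ S := by
        intro i hi
        by_contra hiS
        apply mem_supp.1 hi
        have h1 : b i = 0 := by
          by_contra h; exact hiS (hb.2.2 ▸ mem_supp.2 h)
        have h2 : b' i = 0 := by
          by_contra h; exact hiS (hb'.2.2 ▸ mem_supp.2 h)
        simp [h1, h2]
      have := Rel.supp_eq_of_noSeven hv h4 h7 hS.le (c := b - b')
        (fun f hf => by simp [smul_sub, hb.2.1 f hf, hb'.2.1 f hf]) (sub_ne_zero.2 hne) hsub
      exact mem_supp.1 (this.1 ▸ hp) (by simp [h])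
    · intro w hw
      have hw0 := (mem_erase.1 hw).1
      refine ⟨fun i => (c i / c p) • w, ?_, by simp [hcp]⟩
      rw [mem_filter]
      refine ⟨mem_univ _, fun f hf => ?_, ?_⟩
      · simp_rw [smul_smul]
        rw [← Finset.sum_smul]
        have := hc f hf
        simp only [smul_eq_mul] at this
        simp_rw [mul_div_assoc']
        rw [← Finset.sum_div, this, zero_div, zero_smul]
      · rw [← hcS]
        ext i
        simp [mem_supp, hcp, hw0]
  rw [key, card_erase_of_mem (mem_univ _), card_univ, Nat.cast_sub Fintype.card_pos, Nat.cast_one]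

lemma onLine_of_relCount_ne_zero (hv : PlaneReps v) {T : Finset ι} (h : relCount v W T ≠ 0)
    (h0 : T ≠ ∅) (hT : T.card ≤ 7) : OnLine v T ∧ 5 ≤ T.card := by
  rw [relCount, card_ne_zero] at h
  obtain ⟨c, hc⟩ := h
  rw [mem_filter] at hc
  obtain ⟨-, hc, rfl⟩ := hc
  exact ⟨hc.exists_line hv hT, hc.card_supp_ge hv (mt supp_eq_empty.2 h0)⟩

lemma relCount_eight_eq_zero (hv : PlaneReps v) {T : Finset ι} (hT : T.card = 8)
    (hl : ¬ OnLine v T) (h5 : ¬ NoFive v T) : relCount v W T = 0 := by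
  refine relCount_eq_zero fun c hc hs => ?_
  subst hs
  exact h5 (hc.onConic_of_card_eq_eight hv hT hl).1

lemma PairType.erase {j j' : ι} {a b : ℕ} {T : Finset ι} (h : PairType v j j' a b T) {i : ι}
    (hi : i ∈ T \ line v j') : PairType v j j' (a - 1) b (T.erase i) := by
  refine ⟨(erase_subset _ _).trans h.1, ?_, ?_⟩
  · rw [← h.2.1, ← card_erase_of_mem hi]
    congr 1
    ext k; simp only [mem_sdiff, mem_erase]; tauto
  · rw [← h.2.2]
    congr 1
    ext k
    simp only [mem_sdiff, mem_erase]
    have : i ∈ line v j := by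
      have := h.1 (mem_sdiff.1 hi).1
      exact (mem_union.1 this).resolve_right (mem_sdiff.1 hi).2
    constructor
    · exact fun h => ⟨h.1.2, h.2⟩
    · rintro ⟨h1, h2⟩
      exact ⟨⟨by rintro rfl; exact h2 this, h1⟩, h2⟩

/-- `J` consists of one private point from each line; removing both leaves seven points with no five
collinear. -/
lemma PairType.sum_powerset (hv : PlaneReps v) {j j' : ι} {a : ℕ} {S : Finset ι}
    (h : PairType v j j' a 4 S) (ha : a = 4 ∨ a = 5) (hS : S.card = 9) :
    ∑ T ∈ S.powerset, relCount v W T = Fintype.card W ^ 2 := by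
  obtain ⟨x, hx⟩ : (S \ line v j').Nonempty := card_pos.1 (by rw [h.2.1]; omega)
  have h1 := h.erase hx
  obtain ⟨y, hy⟩ : ((S.erase x) \ line v j).Nonempty := card_pos.1 (by rw [h1.2.2]; omega)
  have h2 := h1.symm.erase hy
  have hxS := (mem_sdiff.1 hx).1
  have hyS := (mem_sdiff.1 hy).1
  have e : (S.erase x).erase y = S \ {x, y} := by
    ext k; simp only [mem_erase, mem_sdiff, mem_insert, mem_singleton]; tauto
  refine sum_powerset_relCount_nine (J := {x, y}) hv (onConic_of_subset_lines hv h.1) hS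
    (by simp [insert_subset_iff, hxS, (mem_erase.1 hyS).2])
    (card_pair (mem_erase.1 hyS).1.symm) ?_
  rw [← e]
  have hc : ((S.erase x).erase y).card = 7 := by
    rw [card_erase_of_mem hyS, card_erase_of_mem hxS, hS]
  exact h2.noFive hv (by omega) (by omega)

lemma subset_line_of_five (hv : PlaneReps v) {T : Finset ι} {j j' : ι} (hT : 2 ≤ T.card)
    (h : T ⊆ line v j) (h' : T ⊆ line v j') : j = j' := by
  by_contra hne
  have := card_le_card (subset_inter h h')
  rw [card_line_inter hv hne] at this
  omega

lemma PairType.not_onLine (hv : PlaneReps v) {j j' : ι} {a b : ℕ} {T : Finset ι}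
    (hne : j ≠ j') (h : PairType v j j' a b T) (ha : 2 ≤ a) (hb : 2 ≤ b) : ¬ OnLine v T := by
  rintro ⟨k, hk⟩
  have sub : ∀ {l m : ι}, T ⊆ line v l ∪ line v m → T \ line v m ⊆ line v l := by
    intro l m hlm i hi
    exact (mem_union.1 (hlm (mem_sdiff.1 hi).1)).resolve_right (mem_sdiff.1 hi).2
  have h1 := subset_line_of_five hv (ha.trans h.2.1.ge) (sub h.1) (sdiff_subset.trans hk)
  have h2 := subset_line_of_five hv (hb.trans h.2.2.ge) (sub h.symm.1) (sdiff_subset.trans hk)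
  exact hne (h1.trans h2.symm)

/-- Six proper subsets are supports, each of `Q - 1` relations: the five collinear points, and the
five sets of type 4 + 4 left by deleting one of them. Deleting a point of the other line leaves five
collinear points in a non-collinear set of eight, which is no support. -/
lemma relCount_five_four (hv : PlaneReps v) {j j' : ι} (hne : j ≠ j') {S : Finset ι}
    (h : PairType v j j' 5 4 S) (hS : S.card = 9) :
    (relCount v W S : ℤ) = (Fintype.card W : ℤ) ^ 2 - 1 - 6 * (Fintype.card W - 1) := by
  have hj : (S ∩ line v j).card = 5 := by have := h.card_inter_left; omega
  have hj' : (S ∩ line v j').card = 4 := by have := h.card_inter_right; omega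
  have h1 := congrArg (Nat.cast (R := ℤ)) (h.sum_powerset (W := W) hv (Or.inr rfl) hS)
  push_cast at h1
  rw [sum_powerset_nine hS] at h1
  have h2 : ∑ T ∈ S.powerset.filter (fun T => T.card ≤ 7), (relCount v W T : ℤ) =
      1 + (Fintype.card W - 1) := by
    rw [← Finset.sum_subset (s₁ := {∅, S ∩ line v j}), sum_pair, relCount_empty,
      relCount_onLine hv ⟨j, inter_subset_right⟩ (by omega), hj]
    · simp [mdsCount]
    · intro he; rw [← he] at hj; simp at hj
    · simp [insert_subset_iff, hj, inter_subset_left]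
    · intro T hT hT'
      rw [mem_filter, mem_powerset] at hT
      simp only [mem_insert, mem_singleton, not_or] at hT'
      by_contra hr
      obtain ⟨⟨k, hk⟩, h5⟩ := onLine_of_relCount_ne_zero hv (by exact_mod_cast hr) hT'.1 hT.2
      have h6 := card_le_card (subset_inter hT.1 hk)
      by_cases hkj : k = j
      · subst hkj
        exact hT'.2 (eq_of_subset_of_card_le (subset_inter hT.1 hk) (by omega))
      by_cases hkj' : k = j'
      · subst hkj'; omega
      have := card_inter_line_le_two hv h.1 hkj hkj'
      omega
  have h3 : ∑ i ∈ S, (relCount v W (S.erase i) : ℤ) = 5 * (Fintype.card W - 1) := by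
    have : ∀ i ∈ S, (relCount v W (S.erase i) : ℤ) =
        if i ∈ S \ line v j' then (Fintype.card W - 1 : ℤ) else 0 := by
      intro i hi
      have hc : (S.erase i).card = 8 := by rw [card_erase_of_mem hi, hS]
      split_ifs with hij
      · have h4 := h.erase hij
        exact relCount_of_onConic_eight hv (h4.noFive hv (by omega) (by omega))
          (onConic_of_subset_lines hv h4.1) hc
      · have hij : i ∈ S \ line v j := by
          have := h.card
          have h0 : (S ∩ (line v j ∩ line v j')).card = 0 := by omega
          rw [card_eq_zero] at h0
          simp only [mem_sdiff, not_and, not_not] at hij ⊢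
          refine ⟨hi, fun hii => ?_⟩
          have : i ∈ S ∩ (line v j ∩ line v j') := mem_inter.2 ⟨hi, mem_inter.2 ⟨hii, hij hi⟩⟩
          rw [h0] at this
          simp at this
        have h4 := h.symm.erase hij
        rw [relCount_eight_eq_zero hv hc (h4.not_onLine hv hne.symm (by omega) (by omega))]
        · simp
        · intro h5
          have h6 := h5 j
          have h7 := h4.card_inter_right
          omega
    rw [Finset.sum_congr rfl this, Finset.sum_ite_mem, sum_const, inter_eq_right.2 sdiff_subset,
      h.2.1]
    simp
  rw [h2, h3] at h1
  linear_combination h1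

/-- Here the proper supports are three: the five points on each line, and the set of eight left by
deleting the node. -/
lemma relCount_four_four_one (hv : PlaneReps v) {j j' : ι} (hne : j ≠ j') {S : Finset ι}
    (h : PairType v j j' 4 4 S) (hS : S.card = 9) :
    (relCount v W S : ℤ) = (Fintype.card W : ℤ) ^ 2 - 1 - 3 * (Fintype.card W - 1) := by
  have hj : (S ∩ line v j).card = 5 := by have := h.card_inter_left; omega
  have hj' : (S ∩ line v j').card = 5 := by have := h.card_inter_right; omega
  have h0 : (S ∩ (line v j ∩ line v j')).card = 1 := by have := h.card; omega
  have h1 := congrArg (Nat.cast (R := ℤ)) (h.sum_powerset (W := W) hv (Or.inl rfl) hS)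
  push_cast at h1
  rw [sum_powerset_nine hS] at h1
  have h2 : ∑ T ∈ S.powerset.filter (fun T => T.card ≤ 7), (relCount v W T : ℤ) =
      1 + ((Fintype.card W - 1) + (Fintype.card W - 1)) := by
    have hd : S ∩ line v j ≠ S ∩ line v j' := by
      intro he
      apply hne
      exact subset_line_of_five hv (T := S ∩ line v j) (by omega) inter_subset_right
        (by rw [he]; exact inter_subset_right)
    rw [← Finset.sum_subset (s₁ := {∅, S ∩ line v j, S ∩ line v j'}), sum_insert, sum_pair hd,
      relCount_empty, relCount_onLine hv ⟨j, inter_subset_right⟩ (by omega),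
      relCount_onLine hv ⟨j', inter_subset_right⟩ (by omega), hj, hj']
    · simp [mdsCount]
    · simp only [mem_insert, mem_singleton, not_or]
      constructor
      · intro he; rw [← he] at hj; simp at hj
      · intro he; rw [← he] at hj'; simp at hj'
    · simp [insert_subset_iff, hj, hj', inter_subset_left]
    · intro T hT hT'
      rw [mem_filter, mem_powerset] at hT
      simp only [mem_insert, mem_singleton, not_or] at hT'
      by_contra hr
      obtain ⟨⟨k, hk⟩, h5⟩ := onLine_of_relCount_ne_zero hv (by exact_mod_cast hr) hT'.1 hT.2
      have h6 := card_le_card (subset_inter hT.1 hk)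
      by_cases hkj : k = j
      · subst hkj
        exact hT'.2.1 (eq_of_subset_of_card_le (subset_inter hT.1 hk) (by omega))
      by_cases hkj' : k = j'
      · subst hkj'
        exact hT'.2.2 (eq_of_subset_of_card_le (subset_inter hT.1 hk) (by omega))
      have := card_inter_line_le_two hv h.1 hkj hkj'
      omega
  have h3 : ∑ i ∈ S, (relCount v W (S.erase i) : ℤ) = Fintype.card W - 1 := by
    have hz : ∀ (l m : ι), l ≠ m → PairType v l m 4 4 S → ∀ i ∈ S \ line v m,
        relCount v W (S.erase i) = 0 := by
      intro l m hlm hP i hi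
      have hc : (S.erase i).card = 8 := by rw [card_erase_of_mem (mem_sdiff.1 hi).1, hS]
      have h4 := hP.erase hi
      refine relCount_eight_eq_zero hv hc (h4.not_onLine hv hlm (by omega) (by omega)) fun h5 => ?_
      have h6 := h5 m
      have h7 := h4.card_inter_right
      omega
    have : ∀ i ∈ S, (relCount v W (S.erase i) : ℤ) =
        if i ∈ S ∩ (line v j ∩ line v j') then (Fintype.card W - 1 : ℤ) else 0 := by
      intro i hi
      have hc : (S.erase i).card = 8 := by rw [card_erase_of_mem hi, hS]
      split_ifs with hij
      · simp only [mem_inter] at hij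
        have h4 : PairType v j j' 4 4 (S.erase i) := by
          refine ⟨(erase_subset _ _).trans h.1, ?_, ?_⟩
          · rw [← h.2.1]
            congr 1
            ext k; simp only [mem_sdiff, mem_erase]
            constructor
            · exact fun h => ⟨h.1.2, h.2⟩
            · exact fun h => ⟨⟨fun e => h.2 (e ▸ hij.2.2), h.1⟩, h.2⟩
          · rw [← h.2.2]
            congr 1
            ext k; simp only [mem_sdiff, mem_erase]
            constructor
            · exact fun h => ⟨h.1.2, h.2⟩
            · exact fun h => ⟨⟨fun e => h.2 (e ▸ hij.2.1), h.1⟩, h.2⟩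
        exact relCount_of_onConic_eight hv (h4.noFive hv (by omega) (by omega))
          (onConic_of_subset_lines hv h4.1) hc
      · simp only [mem_inter, not_and] at hij
        norm_cast
        by_cases hi1 : i ∈ line v j
        · exact hz j j' hne h i (mem_sdiff.2 ⟨hi, hij hi hi1⟩)
        · exact hz j' j hne.symm h.symm i (mem_sdiff.2 ⟨hi, hi1⟩)
    rw [Finset.sum_congr rfl this, Finset.sum_ite_mem, sum_const, inter_eq_right.2 inter_subset_left,
      h0]
    simp
  rw [h2, h3] at h1
  linear_combination h1

end Counting

/-! ### Counting subsets by their intersections with a partition -/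

section Parts

variable {α : Type*} [Fintype α]

/-- Subsets with prescribed intersections with the parts of a partition. -/
lemma card_subsets_parts {n : ℕ} (X : Fin n → Finset α)
    (hX : ∀ i j, i ≠ j → Disjoint (X i) (X j)) (a : Fin n → ℕ) :
    (univ.filter fun T : Finset α => T ⊆ univ.biUnion X ∧ ∀ i, (T ∩ X i).card = a i).card =
      ∏ i, (X i).card.choose (a i) := by
  have h1 : ∏ i, (X i).card.choose (a i) =
      (Fintype.piFinset fun i => powersetCard (a i) (X i)).card := by
    rw [Fintype.card_piFinset]
    simp
  have key : ∀ g ∈ Fintype.piFinset fun i => powersetCard (a i) (X i), ∀ i,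
      univ.biUnion g ∩ X i = g i := by
    intro g hg i
    rw [Fintype.mem_piFinset] at hg
    ext x
    simp only [mem_inter, mem_biUnion, mem_univ, true_and]
    constructor
    · rintro ⟨⟨k, hk⟩, hx⟩
      by_cases hki : k = i
      · exact hki ▸ hk
      · exact absurd hx (disjoint_left.1 (hX k i hki) ((mem_powersetCard.1 (hg k)).1 hk))
    · intro hx
      exact ⟨⟨i, hx⟩, (mem_powersetCard.1 (hg i)).1 hx⟩
  rw [h1]
  refine card_nbij' (fun T i => T ∩ X i) (fun g => univ.biUnion g) ?_ ?_ ?_ ?_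
  · intro T hT
    simp only [coe_filter, Set.mem_ofPred_eq, mem_univ, true_and] at hT
    simp [mem_powersetCard, hT.2, inter_subset_right]
  · intro g hg
    have hg' := hg
    simp only [coe_filter, Set.mem_ofPred_eq, mem_univ, true_and]
    rw [mem_coe, Fintype.mem_piFinset] at hg'
    refine ⟨fun x hx => ?_, fun i => ?_⟩
    · obtain ⟨i, hi, hx⟩ := mem_biUnion.1 hx
      exact mem_biUnion.2 ⟨i, hi, (mem_powersetCard.1 (hg' i)).1 hx⟩
    · rw [key g hg i]
      exact (mem_powersetCard.1 (hg' i)).2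
  · intro T hT
    simp only [coe_filter, Set.mem_ofPred_eq, mem_univ, true_and] at hT
    ext x
    simp only [mem_biUnion, mem_univ, true_and, mem_inter]
    constructor
    · rintro ⟨i, h, -⟩; exact h
    · intro hx
      obtain ⟨i, -, hi⟩ := mem_biUnion.1 (hT.1 hx)
      exact ⟨i, hx, hi⟩
  · intro g hg
    funext i
    exact key g hg i

lemma card_subsets_two (X Y : Finset α) (h : Disjoint X Y) (a b : ℕ) :
    (univ.filter fun T : Finset α => T ⊆ X ∪ Y ∧ (T ∩ X).card = a ∧ (T ∩ Y).card = b).card =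
      X.card.choose a * Y.card.choose b := by
  have := card_subsets_parts ![X, Y] (by
    intro i j; fin_cases i <;> fin_cases j <;> simp [h, h.symm]) ![a, b]
  simp only [Fin.prod_univ_two, Matrix.cons_val_zero, Matrix.cons_val_one] at this
  rw [← this]
  congr 1
  ext T
  simp [Fin.forall_fin_two, Fin.univ_succ]

lemma card_subsets_three (X Y Z : Finset α) (hXY : Disjoint X Y) (hXZ : Disjoint X Z)
    (hYZ : Disjoint Y Z) (a b c : ℕ) :
    (univ.filter fun T : Finset α => T ⊆ X ∪ (Y ∪ Z) ∧ (T ∩ X).card = a ∧ (T ∩ Y).card = b ∧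
      (T ∩ Z).card = c).card =
      X.card.choose a * (Y.card.choose b * Z.card.choose c) := by
  have := card_subsets_parts ![X, Y, Z] (by
    intro i j; fin_cases i <;> fin_cases j <;>
      simp [hXY, hXZ, hYZ, hXY.symm, hXZ.symm, hYZ.symm]) ![a, b, c]
  simp only [Fin.prod_univ_three, Matrix.cons_val_zero, Matrix.cons_val_one,
    Matrix.cons_val_two, Matrix.tail_cons, Matrix.head_cons, mul_assoc] at this
  rw [← this]
  congr 1
  ext T
  simp [Fin.forall_fin_succ, Fin.univ_succ]

lemma two_mul_choose_two (n : ℕ) : 2 * n.choose 2 = n * (n - 1) := by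
  rw [Nat.choose_two_right, Nat.mul_div_cancel' (Nat.even_mul_pred_self n).two_dvd]

end Parts

/-! ### Counting collinear sets and sets on two lines -/

section LineCounts

variable {K ι : Type*} [Field K] [Fintype K] [Fintype ι] {v : ι → Fin 3 → K}

lemma card_line_sdiff (hv : PlaneReps v) {j j' : ι} (h : j ≠ j') :
    (line v j \ line v j').card = Fintype.card K := by
  have := card_inter_add_card_sdiff (line v j) (line v j')
  rw [card_line_inter hv h, card_line hv] at this
  omega

lemma card_onLine (hv : PlaneReps v) {m : ℕ} (hm : 2 ≤ m) :
    (univ.filter fun S : Finset ι => S.card = m ∧ OnLine v S).card =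
      Fintype.card ι * (Fintype.card K + 1).choose m := by
  have : (univ.filter fun S : Finset ι => S.card = m ∧ OnLine v S) =
      univ.biUnion fun j => powersetCard m (line v j) := by
    ext S
    rw [mem_filter, OnLine]
    simp [mem_powersetCard, and_comm]
  rw [this, card_biUnion]
  · simp [card_line hv]
  · intro j _ j' _ hne
    rw [Function.onFun, disjoint_left]
    intro S hS hS'
    rw [mem_powersetCard] at hS hS'
    exact hne (subset_line_of_five hv (hm.trans hS.2.ge) hS.1 hS'.1)

lemma card_pairType (hv : PlaneReps v) {j j' : ι} (h : j ≠ j') (a b n c : ℕ) (hn : n = a + b + c) :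
    (univ.filter fun S : Finset ι => S.card = n ∧ PairType v j j' a b S).card =
      (Fintype.card K).choose a * ((Fintype.card K).choose b * Nat.choose 1 c) := by
  have := card_subsets_three (line v j \ line v j') (line v j' \ line v j) (line v j ∩ line v j')
    (by rw [disjoint_left]; intro x; simp only [mem_sdiff]; tauto)
    (by rw [disjoint_left]; intro x; simp only [mem_sdiff, mem_inter]; tauto)
    (by rw [disjoint_left]; intro x; simp only [mem_sdiff, mem_inter]; tauto) a b c
  rw [card_line_sdiff hv h, card_line_sdiff hv h.symm, card_line_inter hv h] at this
  rw [← this]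
  congr 1
  ext S
  simp only [mem_filter, mem_univ, true_and]
  have hU : line v j \ line v j' ∪ (line v j' \ line v j ∪ line v j ∩ line v j') =
      line v j ∪ line v j' := by
    ext x; simp only [mem_union, mem_sdiff, mem_inter]; tauto
  rw [hU]
  have e1 : S ⊆ line v j ∪ line v j' → S ∩ (line v j \ line v j') = S \ line v j' := by
    intro hS; ext x; have := @hS x; simp only [mem_union, mem_sdiff, mem_inter] at *; tauto
  have e2 : S ⊆ line v j ∪ line v j' → S ∩ (line v j' \ line v j) = S \ line v j := by
    intro hS; ext x; have := @hS x; simp only [mem_union, mem_sdiff, mem_inter] at *; tauto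
  constructor
  · rintro ⟨hc, hP⟩
    have := hP.card
    exact ⟨hP.1, by rw [e1 hP.1, hP.2.1], by rw [e2 hP.1, hP.2.2], by omega⟩
  · rintro ⟨h1, h2, h3, h4⟩
    have hP : PairType v j j' a b S := ⟨h1, by rw [← e1 h1, h2], by rw [← e2 h1, h3]⟩
    have := hP.card
    exact ⟨by omega, hP⟩

/-- A line other than `k` and `k'` meets their union in at most two points, but `j` carries at least
three points of `S`. -/
lemma PairType.eq_or_eq (hv : PlaneReps v) {j j' k k' : ι} {a b a' b' : ℕ} {S : Finset ι}
    (h : PairType v j j' a b S) (ha : 3 ≤ a) (h' : PairType v k k' a' b' S) : j = k ∨ j = k' := by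
  by_contra! hc
  have h1 := card_inter_line_le_two hv h'.1 hc.1 hc.2
  have h2 := h.card_inter_left
  have h3 := h.card
  omega

/-- The sets of size `n` of type `(a, b)` with respect to some pair of lines. -/
def pairFam (v : ι → Fin 3 → K) (a b n : ℕ) : Finset (Finset ι) :=
  univ.filter fun S => S.card = n ∧ ∃ j j', j ≠ j' ∧ PairType v j j' a b S

lemma mem_pairFam {a b n : ℕ} {S : Finset ι} :
    S ∈ pairFam v a b n ↔ S.card = n ∧ ∃ j j', j ≠ j' ∧ PairType v j j' a b S := by
  simp [pairFam]

/-- Double count against ordered pairs of lines. A set is seen by `r = 1` pair if `a ≠ b` and by `r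
= 2` if `a = b`; `c` records whether the node belongs to it. -/
lemma card_pairFam_mul (hv : PlaneReps v) {a b n c : ℕ} (hn : n = a + b + c) (r : ℕ)
    (hr : ∀ S ∈ pairFam v a b n,
      ((univ : Finset ι).offDiag.filter fun x => PairType v x.1 x.2 a b S).card = r) :
    (pairFam v a b n).card * r = Fintype.card ι * (Fintype.card ι - 1) *
      ((Fintype.card K).choose a * ((Fintype.card K).choose b * Nat.choose 1 c)) := by
  have h := sum_card_bipartiteAbove_eq_sum_card_bipartiteBelow (s := pairFam v a b n)
    (t := (univ : Finset ι).offDiag) (fun S x => PairType v x.1 x.2 a b S)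
  rw [Finset.sum_congr rfl (g := fun _ => r) (fun S hS => by
    rw [← hr S hS, bipartiteAbove]), sum_const, smul_eq_mul] at h
  rw [h, Finset.sum_congr rfl (g := fun _ => (Fintype.card K).choose a *
    ((Fintype.card K).choose b * Nat.choose 1 c)), sum_const, smul_eq_mul, offDiag_card, card_univ]
  · rw [Nat.mul_sub_one]
  · intro x hx
    rw [mem_offDiag] at hx
    rw [← card_pairType hv hx.2.2 a b n c hn, bipartiteBelow]
    congr 1
    ext S
    simp only [mem_filter, mem_pairFam, mem_univ, true_and]
    exact ⟨fun h => ⟨h.1.1, h.2⟩, fun h => ⟨⟨h.1, x.1, x.2, hx.2.2, h.2⟩, h.2⟩⟩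

lemma card_pairFam_of_ne (hv : PlaneReps v) {a b n c : ℕ} (hn : n = a + b + c) (hab : a ≠ b)
    (ha : 3 ≤ a) (hb : 3 ≤ b) :
    (pairFam v a b n).card = 2 * (Fintype.card ι).choose 2 *
      ((Fintype.card K).choose a * ((Fintype.card K).choose b * Nat.choose 1 c)) := by
  rw [two_mul_choose_two, ← card_pairFam_mul hv hn 1, mul_one]
  intro S hS
  obtain ⟨-, j, j', hne, hP⟩ := mem_pairFam.1 hS
  rw [card_eq_one]
  refine ⟨(j, j'), ?_⟩
  ext ⟨k, k'⟩
  simp only [mem_filter, mem_offDiag, mem_univ, true_and, mem_singleton, Prod.mk.injEq]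
  constructor
  · rintro ⟨hk, hQ⟩
    have h1 := hQ.eq_or_eq hv ha hP
    have h2 := hQ.symm.eq_or_eq hv hb hP
    rcases h1 with rfl | rfl
    · exact ⟨rfl, h2.resolve_left hk.symm⟩
    · rcases h2 with rfl | rfl
      · exact absurd (hQ.2.1.symm.trans hP.2.2) hab
      · exact absurd rfl hk
  · rintro ⟨rfl, rfl⟩
    exact ⟨hne, hP⟩

lemma card_pairFam_self (hv : PlaneReps v) {a n c : ℕ} (hn : n = a + a + c) (ha : 3 ≤ a) :
    (pairFam v a a n).card = (Fintype.card ι).choose 2 *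
      ((Fintype.card K).choose a * ((Fintype.card K).choose a * Nat.choose 1 c)) := by
  have h := card_pairFam_mul hv hn 2 (v := v) ?_
  · rw [← two_mul_choose_two] at h
    refine Nat.eq_of_mul_eq_mul_right two_pos (h.trans ?_)
    ring
  intro S hS
  obtain ⟨-, j, j', hne, hP⟩ := mem_pairFam.1 hS
  rw [card_eq_two]
  refine ⟨(j, j'), (j', j), by simp [hne], ?_⟩
  ext ⟨k, k'⟩
  simp only [mem_filter, mem_offDiag, mem_univ, true_and, mem_insert, mem_singleton, Prod.mk.injEq]
  constructor
  · rintro ⟨hk, hQ⟩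
    have h1 := hQ.eq_or_eq hv ha hP
    have h2 := hQ.symm.eq_or_eq hv ha hP
    rcases h1 with rfl | rfl
    · exact Or.inl ⟨rfl, h2.resolve_left hk.symm⟩
    · exact Or.inr ⟨rfl, h2.resolve_right hk.symm⟩
  · rintro (⟨rfl, rfl⟩ | ⟨rfl, rfl⟩)
    · exact ⟨hne, hP⟩
    · exact ⟨hne.symm, hP.symm⟩

end LineCounts

/-! ### Weight distribution in terms of the families of supports -/

section WeightDistribution

variable {K ι : Type*} [Field K] [Fintype K] [Fintype ι] {v : ι → Fin 3 → K}

/-- The sets of `m` points on a conic, no four of them collinear. -/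
def conicFam (v : ι → Fin 3 → K) (m : ℕ) : Finset (Finset ι) :=
  univ.filter fun S => S.card = m ∧ NoFour v S ∧ OnConic v S

/-- The sets of nine points, no four collinear and no seven on a conic, that fail to impose
independent conditions on cubics. -/
def baseFam (v : ι → Fin 3 → K) : Finset (Finset ι) :=
  univ.filter fun S => S.card = 9 ∧ NoFour v S ∧ NoSeven v S ∧
    ∃ c : ι → K, c ≠ 0 ∧ Rel v 3 c ∧ supp c ⊆ S

lemma mem_conicFam {m : ℕ} {S : Finset ι} :
    S ∈ conicFam v m ↔ S.card = m ∧ NoFour v S ∧ OnConic v S := by simp [conicFam]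

lemma mem_baseFam {S : Finset ι} :
    S ∈ baseFam v ↔ S.card = 9 ∧ NoFour v S ∧ NoSeven v S ∧
      ∃ c : ι → K, c ≠ 0 ∧ Rel v 3 c ∧ supp c ⊆ S := by simp [baseFam]

variable (v) (W : Type*) [AddCommGroup W] [Module K W] [Fintype W]

/-- The number of `W`-valued relations on cubics of weight `m`. -/
def relWeight (m : ℕ) : ℕ := (univ.filter fun c : ι → W => Rel v 3 c ∧ (supp c).card = m).card

lemma relWeight_eq_sum (m : ℕ) :
    relWeight v W m = ∑ S ∈ univ.filter (fun S : Finset ι => S.card = m), relCount v W S := by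
  rw [relWeight]
  convert (sum_relCount v W fun S => S.card = m).symm using 2 <;> (ext; simp)

variable {v W}

lemma relWeight_zero : relWeight v W 0 = 1 := by
  have : (univ.filter fun S : Finset ι => S.card = 0) = {∅} := by ext; simp
  rw [relWeight_eq_sum, this, sum_singleton, relCount_empty]

lemma relWeight_eq_zero (hv : PlaneReps v) {m : ℕ} (h0 : m ≠ 0) (hm : m ≤ 4) :
    relWeight v W m = 0 := by
  rw [relWeight_eq_sum]
  refine Finset.sum_eq_zero fun S hS => ?_
  simp only [mem_filter, mem_univ, true_and] at hS
  exact relCount_eq_zero_of_card_le_four hv (card_pos.1 (by omega)) (by omega)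

/-- The collinear sets of size `m`. -/
def lineFam (v : ι → Fin 3 → K) (m : ℕ) : Finset (Finset ι) :=
  univ.filter fun S => S.card = m ∧ OnLine v S

lemma mem_lineFam {m : ℕ} {S : Finset ι} : S ∈ lineFam v m ↔ S.card = m ∧ OnLine v S := by
  simp [lineFam]

lemma card_lineFam (hv : PlaneReps v) {m : ℕ} (hm : 2 ≤ m) :
    (lineFam v m).card = Fintype.card ι * (Fintype.card K + 1).choose m := by
  rw [← card_onLine hv hm, lineFam]

/-- Summing `relCount` over the sets of size `m` reduces to a sum over disjoint families. -/
lemma relWeight_eq_sum_families {m : ℕ} {n : ℕ} (F : Fin n → Finset (Finset ι)) (val : Fin n → ℤ)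
    (hcard : ∀ i, ∀ S ∈ F i, S.card = m)
    (hd : ∀ i j, i ≠ j → Disjoint (F i) (F j))
    (hval : ∀ i, ∀ S ∈ F i, (relCount v W S : ℤ) = val i)
    (hF : ∀ c : ι → W, Rel v 3 c → (supp c).card = m → ∃ i, supp c ∈ F i) :
    (relWeight v W m : ℤ) = ∑ i, ((F i).card : ℤ) * val i := by
  rw [relWeight_eq_sum]
  push_cast
  rw [← Finset.sum_subset (s₁ := univ.biUnion F), sum_biUnion]
  · refine Finset.sum_congr rfl fun i _ => ?_
    rw [Finset.sum_congr rfl (hval i), sum_const, nsmul_eq_mul]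
  · exact fun i _ j _ hne => hd i j hne
  · intro S hS
    obtain ⟨i, -, hi⟩ := mem_biUnion.1 hS
    simpa using hcard i S hi
  · intro S hS hSF
    simp only [mem_filter, mem_univ, true_and] at hS
    norm_cast
    refine relCount_eq_zero fun c hc hs => hSF ?_
    obtain ⟨i, hi⟩ := hF c hc (by rw [hs, hS])
    exact mem_biUnion.2 ⟨i, mem_univ _, hs ▸ hi⟩

lemma relWeight_five_to_seven (hv : PlaneReps v) {m : ℕ} (h5 : 5 ≤ m) (h7 : m ≤ 7) :
    (relWeight v W m : ℤ) = Fintype.card ι * (Fintype.card K + 1).choose m *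
      mdsCount (Fintype.card W) m := by
  rw [relWeight_eq_sum_families (n := 1) ![lineFam v m] ![mdsCount (Fintype.card W) m]]
  · simp [card_lineFam hv (show 2 ≤ m by omega)]
  · intro i S hS
    fin_cases i
    exact (mem_lineFam.1 hS).1
  · intro i j hne; exact absurd (Subsingleton.elim i j) hne
  · intro i S hS
    fin_cases i
    obtain ⟨h1, h2⟩ := mem_lineFam.1 hS
    simp only [Matrix.cons_val_zero, Fin.zero_eta]
    rw [relCount_onLine hv h2 (by omega), h1]
  · intro c hc hm
    exact ⟨0, mem_lineFam.2 ⟨hm, hc.exists_line hv (by omega)⟩⟩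

lemma disjoint_lineFam_pairFam (hv : PlaneReps v) (m a b : ℕ) (ha : 2 ≤ a) (hb : 2 ≤ b) :
    Disjoint (lineFam v m) (pairFam v a b m) := by
  rw [disjoint_left]
  intro S hS hS'
  obtain ⟨-, j, j', hne, hP⟩ := mem_pairFam.1 hS'
  exact hP.not_onLine hv hne ha hb (mem_lineFam.1 hS).2

lemma disjoint_lineFam_of_noFour {m : ℕ} (hm : 5 ≤ m) {F : Finset (Finset ι)}
    (hF : ∀ S ∈ F, NoFour v S) : Disjoint (lineFam v m) F := by
  rw [disjoint_left]
  intro S hS hS'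
  obtain ⟨h1, h2⟩ := mem_lineFam.1 hS
  exact not_onLine_of_noFive (hF S hS').noFive (by omega) h2

lemma disjoint_pairFam_of_noFour {m a b : ℕ} (ha : m ≤ a + b + 1) (ha' : a + b ≤ m) (hb : 4 ≤ a)
    {F : Finset (Finset ι)} (hF : ∀ S ∈ F, NoFour v S) : Disjoint (pairFam v a b m) F := by
  rw [disjoint_left]
  intro S hS hS'
  obtain ⟨h1, j, j', hne, hP⟩ := mem_pairFam.1 hS
  have := hF S hS' j
  have := hP.card_inter_left
  omega

/-- A non-collinear support of size eight lies on a conic: a line pair of type 4 + 4 if four points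
are collinear, otherwise a member of `conicFam`. -/
lemma relWeight_eight (hv : PlaneReps v) :
    (relWeight v W 8 : ℤ) =
      Fintype.card ι * (Fintype.card K + 1).choose 8 * mdsCount (Fintype.card W) 8 +
      (Fintype.card ι).choose 2 * ((Fintype.card K).choose 4) ^ 2 * (Fintype.card W - 1) +
      (conicFam v 8).card * (Fintype.card W - 1) := by
  have hc4 : ∀ S ∈ conicFam v 8, NoFour v S := fun S hS => (mem_conicFam.1 hS).2.1
  rw [relWeight_eq_sum_families (n := 3) ![lineFam v 8, pairFam v 4 4 8, conicFam v 8]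
    ![mdsCount (Fintype.card W) 8, Fintype.card W - 1, Fintype.card W - 1]]
  · have h := card_pairFam_self hv (show 8 = 4 + 4 + 0 from rfl) (by omega)
    simp [Fin.sum_univ_succ, card_lineFam hv (show 2 ≤ 8 by omega), h]
    ring
  · intro i S hS
    fin_cases i
    · exact (mem_lineFam.1 hS).1
    · exact (mem_pairFam.1 hS).1
    · exact (mem_conicFam.1 hS).1
  · have h1 := disjoint_lineFam_pairFam hv 8 4 4 (by omega) (by omega)
    have h2 := disjoint_lineFam_of_noFour (show 5 ≤ 8 by omega) hc4
    have h3 := disjoint_pairFam_of_noFour (m := 8) (a := 4) (b := 4) (by omega) (by omega)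
      (by omega) hc4
    intro i j hne
    fin_cases i <;> fin_cases j <;> first | exact absurd rfl hne | assumption | (apply Disjoint.symm; assumption)
  · intro i S hS
    fin_cases i
    · obtain ⟨h1, h2⟩ := mem_lineFam.1 hS
      exact (relCount_onLine hv h2 (by omega)).trans (by rw [h1]; rfl)
    · obtain ⟨h1, j, j', hne, hP⟩ := mem_pairFam.1 hS
      exact relCount_of_onConic_eight hv (hP.noFive hv (by omega) (by omega))
        (onConic_of_subset_lines hv hP.1) h1
    · obtain ⟨h1, h2, h3⟩ := mem_conicFam.1 hS
      exact relCount_of_onConic_eight hv h2.noFive h3 h1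
  · intro c hc hm
    by_cases hl : OnLine v (supp c)
    · exact ⟨0, mem_lineFam.2 ⟨hm, hl⟩⟩
    by_cases h4 : NoFour v (supp c)
    · exact ⟨2, mem_conicFam.2 ⟨hm, h4, (hc.onConic_of_card_eq_eight hv hm hl).2⟩⟩
    · obtain ⟨j, j', hne, h⟩ := hc.exists_pairType hv (by omega) hl h4
      refine ⟨1, mem_pairFam.2 ⟨hm, j, j', hne, ?_⟩⟩
      rcases h with h | h | h
      · exact h.2
      · omega
      · omega

/-- Five disjoint families exhaust the supports of size nine; the multiples of `Q - 1` subtracted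
from `Q² - 1` count their proper nonempty supports. -/
lemma relWeight_nine (hv : PlaneReps v) :
    (relWeight v W 9 : ℤ) =
      Fintype.card ι * (Fintype.card K + 1).choose 9 * mdsCount (Fintype.card W) 9 +
      2 * (Fintype.card ι).choose 2 * ((Fintype.card K).choose 5 * (Fintype.card K).choose 4) *
        ((Fintype.card W : ℤ) ^ 2 - 1 - 6 * (Fintype.card W - 1)) +
      (Fintype.card ι).choose 2 * ((Fintype.card K).choose 4) ^ 2 *
        ((Fintype.card W : ℤ) ^ 2 - 1 - 3 * (Fintype.card W - 1)) +
      (conicFam v 9).card * ((Fintype.card W : ℤ) ^ 2 - 1 - 9 * (Fintype.card W - 1)) +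
      (baseFam v).card * (Fintype.card W - 1) := by
  have hc4 : ∀ S ∈ conicFam v 9, NoFour v S := fun S hS => (mem_conicFam.1 hS).2.1
  have hb4 : ∀ S ∈ baseFam v, NoFour v S := fun S hS => (mem_baseFam.1 hS).2.1
  rw [relWeight_eq_sum_families (n := 5)
    ![lineFam v 9, pairFam v 5 4 9, pairFam v 4 4 9, conicFam v 9, baseFam v]
    ![mdsCount (Fintype.card W) 9, (Fintype.card W : ℤ) ^ 2 - 1 - 6 * (Fintype.card W - 1),
      (Fintype.card W : ℤ) ^ 2 - 1 - 3 * (Fintype.card W - 1),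
      (Fintype.card W : ℤ) ^ 2 - 1 - 9 * (Fintype.card W - 1), Fintype.card W - 1]]
  · have h := card_pairFam_self hv (show 9 = 4 + 4 + 1 from rfl) (by omega)
    have h' := card_pairFam_of_ne hv (show 9 = 5 + 4 + 0 from rfl) (by omega) (by omega) (by omega)
    simp [Fin.sum_univ_succ, card_lineFam hv (show 2 ≤ 9 by omega), h, h']
    ring
  · intro i S hS
    fin_cases i
    · exact (mem_lineFam.1 hS).1
    · exact (mem_pairFam.1 hS).1
    · exact (mem_pairFam.1 hS).1
    · exact (mem_conicFam.1 hS).1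
    · exact (mem_baseFam.1 hS).1
  · have h01 := disjoint_lineFam_pairFam hv 9 5 4 (by omega) (by omega)
    have h02 := disjoint_lineFam_pairFam hv 9 4 4 (by omega) (by omega)
    have h03 := disjoint_lineFam_of_noFour (show 5 ≤ 9 by omega) hc4
    have h04 := disjoint_lineFam_of_noFour (show 5 ≤ 9 by omega) hb4
    have h12 : Disjoint (pairFam v 5 4 9) (pairFam v 4 4 9) := by
      rw [disjoint_left]
      intro S hS hS'
      obtain ⟨h1, j, j', hne, hP⟩ := mem_pairFam.1 hS
      obtain ⟨-, k, k', -, hQ⟩ := mem_pairFam.1 hS'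
      have h2 := hP.card_inter_right
      have h3 := hQ.card_inter_left
      have h4 := hQ.card_inter_right
      rcases hP.symm.eq_or_eq hv (by omega) hQ with rfl | rfl <;> omega
    have h13 := disjoint_pairFam_of_noFour (m := 9) (a := 5) (b := 4) (by omega) (by omega)
      (by omega) hc4
    have h14 := disjoint_pairFam_of_noFour (m := 9) (a := 5) (b := 4) (by omega) (by omega)
      (by omega) hb4
    have h23 := disjoint_pairFam_of_noFour (m := 9) (a := 4) (b := 4) (by omega) (by omega)
      (by omega) hc4
    have h24 := disjoint_pairFam_of_noFour (m := 9) (a := 4) (b := 4) (by omega) (by omega)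
      (by omega) hb4
    have h34 : Disjoint (conicFam v 9) (baseFam v) := by
      rw [disjoint_left]
      intro S hS hS'
      obtain ⟨h1, -, f, hf0, hf, hSf⟩ := mem_conicFam.1 hS
      have := (mem_baseFam.1 hS').2.2.1 f hf0 hf
      rw [inter_eq_left.2 hSf] at this
      omega
    intro i j hne
    fin_cases i <;> fin_cases j <;> first | exact absurd rfl hne | assumption | (apply Disjoint.symm; assumption)
  · intro i S hS
    fin_cases i
    · obtain ⟨h1, h2⟩ := mem_lineFam.1 hS
      exact (relCount_onLine hv h2 (by omega)).trans (by rw [h1]; rfl)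
    · obtain ⟨h1, j, j', hne, hP⟩ := mem_pairFam.1 hS
      exact relCount_five_four hv hne hP h1
    · obtain ⟨h1, j, j', hne, hP⟩ := mem_pairFam.1 hS
      exact relCount_four_four_one hv hne hP h1
    · obtain ⟨h1, h2, h3⟩ := mem_conicFam.1 hS
      exact relCount_of_onConic_nine hv h2 h3 h1
    · obtain ⟨h1, h2, h3, h4⟩ := mem_baseFam.1 hS
      exact relCount_of_noSeven hv h2 h3 h1 h4
  · intro c hc hm
    by_cases hl : OnLine v (supp c)
    · exact ⟨0, mem_lineFam.2 ⟨hm, hl⟩⟩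
    by_cases h4 : NoFour v (supp c)
    · rcases hc.noSeven_or_onConic hv hm.le with h | h
      · exact ⟨3, mem_conicFam.2 ⟨hm, h4, h⟩⟩
      · refine ⟨4, mem_baseFam.2 ⟨hm, h4, h, ?_⟩⟩
        -- `baseFam` is defined by scalar relations. A functional nonzero on one coefficient turns
        -- the `W`-valued relation into a nonzero scalar one.
        obtain ⟨i, hi⟩ := card_pos.1 (show 0 < (supp c).card by omega)
        have hi0 := mem_supp.1 hi
        rw [Ne, ← Module.forall_dual_apply_eq_zero_iff K] at hi0
        push Not at hi0
        obtain ⟨φ, hφ⟩ := hi0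
        refine ⟨fun k => φ (c k), fun h0 => hφ (congrFun h0 i), fun f hf => ?_, fun k hk => ?_⟩
        · have := congrArg φ (hc f hf)
          simpa using this
        · rw [mem_supp] at hk ⊢
          rintro h0
          exact hk (by simp [h0])
    · obtain ⟨j, j', hne, h⟩ := hc.exists_pairType hv (by omega) hl h4
      rcases h with h | h | h
      · omega
      · exact ⟨1, mem_pairFam.2 ⟨hm, j, j', hne, h.2⟩⟩
      · exact ⟨2, mem_pairFam.2 ⟨hm, j, j', hne, h.2⟩⟩

end WeightDistribution

/-! ### Binary forms on the projective line, `none` being the point at infinity -/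

section BinaryForms

variable {K : Type*} [Field K]

/-- The value of the binary form of degree `m` with dehomogenisation `P` at a point of the
projective line. -/
def bev (m : ℕ) (P : Polynomial K) : Option K → K
  | some t => P.eval t
  | none => P.coeff m

lemma bev_zero (m : ℕ) (u : Option K) : bev m (0 : Polynomial K) u = 0 := by
  cases u <;> simp [bev]

lemma bev_add (m : ℕ) (P Q : Polynomial K) (u : Option K) :
    bev m (P + Q) u = bev m P u + bev m Q u := by
  cases u <;> simp [bev]

lemma bev_sub (m : ℕ) (P Q : Polynomial K) (u : Option K) :
    bev m (P - Q) u = bev m P u - bev m Q u := by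
  cases u <;> simp [bev]

lemma bev_C_mul (m : ℕ) (c : K) (P : Polynomial K) (u : Option K) :
    bev m (Polynomial.C c * P) u = c * bev m P u := by
  cases u <;> simp [bev]

lemma bev_mul {m n : ℕ} {P Q : Polynomial K} (hP : P.natDegree ≤ m) (hQ : Q.natDegree ≤ n)
    (u : Option K) : bev (m + n) (P * Q) u = bev m P u * bev n Q u := by
  cases u with
  | none => exact Polynomial.coeff_mul_add_eq_of_natDegree_le hP hQ
  | some t => simp [bev]

variable [Fintype K]

lemma card_bev_zeros_le {m : ℕ} {P : Polynomial K} (hP : P.natDegree ≤ m) (h0 : P ≠ 0) :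
    (univ.filter fun u => bev m P u = 0).card ≤ m := by
  have h1 : (univ.filter fun u => bev m P u = 0) ⊆
      (P.roots.toFinset.image some) ∪ if P.coeff m = 0 then {none} else ∅ := by
    intro u hu
    simp only [mem_filter, mem_univ, true_and] at hu
    cases u with
    | none =>
      simp only [bev] at hu
      simp [hu]
    | some t =>
      simp only [bev] at hu
      simp [h0, hu]
  have h2 : (P.roots.toFinset.image some).card ≤ P.natDegree :=
    card_image_le.trans ((Multiset.toFinset_card_le _).trans (Polynomial.card_roots' P))
  refine (card_le_card h1).trans ((card_union_le _ _).trans ?_)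
  split_ifs with hc
  · have : P.natDegree ≠ m := by
      rintro rfl
      exact h0 (Polynomial.leadingCoeff_eq_zero.1 hc)
    rw [card_singleton]
    omega
  · simpa using h2.trans hP

lemma eq_zero_of_bev_eq_zero {m : ℕ} {P : Polynomial K} (hP : P.natDegree ≤ m)
    {D : Finset (Option K)} (hD : m < D.card) (h : ∀ u ∈ D, bev m P u = 0) : P = 0 := by
  by_contra h0
  have h1 := card_bev_zeros_le hP h0
  have h2 : D ⊆ univ.filter fun u => bev m P u = 0 := fun u hu => by simp [h u hu]
  have := card_le_card h2
  omega

end BinaryForms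

/-! ### Forms of degree at most one in the last variable -/

section Cones

variable {K : Type*} [Field K]

/-- Coordinates of a representative of a point of the projective line. -/
def lineRep (u : Option K) (z : K) : Fin 3 → K := ![u.elim 0 fun _ => 1, u.elim 1 id, z]

/-- The binary form of degree `m` with dehomogenisation `P`, in the first two variables. -/
def homog (m : ℕ) (P : Polynomial K) : MvPolynomial (Fin 3) K :=
  ∑ j ∈ range (m + 1), MvPolynomial.C (P.coeff j) *
    (MvPolynomial.X 0 ^ (m - j) * MvPolynomial.X 1 ^ j)

/-- The ternary form of degree `k + 1`, of degree at most one in the last variable, with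
coefficients the binary forms `A` and `B`. -/
def stdCone (k : ℕ) (A B : Polynomial K) : MvPolynomial (Fin 3) K :=
  MvPolynomial.X 2 * homog k A + homog (k + 1) B

lemma isHomogeneous_homog (m : ℕ) (P : Polynomial K) : (homog m P).IsHomogeneous m := by
  refine MvPolynomial.IsHomogeneous.sum _ _ _ fun j hj => ?_
  have := ((MvPolynomial.isHomogeneous_X K (0 : Fin 3)).pow (m - j)).mul
    ((MvPolynomial.isHomogeneous_X K (1 : Fin 3)).pow j)
  rw [mem_range] at hj
  rw [show 1 * (m - j) + 1 * j = m by omega] at this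
  exact this.C_mul _

lemma isHomogeneous_stdCone (k : ℕ) (A B : Polynomial K) :
    (stdCone k A B).IsHomogeneous (k + 1) := by
  refine MvPolynomial.IsHomogeneous.add ?_ (isHomogeneous_homog _ _)
  rw [add_comm k 1]
  exact (MvPolynomial.isHomogeneous_X K 2).mul (isHomogeneous_homog _ _)

lemma eval_homog {m : ℕ} {P : Polynomial K} (hP : P.natDegree ≤ m) (u : Option K) (z : K) :
    MvPolynomial.eval (lineRep u z) (homog m P) = bev m P u := by
  cases u with
  | none =>
    simp only [homog, lineRep, bev, map_sum, map_mul, map_pow, MvPolynomial.eval_C,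
      MvPolynomial.eval_X]
    rw [Finset.sum_eq_single m]
    · simp
    · intro j hj hjm
      rw [mem_range] at hj
      simp [show m - j ≠ 0 by omega]
    · simp
  | some t =>
    simp only [homog, lineRep, bev, map_sum, map_mul, map_pow, MvPolynomial.eval_C,
      MvPolynomial.eval_X]
    rw [Polynomial.eval_eq_sum_range' (Nat.lt_succ_of_le hP)]
    simp

lemma eval_stdCone {k : ℕ} {A B : Polynomial K} (hA : A.natDegree ≤ k) (hB : B.natDegree ≤ k + 1)
    (u : Option K) (z : K) :
    MvPolynomial.eval (lineRep u z) (stdCone k A B) = z * bev k A u + bev (k + 1) B u := by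
  rw [stdCone, map_add, map_mul, eval_homog hA, eval_homog hB]
  simp [lineRep]

lemma homog_add (m : ℕ) (P Q : Polynomial K) : homog m (P + Q) = homog m P + homog m Q := by
  simp [homog, add_mul, Finset.sum_add_distrib]

lemma homog_zero (m : ℕ) : homog m (0 : Polynomial K) = 0 := by simp [homog]

lemma homog_monomial {m j : ℕ} (hj : j ≤ m) (c : K) :
    homog m (Polynomial.monomial j c) =
      MvPolynomial.C c * (MvPolynomial.X 0 ^ (m - j) * MvPolynomial.X 1 ^ j) := by
  rw [homog, Finset.sum_eq_single j]
  · simp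
  · intro i _ hij
    simp [Polynomial.coeff_monomial, hij.symm]
  · simp only [mem_range]; omega

lemma monomial_eq_prod (m : Fin 3 →₀ ℕ) (c : K) :
    MvPolynomial.monomial m c = MvPolynomial.C c *
      (MvPolynomial.X 0 ^ m 0 * MvPolynomial.X 1 ^ m 1 * MvPolynomial.X 2 ^ m 2) := by
  rw [MvPolynomial.monomial_eq, Finsupp.prod_fintype _ _ (by simp), Fin.prod_univ_three]

/-- A form of degree at most one in the last variable is a cone. -/
lemma exists_stdCone {k : ℕ} {f : MvPolynomial (Fin 3) K} (hf : f.IsHomogeneous (k + 1))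
    (h2 : f.degreeOf 2 ≤ 1) : ∃ A B : Polynomial K, A.natDegree ≤ k ∧ B.natDegree ≤ k + 1 ∧
      f = stdCone k A B := by
  rw [MvPolynomial.degreeOf_le_iff] at h2
  rw [f.as_sum]
  have key : ∀ s : Finset (Fin 3 →₀ ℕ), s ⊆ f.support → ∃ A B : Polynomial K,
      A.natDegree ≤ k ∧ B.natDegree ≤ k + 1 ∧
      ∑ m ∈ s, MvPolynomial.monomial m (f.coeff m) = stdCone k A B := by
    intro s
    induction s using Finset.induction_on with
    | empty => exact fun _ => ⟨0, 0, by simp, by simp, by simp [stdCone, homog_zero]⟩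
    | insert m s hms ih =>
      intro hs
      obtain ⟨A, B, hA, hB, h⟩ := ih fun x hx => hs (mem_insert_of_mem hx)
      have hm := hs (mem_insert_self m s)
      have hdeg := hf.degree_eq_sum_deg_support hm
      have hdeg' : k + 1 = m 0 + m 1 + m 2 := by
        rw [hdeg]
        change m.degree = _
        rw [Finsupp.degree_eq_sum, Fin.sum_univ_three]
      have hm2 := h2 m hm
      rw [sum_insert hms, h, monomial_eq_prod]
      rcases Nat.le_one_iff_eq_zero_or_eq_one.1 hm2 with h0 | h1
      · refine ⟨A, Polynomial.monomial (m 1) (f.coeff m) + B, hA, ?_, ?_⟩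
        · exact (Polynomial.natDegree_add_le _ _).trans (max_le
            ((Polynomial.natDegree_monomial_le _).trans (by omega)) hB)
        · rw [stdCone, stdCone, homog_add, homog_monomial (by omega), h0,
            show k + 1 - m 1 = m 0 by omega]
          ring
      · refine ⟨Polynomial.monomial (m 1) (f.coeff m) + A, B, ?_, hB, ?_⟩
        · exact (Polynomial.natDegree_add_le _ _).trans (max_le
            ((Polynomial.natDegree_monomial_le _).trans (by omega)) hA)
        · rw [stdCone, stdCone, homog_add, homog_monomial (by omega), h1,
            show k - m 1 = m 0 by omega]
          ring
  exact key _ subset_rfl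

/-- The last coordinate point. -/
def lastPt : Fin 3 → K := ![0, 0, 1]

lemma eval_lastPt {d : ℕ} {f : MvPolynomial (Fin 3) K} (hf : f.IsHomogeneous d) :
    MvPolynomial.eval lastPt f = f.coeff (Finsupp.single 2 d) := by
  rw [MvPolynomial.eval_eq']
  rw [Finset.sum_eq_single (Finsupp.single 2 d)]
  · simp [Fin.prod_univ_three, lastPt]
  · intro m hm hne
    have hdeg := hf.degree_eq_sum_deg_support hm
    have hdeg' : d = m 0 + m 1 + m 2 := by
      rw [hdeg]
      change m.degree = _
      rw [Finsupp.degree_eq_sum, Fin.sum_univ_three]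
    have : m 0 ≠ 0 ∨ m 1 ≠ 0 := by
      by_contra! hc
      apply hne
      ext i
      fin_cases i <;> simp [hc.1, hc.2]
      omega
    rw [Fin.prod_univ_three]
    rcases this with h | h <;> simp [lastPt, h]
  · intro h
    simp only [MvPolynomial.mem_support_iff, not_not] at h
    simp [h]

/-- The value at the last coordinate point is the coefficient of the pure power of the last
variable, the only monomial of full degree in it. -/
lemma degreeOf_two_lt {d : ℕ} {f : MvPolynomial (Fin 3) K} (hf : f.IsHomogeneous (d + 1))
    (h0 : MvPolynomial.eval lastPt f = 0) : f.degreeOf 2 ≤ d := by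
  rw [MvPolynomial.degreeOf_le_iff]
  intro m hm
  have hdeg := hf.degree_eq_sum_deg_support hm
  have hdeg' : d + 1 = m 0 + m 1 + m 2 := by
    rw [hdeg]
    change m.degree = _
    rw [Finsupp.degree_eq_sum, Fin.sum_univ_three]
  by_contra hlt
  have : m = Finsupp.single 2 (d + 1) := by
    ext i
    fin_cases i <;> simp <;> omega
  rw [eval_lastPt hf, ← this] at h0
  exact MvPolynomial.mem_support_iff.1 hm h0

lemma eval_smul_of_isHomogeneous {d : ℕ} {f : MvPolynomial (Fin 3) K} (hf : f.IsHomogeneous d)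
    (c : K) (w : Fin 3 → K) :
    MvPolynomial.eval (c • w) f = c ^ d * MvPolynomial.eval w f := by
  rw [MvPolynomial.eval_eq', MvPolynomial.eval_eq', Finset.mul_sum]
  refine Finset.sum_congr rfl fun m hm => ?_
  have hdeg := hf.degree_eq_sum_deg_support hm
  have hdeg' : d = m 0 + m 1 + m 2 := by
    rw [hdeg]
    change m.degree = _
    rw [Finsupp.degree_eq_sum, Fin.sum_univ_three]
  rw [Fin.prod_univ_three, Fin.prod_univ_three, hdeg']
  simp only [Pi.smul_apply, smul_eq_mul]
  ring

/-- Linear substitution of the variables. -/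
def subst (M : Matrix (Fin 3) (Fin 3) K) : MvPolynomial (Fin 3) K →ₐ[K] MvPolynomial (Fin 3) K :=
  MvPolynomial.aeval fun i => lin (M i)

open Matrix in
lemma eval_subst (M : Matrix (Fin 3) (Fin 3) K) (w : Fin 3 → K) (f : MvPolynomial (Fin 3) K) :
    MvPolynomial.eval w (subst M f) = MvPolynomial.eval (M *ᵥ w) f := by
  rw [subst, ← MvPolynomial.aeval_eq_eval, ← MvPolynomial.aeval_eq_eval,
    ← AlgHom.comp_apply, MvPolynomial.comp_aeval]
  congr 2
  ext i
  rw [MvPolynomial.aeval_eq_eval, eval_lin]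
  rfl

lemma subst_isHomogeneous (M : Matrix (Fin 3) (Fin 3) K) {d : ℕ} {f : MvPolynomial (Fin 3) K}
    (hf : f.IsHomogeneous d) : (subst M f).IsHomogeneous d := by
  have := hf.aeval (fun i => lin (M i)) (n := 1) fun i => isHomogeneous_lin _
  rwa [one_mul] at this

open Matrix in
lemma subst_lin (M : Matrix (Fin 3) (Fin 3) K) (a : Fin 3 → K) :
    subst M (lin a) = lin (a ᵥ* M) := by
  simp only [subst, lin, Matrix.vecMul, dotProduct, Fin.sum_univ_three, map_add, map_mul,
    MvPolynomial.aeval_X, MvPolynomial.aeval_C, MvPolynomial.algebraMap_eq]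
  ring

lemma lin_one (k : Fin 3) : lin ((1 : Matrix (Fin 3) (Fin 3) K) k) = MvPolynomial.X k := by
  simp [lin, Matrix.one_apply]

lemma subst_subst {M M' : Matrix (Fin 3) (Fin 3) K} (h : M' * M = 1) (f : MvPolynomial (Fin 3) K) :
    subst M (subst M' f) = f := by
  have : (subst M).comp (subst M') = AlgHom.id K _ := by
    refine MvPolynomial.algHom_ext fun i => ?_
    have h1 : subst M' (MvPolynomial.X i) = lin (M' i) := MvPolynomial.aeval_X _ _
    rw [AlgHom.comp_apply, h1, subst_lin, ← Matrix.mul_apply_eq_vecMul, h, lin_one, AlgHom.id_apply]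
  exact DFunLike.congr_fun this f

end Cones

/-! ### Projection from a point -/

section Frames

variable {K ι : Type*} [Field K] [Fintype ι] {v : ι → Fin 3 → K}

/-- Coordinates adapted to a point `p`: the other points are given by a direction and a height. -/
structure Frame (v : ι → Fin 3 → K) (p : ι) where
  e : Option K × K → ι
  inj : Function.Injective e
  ne : ∀ x, e x ≠ p
  surj : ∀ i, i ≠ p → ∃ x, e x = i
  M : Matrix (Fin 3) (Fin 3) K
  M' : Matrix (Fin 3) (Fin 3) K
  mul : M * M' = 1
  mul' : M' * M = 1
  last : M.mulVec lastPt = v p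
  rep : ∀ u z, ∃ c : K, c ≠ 0 ∧ v (e (u, z)) = c • M.mulVec (lineRep u z)

lemma exists_matrix {w : Fin 3 → K} (hw : w ≠ 0) : ∃ M : Matrix (Fin 3) (Fin 3) K,
    M.det ≠ 0 ∧ M.mulVec lastPt = w := by
  by_cases h2 : w 2 = 0
  · by_cases h1 : w 1 = 0
    · have h0 : w 0 ≠ 0 := by
        intro h0
        apply hw
        ext i
        fin_cases i <;> simp [h0, h1, h2]
      refine ⟨!![0, 0, w 0; 1, 0, w 1; 0, 1, w 2], ?_, ?_⟩
      · simp [Matrix.det_fin_three, h0]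
      · ext i; fin_cases i <;> simp [Matrix.mulVec, dotProduct, Fin.sum_univ_three, lastPt]
    · refine ⟨!![1, 0, w 0; 0, 0, w 1; 0, 1, w 2], ?_, ?_⟩
      · simp [Matrix.det_fin_three, h1]
      · ext i; fin_cases i <;> simp [Matrix.mulVec, dotProduct, Fin.sum_univ_three, lastPt]
  · refine ⟨!![1, 0, w 0; 0, 1, w 1; 0, 0, w 2], ?_, ?_⟩
    · simp [Matrix.det_fin_three, h2]
    · ext i; fin_cases i <;> simp [Matrix.mulVec, dotProduct, Fin.sum_univ_three, lastPt]

lemma lineRep_ne_smul_lastPt (u : Option K) (z c : K) : lineRep u z ≠ c • lastPt := by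
  intro h
  cases u with
  | none => simpa [lineRep, lastPt] using congrFun h 1
  | some t => simpa [lineRep, lastPt] using congrFun h 0

lemma lineRep_injective {u u' : Option K} {z z' c : K} (h : lineRep u z = c • lineRep u' z') :
    u = u' ∧ z = z' := by
  have h0 := congrFun h 0
  have h1 := congrFun h 1
  have h2 := congrFun h 2
  cases u <;> cases u' <;> simp [lineRep] at h0 h1 h2
  · subst h1; simpa using h2
  · subst h0; simp at h1
  · subst h0; simp at h1 h2; simp [h1, h2]

lemma exists_lineRep {w : Fin 3 → K} (hw : ∀ c : K, w ≠ c • lastPt) :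
    ∃ u z, ∃ c : K, c ≠ 0 ∧ w = c • lineRep u z := by
  by_cases h0 : w 0 = 0
  · by_cases h1 : w 1 = 0
    · refine absurd ?_ (hw (w 2))
      ext i
      fin_cases i <;> simp [lastPt, h0, h1]
    · refine ⟨none, w 2 / w 1, w 1, h1, ?_⟩
      ext i
      fin_cases i <;> simp [lineRep, h0, mul_div_cancel₀, h1]
  · refine ⟨some (w 1 / w 0), w 2 / w 0, w 0, h0, ?_⟩
    ext i
    fin_cases i <;> simp [lineRep, mul_div_cancel₀, h0]

lemma exists_frame (hv : PlaneReps v) (p : ι) : Nonempty (Frame v p) := by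
  obtain ⟨M, hM, hp⟩ := exists_matrix (hv.ne_zero p)
  have hu : IsUnit M.det := hM.isUnit
  have h1 := Matrix.mul_nonsing_inv M hu
  have h2 := Matrix.nonsing_inv_mul M hu
  have hinj : ∀ a b : Fin 3 → K, M.mulVec a = M.mulVec b → a = b := fun a b h => by
    have := congrArg M⁻¹.mulVec h
    simpa [Matrix.mulVec_mulVec, h2] using this
  have hx : ∀ x : Option K × K, ∃ i, ∃ c : K, c ≠ 0 ∧ v i = c • M.mulVec (lineRep x.1 x.2) := by
    intro x
    refine hv.exists_smul fun h0 => lineRep_ne_smul_lastPt x.1 x.2 0 ?_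
    rw [zero_smul]
    exact hinj _ _ (by rw [h0, Matrix.mulVec_zero])
  choose e c hc he using hx
  refine ⟨⟨e, ?_, ?_, ?_, M, M⁻¹, h1, h2, hp, fun u z => ⟨_, hc (u, z), he (u, z)⟩⟩⟩
  · rintro ⟨u, z⟩ ⟨u', z'⟩ h
    have h3 := (he (u, z)).symm.trans ((congrArg v h).trans (he (u', z')))
    have h4 : lineRep u z = ((c (u, z))⁻¹ * c (u', z')) • lineRep u' z' := by
      apply hinj
      rw [Matrix.mulVec_smul, mul_smul, ← h3, inv_smul_smul₀ (hc _)]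
    exact Prod.ext_iff.2 (lineRep_injective h4)
  · intro x h
    have h3 := he x
    rw [h, ← hp] at h3
    apply lineRep_ne_smul_lastPt x.1 x.2 (c x)⁻¹
    apply hinj
    rw [Matrix.mulVec_smul, h3, inv_smul_smul₀ (hc _)]
  · intro i hi
    obtain ⟨u, z, d, hd, h⟩ := exists_lineRep (w := M⁻¹.mulVec (v i)) (fun b hb => hi (by
      apply hv.eq_of_smul (c := b)
      rw [← hp, ← Matrix.mulVec_smul, ← hb, Matrix.mulVec_mulVec, h1, Matrix.one_mulVec]))
    refine ⟨(u, z), ?_⟩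
    have h3 : v i = d • M.mulVec (lineRep u z) := by
      rw [← Matrix.mulVec_smul, ← h, Matrix.mulVec_mulVec, h1, Matrix.one_mulVec]
    apply hv.eq_of_smul (c := c (u, z) * d⁻¹)
    rw [he (u, z), h3, smul_smul, mul_assoc, inv_mul_cancel₀ hd, mul_one]

/-- The cubic form `f` lies in the square of the ideal of the point `p`. -/
def SingularAt (v : ι → Fin 3 → K) (p : ι) (f : MvPolynomial (Fin 3) K) : Prop :=
  ∃ x y G H : MvPolynomial (Fin 3) K, x.IsHomogeneous 1 ∧ y.IsHomogeneous 1 ∧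
    G.IsHomogeneous 2 ∧ H.IsHomogeneous 2 ∧ MvPolynomial.eval (v p) x = 0 ∧
    MvPolynomial.eval (v p) y = 0 ∧ MvPolynomial.eval (v p) G = 0 ∧
    MvPolynomial.eval (v p) H = 0 ∧ f = x * G + y * H

namespace Frame

variable {p : ι} (F : Frame v p)

/-- The plane curve of degree `k + 1` with equation `z A(u) + B(u) = 0` in adapted coordinates. -/
def cone (k : ℕ) (A B : Polynomial K) : MvPolynomial (Fin 3) K := subst F.M' (stdCone k A B)

lemma cone_isHomogeneous (k : ℕ) (A B : Polynomial K) : (F.cone k A B).IsHomogeneous (k + 1) :=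
  subst_isHomogeneous _ (isHomogeneous_stdCone k A B)

lemma exists_eval (u : Option K) (z : K) : ∃ c : K, c ≠ 0 ∧
    ∀ (d : ℕ) (f : MvPolynomial (Fin 3) K), f.IsHomogeneous d →
      MvPolynomial.eval (v (F.e (u, z))) (subst F.M' f) =
        c ^ d * MvPolynomial.eval (lineRep u z) f := by
  obtain ⟨c, hc, h⟩ := F.rep u z
  refine ⟨c, hc, fun d f hf => ?_⟩
  rw [h, eval_smul_of_isHomogeneous (subst_isHomogeneous _ hf), eval_subst, Matrix.mulVec_mulVec,
    F.mul', Matrix.one_mulVec]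

lemma eval_subst_point (f : MvPolynomial (Fin 3) K) :
    MvPolynomial.eval (v p) (subst F.M' f) = MvPolynomial.eval lastPt f := by
  rw [eval_subst, ← F.last, Matrix.mulVec_mulVec, F.mul', Matrix.one_mulVec]

lemma eval_lastPt_subst (f : MvPolynomial (Fin 3) K) :
    MvPolynomial.eval lastPt (subst F.M f) = MvPolynomial.eval (v p) f := by
  rw [eval_subst, F.last]

lemma mem_zeros_cone {k : ℕ} {A B : Polynomial K} (hA : A.natDegree ≤ k)
    (hB : B.natDegree ≤ k + 1) {u : Option K} {z : K} :
    F.e (u, z) ∈ zeros v (F.cone k A B) ↔ z * bev k A u + bev (k + 1) B u = 0 := by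
  obtain ⟨c, hc, h⟩ := F.exists_eval u z
  rw [mem_zeros, cone, h _ _ (isHomogeneous_stdCone k A B), eval_stdCone hA hB]
  simp [hc]

lemma point_mem_zeros_cone {k : ℕ} (hk : k ≠ 0) (A B : Polynomial K) :
    p ∈ zeros v (F.cone k A B) := by
  rw [mem_zeros, cone, F.eval_subst_point, stdCone, homog, homog]
  simp only [map_add, map_mul, map_sum, map_pow, MvPolynomial.eval_X, MvPolynomial.eval_C]
  rw [Finset.sum_eq_zero, Finset.sum_eq_zero]
  · simp
  · intro j hj
    by_cases h : j = 0 <;> simp [lastPt, h]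
  · intro j hj
    by_cases h : j = 0 <;> simp [lastPt, h, hk]

lemma subst_subst_self (f : MvPolynomial (Fin 3) K) : subst F.M' (subst F.M f) = f :=
  subst_subst F.mul f

lemma exists_cone_line {f : MvPolynomial (Fin 3) K} (hf : f.IsHomogeneous 1) :
    ∃ A B : Polynomial K, A.natDegree ≤ 0 ∧ B.natDegree ≤ 1 ∧ f = F.cone 0 A B := by
  have h1 := subst_isHomogeneous F.M hf
  obtain ⟨A, B, hA, hB, h⟩ := exists_stdCone (k := 0) h1
    ((MvPolynomial.degreeOf_le_totalDegree _ _).trans h1.totalDegree_le)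
  exact ⟨A, B, hA, hB, by rw [cone, ← h, F.subst_subst_self]⟩

lemma exists_cone_conic {f : MvPolynomial (Fin 3) K} (hf : f.IsHomogeneous 2)
    (h0 : MvPolynomial.eval (v p) f = 0) :
    ∃ A B : Polynomial K, A.natDegree ≤ 1 ∧ B.natDegree ≤ 2 ∧ f = F.cone 1 A B := by
  have h1 := subst_isHomogeneous F.M hf
  obtain ⟨A, B, hA, hB, h⟩ := exists_stdCone (k := 1) h1
    (degreeOf_two_lt h1 (by rw [F.eval_lastPt_subst, h0]))
  exact ⟨A, B, hA, hB, by rw [cone, ← h, F.subst_subst_self]⟩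

/-- A conic missing `p` is normalised to be monic of degree two in the height; subtracting the
square of the last variable brings it back to a cone. -/
lemma exists_conic_eq {f : MvPolynomial (Fin 3) K} (hf : f.IsHomogeneous 2)
    (h0 : MvPolynomial.eval (v p) f ≠ 0) :
    ∃ A B : Polynomial K, A.natDegree ≤ 1 ∧ B.natDegree ≤ 2 ∧
      ∀ u z, F.e (u, z) ∈ zeros v f → z ^ 2 + z * bev 1 A u + bev 2 B u = 0 := by
  set c := MvPolynomial.eval (v p) f with hc
  have h1 := subst_isHomogeneous F.M (hf.C_mul c⁻¹)
  have h2 : (MvPolynomial.X 2 ^ 2 : MvPolynomial (Fin 3) K).IsHomogeneous 2 := by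
    simpa using (MvPolynomial.isHomogeneous_X K (2 : Fin 3)).pow 2
  have h3 := h1.sub h2
  obtain ⟨A, B, hA, hB, h⟩ := exists_stdCone (k := 1) h3 (degreeOf_two_lt h3 (by
    rw [map_sub, F.eval_lastPt_subst]
    simp [← hc, h0, lastPt]))
  refine ⟨A, B, hA, hB, fun u z hz => ?_⟩
  obtain ⟨b, hb, hev⟩ := F.exists_eval u z
  have h4 := hev _ _ h1
  rw [F.subst_subst_self] at h4
  have h5 := congrArg (MvPolynomial.eval (lineRep u z)) h
  rw [map_sub, eval_stdCone hA hB] at h5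
  rw [mem_zeros] at hz
  simp only [map_mul, hz, mul_zero, zero_eq_mul] at h4
  have h6 : MvPolynomial.eval (lineRep u z) (subst F.M (MvPolynomial.C c⁻¹ * f)) = 0 := by
    rcases h4 with h | h
    · exact absurd h (pow_ne_zero _ hb)
    · simpa using h
  rw [h6] at h5
  have h7 : MvPolynomial.eval (lineRep u z) (MvPolynomial.X 2 ^ 2) = z ^ 2 := by simp [lineRep]
  rw [h7] at h5
  linear_combination -h5

/-- In each product of `SingularAt` the linear factor is free of the last variable and the quadratic
one has degree at most one in it. -/
lemma exists_cone_of_singularAt {f : MvPolynomial (Fin 3) K} (hf : SingularAt v p f) :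
    ∃ A B : Polynomial K, A.natDegree ≤ 2 ∧ B.natDegree ≤ 3 ∧ f = F.cone 2 A B := by
  obtain ⟨x, y, G, H, hx, hy, hG, hH, hx0, hy0, hG0, hH0, rfl⟩ := hf
  have key : ∀ x G : MvPolynomial (Fin 3) K, x.IsHomogeneous 1 → G.IsHomogeneous 2 →
      MvPolynomial.eval (v p) x = 0 → MvPolynomial.eval (v p) G = 0 →
      (subst F.M (x * G)).degreeOf 2 ≤ 1 := by
    intro x G hx hG hx0 hG0
    rw [map_mul]
    have h1 := degreeOf_two_lt (d := 0) (subst_isHomogeneous F.M hx)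
      (by rw [F.eval_lastPt_subst, hx0])
    have h2 := degreeOf_two_lt (d := 1) (subst_isHomogeneous F.M hG)
      (by rw [F.eval_lastPt_subst, hG0])
    exact (MvPolynomial.degreeOf_mul_le _ _ _).trans (by omega)
  have hhom : (x * G + y * H).IsHomogeneous 3 := (hx.mul hG).add (hy.mul hH)
  have h1 := subst_isHomogeneous F.M hhom
  obtain ⟨A, B, hA, hB, h⟩ := exists_stdCone (k := 2) h1 (by
    rw [map_add]
    exact (MvPolynomial.degreeOf_add_le _ _ _).trans
      (max_le (key x G hx hG hx0 hG0) (key y H hy hH hy0 hH0)))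
  exact ⟨A, B, hA, hB, by rw [cone, ← h, F.subst_subst_self]⟩

lemma singularAt_cone (A B : Polynomial K) : SingularAt v p (F.cone 2 A B) := by
  have hX : ∀ i : Fin 3, (MvPolynomial.X i : MvPolynomial (Fin 3) K).IsHomogeneous 1 :=
    fun i => MvPolynomial.isHomogeneous_X K i
  have hXX : ∀ (c : K) (i j : Fin 3), (MvPolynomial.C c * (MvPolynomial.X i * MvPolynomial.X j) :
      MvPolynomial (Fin 3) K).IsHomogeneous 2 := fun c i j => ((hX i).mul (hX j)).C_mul c
  refine ⟨subst F.M' (MvPolynomial.X 0), subst F.M' (MvPolynomial.X 1),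
    subst F.M' (MvPolynomial.C (A.coeff 0) * (MvPolynomial.X 2 * MvPolynomial.X 0) +
      MvPolynomial.C (A.coeff 1) * (MvPolynomial.X 2 * MvPolynomial.X 1) +
      MvPolynomial.C (B.coeff 0) * (MvPolynomial.X 0 * MvPolynomial.X 0) +
      MvPolynomial.C (B.coeff 1) * (MvPolynomial.X 0 * MvPolynomial.X 1) +
      MvPolynomial.C (B.coeff 2) * (MvPolynomial.X 1 * MvPolynomial.X 1)),
    subst F.M' (MvPolynomial.C (A.coeff 2) * (MvPolynomial.X 2 * MvPolynomial.X 1) +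
      MvPolynomial.C (B.coeff 3) * (MvPolynomial.X 1 * MvPolynomial.X 1)),
    subst_isHomogeneous _ (hX 0), subst_isHomogeneous _ (hX 1),
    subst_isHomogeneous _ ((((hXX _ _ _).add (hXX _ _ _)).add (hXX _ _ _)).add (hXX _ _ _) |>.add
      (hXX _ _ _)), subst_isHomogeneous _ ((hXX _ _ _).add (hXX _ _ _)), ?_, ?_, ?_, ?_, ?_⟩
  · rw [F.eval_subst_point]; simp [lastPt]
  · rw [F.eval_subst_point]; simp [lastPt]
  · rw [F.eval_subst_point]; simp [lastPt]
  · rw [F.eval_subst_point]; simp [lastPt]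
  · rw [← map_mul, ← map_mul, ← map_add, cone, stdCone, homog, homog]
    congr 1
    simp [Finset.sum_range_succ]
    ring

variable [Fintype K]

/-- The heights 0 and 1 separate the two coefficients; the bound on `k` makes the `q + 1` directions
more than the degrees `k` and `k + 1`. -/
lemma cone_injective {k : ℕ} (hk : k ≤ Fintype.card K - 1) {A B A' B' : Polynomial K}
    (hA : A.natDegree ≤ k) (hB : B.natDegree ≤ k + 1) (hA' : A'.natDegree ≤ k)
    (hB' : B'.natDegree ≤ k + 1) (h : F.cone k A B = F.cone k A' B') : A = A' ∧ B = B' := by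
  have hev : ∀ u z, z * bev k (A - A') u + bev (k + 1) (B - B') u = 0 := by
    intro u z
    obtain ⟨c, hc, hc'⟩ := F.exists_eval u z
    have h1 := hc' _ _ (isHomogeneous_stdCone k A B)
    have h2 := hc' _ _ (isHomogeneous_stdCone k A' B')
    rw [← cone, eval_stdCone hA hB] at h1
    rw [← cone, ← h, h1, eval_stdCone hA' hB'] at h2
    have := mul_left_cancel₀ (pow_ne_zero _ hc) h2
    rw [bev_sub, bev_sub]
    linear_combination this
  have hB0 : ∀ u, bev (k + 1) (B - B') u = 0 := fun u => by simpa using hev u 0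
  have hA0 : ∀ u, bev k (A - A') u = 0 := fun u => by simpa [hB0 u] using hev u 1
  have hc := Fintype.one_lt_card (α := K)
  constructor
  · exact sub_eq_zero.1 (eq_zero_of_bev_eq_zero (D := univ)
      ((Polynomial.natDegree_sub_le _ _).trans (max_le hA hA'))
      (by rw [card_univ, Fintype.card_option]; omega) fun u _ => hA0 u)
  · exact sub_eq_zero.1 (eq_zero_of_bev_eq_zero (D := univ)
      ((Polynomial.natDegree_sub_le _ _).trans (max_le hB hB'))
      (by rw [card_univ, Fintype.card_option]; omega) fun u _ => hB0 u)

lemma cone_zero (k : ℕ) : F.cone k 0 0 = 0 := by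
  simp [cone, stdCone, homog_zero]

lemma cone_ne_zero {k : ℕ} (hk : k ≤ Fintype.card K - 1) {A B : Polynomial K}
    (hA : A.natDegree ≤ k) (hB : B.natDegree ≤ k + 1) (h : A ≠ 0 ∨ B ≠ 0) : F.cone k A B ≠ 0 := by
  intro h0
  rw [← F.cone_zero k] at h0
  obtain ⟨rfl, rfl⟩ := F.cone_injective hk hA hB (by simp) (by simp) h0
  simp at h

end Frame

end Frames

/-! ### Coprime pairs of binary forms -/

section Coprime

variable {K : Type*} [Field K]

open Polynomial

/-- The binary forms of degrees `k` and `k + 1` with dehomogenisations `A` and `B` are coprime. -/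
structure Cop (k : ℕ) (A B : K[X]) : Prop where
  natDegree_left : A.natDegree ≤ k
  natDegree_right : B.natDegree ≤ k + 1
  coprime : IsCoprime A B
  top : A.coeff k ≠ 0 ∨ B.coeff (k + 1) ≠ 0

namespace Cop

variable {k : ℕ} {A B : K[X]}

lemma ne_zero (h : Cop k A B) : A ≠ 0 := by
  rintro rfl
  have h1 := isCoprime_zero_left.1 h.coprime
  have h2 := natDegree_eq_zero_of_isUnit h1
  rcases h.top with h3 | h3
  · simp at h3
  · exact h3 (coeff_eq_zero_of_natDegree_lt (by omega))

lemma bev_ne_zero (h : Cop k A B) {u : Option K} (hu : bev k A u = 0) : bev (k + 1) B u ≠ 0 := by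
  intro hB
  cases u with
  | none => exact h.top.elim (fun h => h hu) (fun h => h hB)
  | some t =>
    obtain ⟨a, b, hab⟩ := h.coprime
    have := congrArg (eval t) hab
    simp only [bev] at hu hB
    simp [hu, hB] at this

lemma C_mul (h : Cop k A B) {c : K} (hc : c ≠ 0) : Cop k (C c * A) (C c * B) := by
  refine ⟨(natDegree_C_mul_le _ _).trans h.natDegree_left,
    (natDegree_C_mul_le _ _).trans h.natDegree_right, ?_, ?_⟩
  · have hu : IsUnit (C c) := isUnit_C.2 hc.isUnit
    exact (isCoprime_mul_unit_left hu A B).2 h.coprime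
  · simpa [hc] using h.top

/-- Two pairs of forms with vanishing cross product, one of them coprime. -/
lemma exists_factor (h : Cop k A B) {l : ℕ} {a b : K[X]} (ha : a.natDegree ≤ l)
    (hb : b.natDegree ≤ l + 1) (hab : a * B = b * A) :
    ∃ c, a = c * A ∧ b = c * B ∧ (c = 0 ∨ k + c.natDegree ≤ l) := by
  have h1 : A ∣ a * B := ⟨b, by rw [hab, mul_comm]⟩
  obtain ⟨c, rfl⟩ := h.coprime.dvd_of_dvd_mul_right h1
  have h2 : b = c * B := by
    apply mul_right_cancel₀ h.ne_zero
    rw [← hab]; ring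
  subst h2
  refine ⟨c, mul_comm _ _, rfl, ?_⟩
  by_cases hc : c = 0
  · exact Or.inl hc
  right
  rw [natDegree_mul h.ne_zero hc] at ha
  rcases h.top with ht | ht
  · have := le_natDegree_of_ne_zero ht
    omega
  · have := le_natDegree_of_ne_zero ht
    rw [natDegree_mul hc (by rintro rfl; simp at ht)] at hb
    omega

/-- A nonzero cross product of forms vanishes at a bounded number of points. -/
lemma eq_of_bev [Fintype K] (h : Cop k A B) {l : ℕ} {a b : K[X]} (ha : a.natDegree ≤ l)
    (hb : b.natDegree ≤ l + 1) {D : Finset (Option K)} (hD : k + l + 1 < D.card)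
    (hz : ∀ u ∈ D, bev l a u * bev (k + 1) B u = bev (l + 1) b u * bev k A u) :
    a * B = b * A := by
  have hA := h.natDegree_left
  have hB := h.natDegree_right
  have e : l + (k + 1) = l + 1 + k := by omega
  refine sub_eq_zero.1 (eq_zero_of_bev_eq_zero (m := l + (k + 1)) ?_
    (show l + (k + 1) < D.card by omega) fun u hu => ?_)
  · refine (natDegree_sub_le _ _).trans (max_le ?_ ?_)
    · exact natDegree_mul_le.trans (by omega)
    · exact natDegree_mul_le.trans (by omega)
  · rw [bev_sub, bev_mul ha hB, e, bev_mul hb hA, hz u hu, sub_self]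

end Cop

/-- Division by the greatest common divisor of two binary forms, a common zero at infinity included.
-/
lemma exists_cop {k : ℕ} {A B : K[X]} (hA0 : A ≠ 0) (hA : A.natDegree ≤ k)
    (hB : B.natDegree ≤ k + 1) :
    ∃ l ≤ k, ∃ g A₁ B₁ : K[X], g ≠ 0 ∧ g.natDegree ≤ k - l ∧ Cop l A₁ B₁ ∧
      A = g * A₁ ∧ B = g * B₁ := by
  set g := EuclideanDomain.gcd A B with hg
  have hg0 : g ≠ 0 := fun h => hA0 (EuclideanDomain.gcd_eq_zero_iff.1 h).1
  obtain ⟨A₁, hA₁⟩ := EuclideanDomain.gcd_dvd_left A B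
  obtain ⟨B₁, hB₁⟩ := EuclideanDomain.gcd_dvd_right A B
  rw [← hg] at hA₁ hB₁
  have hA₁0 : A₁ ≠ 0 := by rintro rfl; simp at hA₁; exact hA0 hA₁
  have hcop : IsCoprime A₁ B₁ := by
    have := EuclideanDomain.gcd_eq_gcd_ab A B
    rw [← hg] at this
    refine ⟨EuclideanDomain.gcdA A B, EuclideanDomain.gcdB A B, mul_left_cancel₀ hg0 ?_⟩
    rw [mul_one]
    conv_rhs => rw [this]
    conv_rhs => rw [hA₁, hB₁]
    rw [← hA₁, ← hB₁]
    linear_combination (-EuclideanDomain.gcdA A B) * hA₁ - EuclideanDomain.gcdB A B * hB₁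
  have dA : g.natDegree + A₁.natDegree ≤ k := by
    rw [← natDegree_mul hg0 hA₁0, ← hA₁]; exact hA
  have dB : B₁ ≠ 0 → g.natDegree + B₁.natDegree ≤ k + 1 := fun h => by
    rw [← natDegree_mul hg0 h, ← hB₁]; exact hB
  have dB' : g.natDegree + (B₁.natDegree - 1) ≤ k := by
    by_cases h : B₁ = 0
    · subst h; simp; omega
    · have := dB h; omega
  -- The smallest admissible degree, for which one of the two top coefficients is nonzero. The
  -- excess of `k - l` over the degree of `g` is the multiplicity of the common zero at infinity.
  refine ⟨max A₁.natDegree (B₁.natDegree - 1), by omega, g, A₁, B₁, hg0, by omega,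
    ⟨by omega, by omega, hcop, ?_⟩, hA₁, hB₁⟩
  rcases le_or_gt (B₁.natDegree - 1) A₁.natDegree with h | h
  · left
    rw [max_eq_left h]
    exact leadingCoeff_ne_zero.2 hA₁0
  · right
    rw [max_eq_right h.le, Nat.sub_add_cancel (by omega)]
    exact leadingCoeff_ne_zero.2 (by rintro rfl; simp at h)

/-- The linear binary form vanishing at `u`. -/
def rootForm (u : Option K) : K[X] := u.elim 1 fun t => X - C t

lemma natDegree_rootForm (u : Option K) : (rootForm u).natDegree ≤ 1 := by
  cases u <;> simp [rootForm]

lemma rootForm_ne_zero (u : Option K) : rootForm u ≠ 0 := by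
  cases u with
  | none => simp [rootForm]
  | some t => exact X_sub_C_ne_zero t

lemma bev_rootForm {u u' : Option K} : bev 1 (rootForm u) u' = 0 ↔ u' = u := by
  cases u <;> cases u' <;> simp [rootForm, bev, coeff_one, coeff_X, sub_eq_zero]

lemma exists_eq_rootForm_mul {m : ℕ} {P : K[X]} (hP : P.natDegree ≤ m + 1) {u : Option K}
    (hu : bev (m + 1) P u = 0) : ∃ Q : K[X], Q.natDegree ≤ m ∧ P = rootForm u * Q := by
  cases u with
  | none =>
    refine ⟨P, ?_, by simp [rootForm]⟩
    by_contra h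
    have h1 : P.natDegree = m + 1 := by omega
    simp only [bev, ← h1] at hu
    rw [coeff_natDegree, leadingCoeff_eq_zero] at hu
    simp [hu] at h1
  | some t =>
    obtain ⟨Q, rfl⟩ := dvd_iff_isRoot.2 (show IsRoot P t from hu)
    refine ⟨Q, ?_, rfl⟩
    by_cases hQ : Q = 0
    · simp [hQ]
    · rw [natDegree_mul (X_sub_C_ne_zero t) hQ, natDegree_X_sub_C] at hP
      omega

lemma exists_bev_eq_zero {g : K[X]} (hg : g.natDegree ≤ 1) : ∃ u, bev 1 g u = 0 := by
  by_cases h : g.coeff 1 = 0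
  · exact ⟨none, h⟩
  · refine ⟨some (-g.coeff 0 / g.coeff 1), ?_⟩
    simp only [bev]
    rw [eq_X_add_C_of_natDegree_le_one hg]
    simp
    field_simp
    ring

lemma Cop.bev_zero_ne_zero {A B : K[X]} (h : Cop 0 A B) (u : Option K) : bev 0 A u ≠ 0 := by
  have h0 := h.ne_zero
  have h1 := eq_C_of_natDegree_le_zero h.natDegree_left
  rw [h1] at h0 ⊢
  have : A.coeff 0 ≠ 0 := by rintro h; simp [h] at h0
  cases u <;> simpa [bev] using this

/-- Forms of degrees at most two and three without a common rational zero are coprime, provided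
that the first one has a rational zero. -/
lemma cop_of_root {k : ℕ} (hk : k ≤ 2) {A B : K[X]} (hA0 : A ≠ 0) (hA : A.natDegree ≤ k)
    (hB : B.natDegree ≤ k + 1) {u₀ : Option K} (hu₀ : bev k A u₀ = 0)
    (hc : ∀ u, bev k A u = 0 → bev (k + 1) B u ≠ 0) : Cop k A B := by
  obtain ⟨l, hl, g, A₁, B₁, hg0, hg, hcop, rfl, rfl⟩ := exists_cop hA0 hA hB
  have hA₁ := hcop.natDegree_left
  have hB₁ := hcop.natDegree_right
  rcases hl.eq_or_lt with rfl | hlt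
  · rw [Nat.sub_self] at hg
    rw [eq_C_of_natDegree_le_zero hg] at hg0 ⊢
    exact hcop.C_mul (by rintro h; simp [h] at hg0)
  exfalso
  -- A common factor of degree one has a rational zero. One of degree two is the first form up to a
  -- constant, and so vanishes at `u₀`.
  obtain ⟨u, hu⟩ : ∃ u, bev (k - l) g u = 0 := by
    have : k - l = 1 ∨ (l = 0 ∧ k = 2) := by omega
    rcases this with h1 | ⟨rfl, rfl⟩
    · rw [h1] at hg ⊢
      exact exists_bev_eq_zero hg
    · refine ⟨u₀, ?_⟩
      have := bev_mul hg hA₁ u₀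
      rw [Nat.sub_zero, Nat.add_zero, hu₀] at this
      exact (mul_eq_zero.1 this.symm).resolve_right (hcop.bev_zero_ne_zero u₀)
  have e1 := bev_mul hg hA₁ u
  have e2 := bev_mul hg hB₁ u
  rw [hu, zero_mul] at e1 e2
  rw [Nat.sub_add_cancel hl] at e1
  rw [← add_assoc, Nat.sub_add_cancel hl] at e2
  exact hc u e1 e2

end Coprime

/-! ### Counting binary forms and coprime pairs -/

section PolynomialCounts

variable {K : Type*} [Field K] [Fintype K]

open Polynomial

/-- The polynomials of degree at most `m`. -/
def polys (K : Type*) [Field K] [Fintype K] (m : ℕ) : Finset K[X] :=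
  univ.image fun c : Fin (m + 1) → K => ∑ i, C (c i) * X ^ (i : ℕ)

lemma coeff_sum_fin {m : ℕ} (c : Fin (m + 1) → K) (j : Fin (m + 1)) :
    (∑ i, C (c i) * X ^ (i : ℕ)).coeff j = c j := by
  rw [finsetSum_coeff, Finset.sum_eq_single j]
  · simp
  · intro i _ hij
    simp [coeff_X_pow, Fin.val_inj, hij.symm]
  · simp

lemma mem_polys {m : ℕ} {P : K[X]} : P ∈ polys K m ↔ P.natDegree ≤ m := by
  rw [polys, mem_image]
  constructor
  · rintro ⟨c, -, rfl⟩
    refine natDegree_sum_le_of_forall_le _ _ fun i _ => ?_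
    exact (natDegree_C_mul_X_pow_le _ _).trans (by omega)
  · intro h
    refine ⟨fun i => P.coeff i, mem_univ _, ?_⟩
    conv_rhs => rw [P.as_sum_range_C_mul_X_pow' (Nat.lt_succ_of_le h)]
    rw [Finset.sum_range]

lemma card_polys (m : ℕ) : (polys K m).card = Fintype.card K ^ (m + 1) := by
  rw [polys, card_image_of_injective, card_univ, Fintype.card_fun, Fintype.card_fin]
  intro c c' h
  funext j
  rw [← coeff_sum_fin c j, ← coeff_sum_fin c' j]
  exact congrArg (fun P => P.coeff j) h

lemma card_filter_bev (m : ℕ) (u : Option K) :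
    ((polys K (m + 1)).filter fun P => bev (m + 1) P u = 0).card = Fintype.card K ^ (m + 1) := by
  rw [← card_polys, ← card_image_of_injective (polys K m) (mul_right_injective₀ (rootForm_ne_zero u))]
  congr 1
  ext P
  simp only [mem_filter, mem_polys, mem_image]
  constructor
  · rintro ⟨hP, hu⟩
    obtain ⟨Q, hQ, rfl⟩ := exists_eq_rootForm_mul hP hu
    exact ⟨Q, hQ, rfl⟩
  · rintro ⟨Q, hQ, rfl⟩
    have h1 := natDegree_rootForm u
    refine ⟨natDegree_mul_le.trans (by omega), ?_⟩
    rw [add_comm m 1, bev_mul h1 hQ, bev_rootForm.2 rfl, zero_mul]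

lemma card_filter_bev_two (m : ℕ) {u u' : Option K} (h : u ≠ u') :
    ((polys K (m + 2)).filter fun P => bev (m + 2) P u = 0 ∧ bev (m + 2) P u' = 0).card =
      Fintype.card K ^ (m + 1) := by
  rw [← card_filter_bev m u',
    ← card_image_of_injective ((polys K (m + 1)).filter fun P => bev (m + 1) P u' = 0)
      (mul_right_injective₀ (rootForm_ne_zero u))]
  congr 1
  ext P
  have h1 := natDegree_rootForm u
  simp only [mem_filter, mem_polys, mem_image]
  constructor
  · rintro ⟨hP, hu, hu'⟩
    obtain ⟨Q, hQ, rfl⟩ := exists_eq_rootForm_mul (m := m + 1) hP hu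
    refine ⟨Q, ⟨hQ, ?_⟩, rfl⟩
    rw [show m + 2 = 1 + (m + 1) by omega, bev_mul h1 hQ] at hu'
    exact (mul_eq_zero.1 hu').resolve_left fun h0 => h (bev_rootForm.1 h0).symm
  · rintro ⟨Q, ⟨hQ, hu'⟩, rfl⟩
    refine ⟨natDegree_mul_le.trans (by omega), ?_, ?_⟩
    · rw [show m + 2 = 1 + (m + 1) by omega, bev_mul h1 hQ, bev_rootForm.2 rfl, zero_mul]
    · rw [show m + 2 = 1 + (m + 1) by omega, bev_mul h1 hQ, hu', mul_zero]

lemma card_filter_bev_ne (m : ℕ) (u : Option K) :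
    (((polys K (m + 1)).filter fun P => bev (m + 1) P u ≠ 0).card : ℤ) =
      (Fintype.card K : ℤ) ^ (m + 2) - Fintype.card K ^ (m + 1) := by
  have h := card_filter_add_card_filter_not (s := polys K (m + 1)) fun P => bev (m + 1) P u = 0
  rw [card_filter_bev, card_polys] at h
  zify at h
  linear_combination h

lemma card_filter_bev_ne_two (m : ℕ) {u u' : Option K} (h : u ≠ u') :
    (((polys K (m + 2)).filter fun P => bev (m + 2) P u ≠ 0 ∧ bev (m + 2) P u' ≠ 0).card : ℤ) =
      (Fintype.card K : ℤ) ^ (m + 3) - 2 * Fintype.card K ^ (m + 2) + Fintype.card K ^ (m + 1) := by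
  have h1 := card_filter_bev_ne (m + 1) u
  have h2 := card_filter_add_card_filter_not
    (s := (polys K (m + 2)).filter fun P => bev (m + 2) P u ≠ 0) fun P => bev (m + 2) P u' = 0
  have h3 := card_filter_add_card_filter_not
    (s := (polys K (m + 2)).filter fun P => bev (m + 2) P u' = 0) fun P => bev (m + 2) P u = 0
  have h4 := card_filter_bev_two m h
  have h5 := card_filter_bev (m + 1) u'
  simp only [filter_filter] at h2 h3
  have e1 : ((polys K (m + 2)).filter fun P => bev (m + 2) P u' = 0 ∧ ¬ bev (m + 2) P u = 0) =
      (polys K (m + 2)).filter fun P => bev (m + 2) P u ≠ 0 ∧ bev (m + 2) P u' = 0 := by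
    ext P; simp only [mem_filter]; tauto
  have e2 : ((polys K (m + 2)).filter fun P => bev (m + 2) P u' = 0 ∧ bev (m + 2) P u = 0) =
      (polys K (m + 2)).filter fun P => bev (m + 2) P u = 0 ∧ bev (m + 2) P u' = 0 := by
    ext P; simp only [mem_filter]; tauto
  rw [e1, e2, h4] at h3
  zify at h2 h3 h5
  rw [h5] at h3
  rw [h1] at h2
  simp only [ne_eq] at h2 h3 ⊢
  linear_combination h2 - h3

/-- The coprime pairs of binary forms of degrees `k` and `k + 1`. -/
def copSet (K : Type*) [Field K] [Fintype K] (k : ℕ) : Finset (K[X] × K[X]) :=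
  (polys K k ×ˢ polys K (k + 1)).filter fun x => Cop k x.1 x.2

lemma mem_copSet {k : ℕ} {x : K[X] × K[X]} : x ∈ copSet K k ↔ Cop k x.1 x.2 := by
  rw [copSet, mem_filter, mem_product, mem_polys, mem_polys]
  exact ⟨fun h => h.2, fun h => ⟨⟨h.1, h.2⟩, h⟩⟩

lemma sum_copSet {β : Type*} [AddCommMonoid β] (k : ℕ) (φ : K[X] → β) :
    ∑ x ∈ copSet K k, φ x.1 =
      ∑ A ∈ (polys K k).erase 0, ((polys K (k + 1)).filter fun B => Cop k A B).card • φ A := by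
  rw [copSet, Finset.sum_filter, Finset.sum_product,
    ← Finset.sum_erase (polys K k) (a := 0)]
  · refine Finset.sum_congr rfl fun A _ => ?_
    rw [← Finset.sum_const, Finset.sum_filter]
  · refine Finset.sum_eq_zero fun B _ => if_neg fun h => h.ne_zero rfl

lemma exists_unique_bev {A : K[X]} (hA : A.natDegree ≤ 1) (h0 : A ≠ 0) :
    ∃ u, univ.filter (fun w => bev 1 A w = 0) = {u} := by
  obtain ⟨u, hu⟩ := exists_bev_eq_zero hA
  have h1 := card_bev_zeros_le hA h0
  refine ⟨u, eq_singleton_iff_unique_mem.2 ⟨by simp [hu], fun w hw => ?_⟩⟩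
  exact card_le_one.1 h1 w hw u (by simp [hu])

lemma card_cop_one {A : K[X]} (hA : A.natDegree ≤ 1) (h0 : A ≠ 0) :
    (((polys K 2).filter fun B => Cop 1 A B).card : ℤ) =
      (Fintype.card K : ℤ) ^ 3 - Fintype.card K ^ 2 := by
  obtain ⟨u, hu⟩ := exists_unique_bev hA h0
  have hu' : ∀ w, bev 1 A w = 0 ↔ w = u := fun w => by
    have := Finset.ext_iff.1 hu w
    simpa using this
  rw [← card_filter_bev_ne 1 u]
  congr 2
  ext B
  simp only [mem_filter, mem_polys, and_congr_right_iff]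
  intro hB
  constructor
  · exact fun h => h.bev_ne_zero ((hu' u).2 rfl)
  · intro h
    exact cop_of_root (by omega) h0 hA hB ((hu' u).2 rfl) fun w hw => by rwa [(hu' w).1 hw]

lemma card_erase_polys (k : ℕ) :
    (((polys K k).erase 0).card : ℤ) = (Fintype.card K : ℤ) ^ (k + 1) - 1 := by
  rw [card_erase_of_mem (mem_polys.2 (by simp)), card_polys, Nat.cast_sub]
  · push_cast; ring
  · exact Nat.one_le_pow _ _ Fintype.card_pos

lemma card_copSet_one :
    ((copSet K 1).card : ℤ) = ((Fintype.card K : ℤ) ^ 2 - 1) *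
      ((Fintype.card K : ℤ) ^ 3 - Fintype.card K ^ 2) := by
  have h := sum_copSet (K := K) 1 (fun _ => (1 : ℤ))
  rw [Finset.sum_const, nsmul_one] at h
  rw [h, ← card_erase_polys, Finset.sum_congr rfl (g := fun _ =>
    ((Fintype.card K : ℤ) ^ 3 - Fintype.card K ^ 2)), sum_const, nsmul_eq_mul]
  intro A hA
  rw [mem_erase, mem_polys] at hA
  rw [nsmul_one, card_cop_one hA.2 hA.1]

lemma card_cop_zero {A : K[X]} (hA : A.natDegree ≤ 0) (h0 : A ≠ 0) :
    (((polys K 1).filter fun B => Cop 0 A B).card : ℤ) = (Fintype.card K : ℤ) ^ 2 := by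
  rw [filter_true_of_mem, card_polys]
  · push_cast; rfl
  intro B hB
  have h1 := eq_C_of_natDegree_le_zero hA
  have h2 : A.coeff 0 ≠ 0 := by
    intro h; rw [h, C_0] at h1; exact h0 h1
  refine ⟨hA, mem_polys.1 hB, ?_, Or.inl h2⟩
  refine ⟨C (A.coeff 0)⁻¹, 0, ?_⟩
  conv_lhs => rw [h1]
  rw [zero_mul, add_zero, coeff_C_zero, ← C_mul, inv_mul_cancel₀ h2, C_1]

/-- The number of rational zeros of a binary form of degree `k`. -/
def rootCount (k : ℕ) (A : K[X]) : ℕ := (univ.filter fun u => bev k A u = 0).card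

/-- A quadratic form without rational zeros is irreducible, so a common factor with `B` must be all
of `A`. -/
lemma cop_two_iff_of_no_root {A B : K[X]} (hA : A.natDegree ≤ 2) (hB : B.natDegree ≤ 3)
    (h : ∀ u, bev 2 A u ≠ 0) : ¬ Cop 2 A B ↔ ∃ Q : K[X], Q.natDegree ≤ 1 ∧ B = A * Q := by
  have h0 : A ≠ 0 := by
    rintro rfl; exact h none (by simp [bev])
  constructor
  · intro hn
    obtain ⟨l, hl, g, A₁, B₁, hg0, hg, hcop, rfl, rfl⟩ := exists_cop h0 hA hB
    have hA₁ := hcop.natDegree_left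
    have hB₁ := hcop.natDegree_right
    interval_cases l
    · obtain ⟨c, rfl⟩ : ∃ c, A₁ = C c := ⟨_, eq_C_of_natDegree_le_zero hA₁⟩
      have h2 : c ≠ 0 := by
        rintro rfl; exact hcop.ne_zero C_0
      refine ⟨C c⁻¹ * B₁, (natDegree_C_mul_le _ _).trans hB₁, ?_⟩
      have : (C c * C c⁻¹ : K[X]) = 1 := by
        rw [← C_mul, mul_inv_cancel₀ h2, C_1]
      linear_combination (-g * B₁) * this
    · obtain ⟨u, hu⟩ := exists_bev_eq_zero (show g.natDegree ≤ 1 from hg)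
      refine absurd ?_ (h u)
      rw [show 2 = 1 + 1 from rfl, bev_mul hg hA₁, hu, zero_mul]
    · refine absurd ?_ hn
      have hg' : g.natDegree ≤ 0 := hg
      rw [eq_C_of_natDegree_le_zero hg'] at hg0 ⊢
      exact hcop.C_mul (by rintro h; simp [h] at hg0)
  · rintro ⟨Q, -, rfl⟩ hcop
    have h1 : IsUnit A := isCoprime_self.1 (hcop.coprime.of_isCoprime_of_dvd_right ⟨Q, rfl⟩)
    have h2 := natDegree_eq_zero_of_isUnit h1
    exact h none (coeff_eq_zero_of_natDegree_lt (by omega))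

/-- Without zeros, the bad `B` are the `q²` multiples of `A` by linear forms. With zeros,
coprimality means that `B` is nonzero at each of them. -/
lemma card_cop_two {A : K[X]} (hA : A.natDegree ≤ 2) (h0 : A ≠ 0) :
    (((polys K 3).filter fun B => Cop 2 A B).card : ℤ) =
      if rootCount 2 A = 0 then (Fintype.card K : ℤ) ^ 4 - Fintype.card K ^ 2
      else if rootCount 2 A = 1 then (Fintype.card K : ℤ) ^ 4 - Fintype.card K ^ 3
      else (Fintype.card K : ℤ) ^ 4 - 2 * Fintype.card K ^ 3 + Fintype.card K ^ 2 := by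
  have hle : rootCount 2 A ≤ 2 := card_bev_zeros_le hA h0
  have hroots : ∀ {u₀ : Option K} {B : K[X]}, B.natDegree ≤ 3 → bev 2 A u₀ = 0 →
      (Cop 2 A B ↔ ∀ u, bev 2 A u = 0 → bev 3 B u ≠ 0) := fun hB hu₀ =>
    ⟨fun h _ hu => h.bev_ne_zero hu, cop_of_root le_rfl h0 hA hB hu₀⟩
  interval_cases h : rootCount 2 A
  · have hno : ∀ u, bev 2 A u ≠ 0 := by
      intro u hu
      have := card_eq_zero.1 h
      exact notMem_empty u (this ▸ (by simp [hu] : u ∈ univ.filter fun u => bev 2 A u = 0))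
    have h1 := card_filter_add_card_filter_not (s := polys K 3) fun B => Cop 2 A B
    have h2 : ((polys K 3).filter fun B => ¬ Cop 2 A B).card = Fintype.card K ^ 2 := by
      rw [← card_polys, ← card_image_of_injective (polys K 1) (mul_right_injective₀ h0)]
      congr 1
      ext B
      simp only [mem_filter, mem_polys, mem_image]
      constructor
      · rintro ⟨hB, hn⟩
        obtain ⟨Q, hQ, rfl⟩ := (cop_two_iff_of_no_root hA hB hno).1 hn
        exact ⟨Q, hQ, rfl⟩
      · rintro ⟨Q, hQ, rfl⟩
        have hB : (A * Q).natDegree ≤ 3 := natDegree_mul_le.trans (by omega)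
        exact ⟨hB, (cop_two_iff_of_no_root hA hB hno).2 ⟨Q, hQ, rfl⟩⟩
    rw [h2, card_polys] at h1
    zify at h1
    simp only [if_true]
    linear_combination h1
  · obtain ⟨u, hu⟩ := card_eq_one.1 h
    have hu' : ∀ w, bev 2 A w = 0 ↔ w = u := fun w => by
      simpa using Finset.ext_iff.1 hu w
    simp only [if_true, one_ne_zero, if_false]
    rw [← card_filter_bev_ne 2 u]
    congr 2
    ext B
    simp only [mem_filter, mem_polys, and_congr_right_iff]
    intro hB
    rw [hroots hB ((hu' u).2 rfl)]
    simp [hu']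
  · obtain ⟨u, u', hne, hu⟩ := card_eq_two.1 h
    have hu' : ∀ w, bev 2 A w = 0 ↔ w = u ∨ w = u' := fun w => by
      simpa using Finset.ext_iff.1 hu w
    simp only [OfNat.ofNat_ne_zero, OfNat.ofNat_ne_one, if_false]
    rw [← card_filter_bev_ne_two 1 hne]
    congr 2
    ext B
    simp only [mem_filter, mem_polys, and_congr_right_iff]
    intro hB
    rw [hroots hB ((hu' u).2 (Or.inl rfl))]
    simp [hu']

lemma sum_rootCount :
    ∑ A ∈ (polys K 2).erase 0, (rootCount 2 A : ℤ) =
      ((Fintype.card K : ℤ) + 1) * ((Fintype.card K : ℤ) ^ 2 - 1) := by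
  have h0 : ∀ A : K[X], (rootCount 2 A : ℤ) = ∑ u : Option K, if bev 2 A u = 0 then 1 else 0 := by
    intro A; rw [rootCount, card_filter]; push_cast; rfl
  simp only [h0]
  rw [sum_comm, Finset.sum_congr rfl (g := fun _ => ((Fintype.card K : ℤ) ^ 2 - 1)), sum_const,
    card_univ, Fintype.card_option, nsmul_eq_mul]
  · push_cast; rfl
  intro u _
  rw [← Finset.sum_filter, sum_const, nsmul_one, filter_erase,
    card_erase_of_mem (by simp [mem_polys, bev_zero]), card_filter_bev, Nat.cast_sub]
  · push_cast; rfl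
  · exact Nat.one_le_pow _ _ Fintype.card_pos

lemma sum_rootCount_sq :
    ∑ A ∈ (polys K 2).erase 0, (rootCount 2 A : ℤ) ^ 2 =
      ((Fintype.card K : ℤ) + 1) * ((Fintype.card K : ℤ) ^ 2 - 1 +
        Fintype.card K * ((Fintype.card K : ℤ) - 1)) := by
  have h0 : ∀ A : K[X], (rootCount 2 A : ℤ) ^ 2 =
      ∑ u : Option K, ∑ u' : Option K, if bev 2 A u = 0 ∧ bev 2 A u' = 0 then 1 else 0 := by
    intro A
    have : (rootCount 2 A : ℤ) = ∑ u : Option K, if bev 2 A u = 0 then 1 else 0 := by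
      rw [rootCount, card_filter]; push_cast; rfl
    rw [sq, this, sum_mul_sum]
    refine Finset.sum_congr rfl fun u _ => Finset.sum_congr rfl fun u' _ => ?_
    split_ifs <;> simp_all
  simp only [h0]
  rw [sum_comm, Finset.sum_congr rfl (g := fun _ => ((Fintype.card K : ℤ) ^ 2 - 1 +
        Fintype.card K * ((Fintype.card K : ℤ) - 1))), sum_const,
    card_univ, Fintype.card_option, nsmul_eq_mul]
  · push_cast; rfl
  intro u _
  rw [sum_comm, ← add_sum_erase _ _ (mem_univ u)]
  congr 1
  · simp only [and_self]
    rw [← Finset.sum_filter, sum_const, nsmul_one, filter_erase,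
      card_erase_of_mem (by simp [mem_polys, bev_zero]), card_filter_bev, Nat.cast_sub]
    · push_cast; rfl
    · exact Nat.one_le_pow _ _ Fintype.card_pos
  · rw [Finset.sum_congr rfl (g := fun _ => ((Fintype.card K : ℤ) - 1)), sum_const,
      card_erase_of_mem (mem_univ u), card_univ, Fintype.card_option, nsmul_eq_mul]
    · simp
    intro u' hu'
    rw [← Finset.sum_filter, sum_const, nsmul_one, filter_erase,
      card_erase_of_mem (by simp [mem_polys, bev_zero]), card_filter_bev_two 0 (ne_of_mem_erase hu').symm,
      Nat.cast_sub]
    · push_cast; ring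
    · exact Nat.one_le_pow _ _ Fintype.card_pos

/-- A nonzero quadratic form has at most two zeros, so the three numbers are determined by the
moments of order 0, 1 and 2 of `rootCount`. -/
lemma card_rootCount_two :
    2 * (((polys K 2).erase 0).filter fun A => rootCount 2 A = 2).card =
      ((Fintype.card K : ℤ) + 1) * Fintype.card K * ((Fintype.card K : ℤ) - 1) ∧
    ((((polys K 2).erase 0).filter fun A => rootCount 2 A = 1).card : ℤ) =
      ((Fintype.card K : ℤ) + 1) * ((Fintype.card K : ℤ) - 1) ∧
    2 * (((polys K 2).erase 0).filter fun A => rootCount 2 A = 0).card =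
      (Fintype.card K : ℤ) * ((Fintype.card K : ℤ) - 1) ^ 2 := by
  have hr : ∀ A ∈ (polys K 2).erase 0, rootCount 2 A ≤ 2 := fun A hA => by
    rw [mem_erase, mem_polys] at hA
    exact card_bev_zeros_le hA.2 hA.1
  have key : ∀ F : ℕ → ℤ, ∑ A ∈ (polys K 2).erase 0, F (rootCount 2 A) =
      ∑ j ∈ range 3, (((polys K 2).erase 0).filter fun A => rootCount 2 A = j).card * F j := by
    intro F
    rw [← sum_fiberwise_of_maps_to (t := range 3) (g := fun A => rootCount 2 A)
      (fun A hA => by have := hr A hA; simp only [mem_range]; omega)]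
    refine Finset.sum_congr rfl fun j _ => ?_
    rw [Finset.sum_congr rfl (g := fun _ => F j), sum_const, nsmul_eq_mul]
    intro A hA
    rw [(mem_filter.1 hA).2]
  have h0 := key fun _ => 1
  have h1 := key fun j => j
  have h2 := key fun j => (j : ℤ) ^ 2
  rw [sum_const, nsmul_one, card_erase_polys] at h0
  rw [sum_rootCount] at h1
  rw [sum_rootCount_sq] at h2
  simp only [sum_range_succ, range_zero, sum_empty] at h0 h1 h2
  push_cast at h0 h1 h2
  refine ⟨by linear_combination h1 - h2, by linear_combination h2 - 2 * h1,
    by linear_combination -2 * h0 + 3 * h1 - h2⟩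

end PolynomialCounts

/-! ### Nonsingular conics and the sets of points on them -/

section Conics

variable {K ι : Type*} [Field K] [Fintype K] [Fintype ι] {v : ι → Fin 3 → K}

lemma exists_lin_of_isHomogeneous_one {f : MvPolynomial (Fin 3) K} (hf : f.IsHomogeneous 1) :
    ∃ a, f = lin a := by
  have h1 : f ∈ MvPolynomial.homogeneousSubmodule (Fin 3) K 1 := hf
  rw [MvPolynomial.homogeneousSubmodule_one_eq_span_X, Submodule.mem_span_range_iff_exists_fun] at h1
  obtain ⟨c, hc⟩ := h1
  exact ⟨c, by simp [← hc, lin, MvPolynomial.smul_eq_C_mul]⟩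

lemma exists_line_of_isHomogeneous_one (hv : PlaneReps v) {f : MvPolynomial (Fin 3) K}
    (hf : f.IsHomogeneous 1) (h0 : f ≠ 0) : ∃ j, zeros v f = line v j := by
  obtain ⟨a, rfl⟩ := exists_lin_of_isHomogeneous_one hf
  have ha : a ≠ 0 := by
    rintro rfl; simp [lin] at h0
  obtain ⟨j, c, hc, hj⟩ := hv.exists_smul ha
  refine ⟨j, ?_⟩
  ext i
  rw [mem_zeros, eval_lin, mem_line, hj, smul_dotProduct, smul_eq_mul, mul_eq_zero]
  simp [hc]

namespace Frame

variable {p : ι} (F : Frame v p)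

lemma exists_line_eq (hv : PlaneReps v) (j : ι) : ∃ A B : Polynomial K, A.natDegree ≤ 0 ∧ B.natDegree ≤ 1 ∧
    (A ≠ 0 ∨ B ≠ 0) ∧ (p ∈ line v j ↔ A = 0) ∧
    ∀ u z, F.e (u, z) ∈ line v j ↔ z * bev 0 A u + bev 1 B u = 0 := by
  obtain ⟨A, B, hA, hB, h⟩ := F.exists_cone_line (isHomogeneous_lin (v j))
  refine ⟨A, B, hA, hB, ?_, ?_, fun u z => ?_⟩
  · by_contra! hc
    rw [hc.1, hc.2, F.cone_zero] at h
    exact lin_ne_zero (hv.ne_zero j) h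
  · rw [← zeros_lin, h, mem_zeros, cone, F.eval_subst_point, stdCone, homog, homog]
    simp only [lastPt, sum_range_succ, map_add, map_mul, map_pow, MvPolynomial.eval_X,
      MvPolynomial.eval_C, range_zero, sum_empty]
    simp
    constructor
    · intro h0
      rw [Polynomial.eq_C_of_natDegree_le_zero hA, h0, Polynomial.C_0]
    · rintro rfl; simp
  · rw [← zeros_lin, h, F.mem_zeros_cone hA hB]

lemma exists_line_fibre (hv : PlaneReps v) (u : Option K) :
    ∃ j, p ∈ line v j ∧ ∀ u' z, F.e (u', z) ∈ line v j ↔ u' = u := by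
  obtain ⟨j, hp, hu⟩ := exists_line_through hv p (F.e (u, 0))
  obtain ⟨A, B, hA, hB, h0, hpA, h⟩ := F.exists_line_eq hv j
  have hA0 := hpA.1 hp
  subst hA0
  simp only [bev_zero, mul_zero, zero_add] at h
  refine ⟨j, hp, fun u' z => ?_⟩
  rw [h]
  rw [h] at hu
  obtain ⟨w, hw⟩ := exists_unique_bev hB (by simpa using h0)
  have hw' : ∀ u, bev 1 B u = 0 ↔ u = w := fun u => by
    simpa using Finset.ext_iff.1 hw u
  rw [hw', (hw' u).1 hu]

lemma cone_C_mul (k : ℕ) (c : K) (A B : Polynomial K) :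
    F.cone k (Polynomial.C c * A) (Polynomial.C c * B) = MvPolynomial.C c * F.cone k A B := by
  have h : ∀ m (P : Polynomial K), homog m (Polynomial.C c * P) = MvPolynomial.C c * homog m P := by
    intro m P
    simp [homog, Finset.mul_sum, mul_assoc]
  have hC : subst F.M' (MvPolynomial.C c) = MvPolynomial.C c := by
    simp [subst, MvPolynomial.algebraMap_eq]
  rw [cone, stdCone, h, h, cone, stdCone, ← hC, ← map_mul]
  congr 1
  rw [hC]
  ring

/-- Points other than `p` with at most one in each fibre are parametrised by their directions. -/
lemma card_le_of_fibre {T : Finset ι} (hp : p ∉ T)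
    (hT : ∀ u z z', F.e (u, z) ∈ T → F.e (u, z') ∈ T → z = z') :
    T.card = (univ.filter fun u => ∃ z, F.e (u, z) ∈ T).card := by
  have h1 : T = (univ.filter fun x => F.e x ∈ T).image F.e := by
    ext i
    simp only [mem_image, mem_filter, mem_univ, true_and]
    constructor
    · intro hi
      obtain ⟨x, rfl⟩ := F.surj i (fun h => hp (h ▸ hi))
      exact ⟨x, hi, rfl⟩
    · rintro ⟨x, hx, rfl⟩; exact hx
  conv_lhs => rw [h1]
  rw [card_image_of_injective _ F.inj, ← card_image_of_injOn (f := Prod.fst)]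
  · congr 1
    ext u
    simp
  · rintro ⟨u, z⟩ hx ⟨u', z'⟩ hx' (rfl : u = u')
    simp only [coe_filter, mem_univ, true_and, Set.mem_ofPred_eq] at hx hx'
    rw [hT _ _ _ hx hx']

end Frame

/-- A nonsingular conic: it has `q + 1` rational points, no three of them collinear. -/
def Smooth (v : ι → Fin 3 → K) (f : MvPolynomial (Fin 3) K) : Prop :=
  f.IsHomogeneous 2 ∧ f ≠ 0 ∧ (zeros v f).card = Fintype.card K + 1 ∧
    ∀ j, (zeros v f ∩ line v j).card ≤ 2

lemma card_univ_option : (univ : Finset (Option K)).card = Fintype.card K + 1 := by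
  rw [card_univ, Fintype.card_option]

namespace Cop

variable {p : ι} (F : Frame v p) {A B : Polynomial K}

lemma unique_fibre {k : ℕ} (h : Cop k A B) {u : Option K} {z z' : K}
    (hz : z * bev k A u + bev (k + 1) B u = 0) (hz' : z' * bev k A u + bev (k + 1) B u = 0) :
    z = z' := by
  have hA : bev k A u ≠ 0 := by
    intro hA
    apply h.bev_ne_zero hA
    simpa [hA] using hz
  apply mul_right_cancel₀ hA
  linear_combination hz - hz'

lemma exists_fibre {k : ℕ} {u : Option K} (h : bev k A u ≠ 0) :
    ∃ z, z * bev k A u + bev (k + 1) B u = 0 :=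
  ⟨-bev (k + 1) B u / bev k A u, by field_simp; ring⟩

/-- A line meets the curve of a coprime pair in few points outside the vertex. -/
lemma card_line_le (hv : PlaneReps v) {k : ℕ} (hk : k ≠ 0) (h : Cop k A B)
    {j : ι} {T : Finset ι}
    (hpT : p ∉ T) (hTj : T ⊆ line v j) (hT : T ⊆ zeros v (F.cone k A B)) :
    T.card ≤ if p ∈ line v j then 1 else k + 1 := by
  have hz : ∀ u z, F.e (u, z) ∈ T → z * bev k A u + bev (k + 1) B u = 0 := fun u z hu =>
    (F.mem_zeros_cone h.natDegree_left h.natDegree_right).1 (hT hu)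
  rw [F.card_le_of_fibre hpT fun u z z' hu hu' => h.unique_fibre (hz _ _ hu) (hz _ _ hu')]
  obtain ⟨a, b, ha, hb, h0, hp, hl⟩ := F.exists_line_eq hv j
  split_ifs with hpj
  · have ha0 := hp.1 hpj
    subst ha0
    obtain ⟨w, hw⟩ := exists_unique_bev hb (by simpa using h0)
    rw [← card_singleton w, ← hw]
    apply card_le_card
    intro u hu
    simp only [mem_filter, mem_univ, true_and] at hu ⊢
    obtain ⟨z, hu⟩ := hu
    simpa [bev_zero] using (hl u z).1 (hTj hu)
  · by_contra! hlt
    have h1 := h.eq_of_bev (l := 0) ha hb (D := univ.filter fun u => ∃ z, F.e (u, z) ∈ T)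
      (by omega) (by
        intro u hu
        simp only [mem_filter, mem_univ, true_and] at hu
        obtain ⟨z, hu⟩ := hu
        have e1 := (hl u z).1 (hTj hu)
        have e2 := hz u z hu
        linear_combination bev 0 a u * e2 - bev k A u * e1)
    obtain ⟨c, rfl, rfl, hc⟩ := h.exists_factor ha hb h1
    rcases hc with rfl | hc
    · simp at h0
    · omega

/-- The curve of a coprime pair consists of the vertex and one point in each direction that is
not a zero of the first form. -/
lemma card_zeros_erase {k : ℕ} (h : Cop k A B) :
    ((zeros v (F.cone k A B)).erase p).card = (univ.filter fun u => bev k A u ≠ 0).card := by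
  have hz : ∀ u z, F.e (u, z) ∈ (zeros v (F.cone k A B)).erase p ↔
      z * bev k A u + bev (k + 1) B u = 0 := fun u z => by
    rw [mem_erase, F.mem_zeros_cone h.natDegree_left h.natDegree_right]
    simp [F.ne]
  rw [F.card_le_of_fibre (notMem_erase _ _) fun u z z' hu hu' =>
    h.unique_fibre ((hz _ _).1 hu) ((hz _ _).1 hu')]
  congr 1
  ext u
  simp only [mem_filter, mem_univ, true_and, hz]
  constructor
  · rintro ⟨z, hz⟩ hA
    apply h.bev_ne_zero hA
    simpa [hA] using hz
  · exact exists_fibre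

lemma card_bev_ne_one (h : Cop 1 A B) :
    (univ.filter fun u => bev 1 A u ≠ 0).card = Fintype.card K := by
  obtain ⟨w, hw⟩ := exists_unique_bev h.natDegree_left h.ne_zero
  have := card_filter_add_card_filter_not (s := (univ : Finset (Option K))) fun u => bev 1 A u = 0
  rw [hw, card_univ_option, card_singleton] at this
  simp only [ne_eq]
  omega

lemma smooth (hv : PlaneReps v) (h : Cop 1 A B) : Smooth v (F.cone 1 A B) := by
  have h0 : F.cone 1 A B ≠ 0 := by
    refine F.cone_ne_zero ?_ h.natDegree_left h.natDegree_right (Or.inl h.ne_zero)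
    have := Fintype.one_lt_card (α := K)
    omega
  have hp : p ∈ zeros v (F.cone 1 A B) := F.point_mem_zeros_cone one_ne_zero A B
  refine ⟨F.cone_isHomogeneous 1 A B, h0, ?_, fun j => ?_⟩
  · rw [← card_erase_add_one hp, h.card_zeros_erase, h.card_bev_ne_one]
  · have h1 := h.card_line_le F hv one_ne_zero (j := j)
      (T := (zeros v (F.cone 1 A B) ∩ line v j).erase p) (notMem_erase _ _)
      ((erase_subset _ _).trans inter_subset_right) ((erase_subset _ _).trans inter_subset_left)
    split_ifs at h1 with hj
    · rw [card_erase_of_mem (mem_inter.2 ⟨hp, hj⟩)] at h1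
      omega
    · rwa [erase_eq_of_notMem (fun h => hj (mem_inter.1 h).2)] at h1

end Cop

namespace Frame

variable {p : ι} (F : Frame v p)

/-- A conic through `p` that does not come from a coprime pair consists of two lines. -/
lemma cop_or_subset_lines (hv : PlaneReps v) {A B : Polynomial K} (hA : A.natDegree ≤ 1)
    (hB : B.natDegree ≤ 2) (h0 : A ≠ 0 ∨ B ≠ 0) :
    Cop 1 A B ∨ (∃ j j', zeros v (F.cone 1 A B) ⊆ line v j ∪ line v j') ∧
      ((zeros v (F.cone 1 A B) = {p}) ∨ ∃ j, line v j ⊆ zeros v (F.cone 1 A B)) := by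
  have hp : p ∈ zeros v (F.cone 1 A B) := F.point_mem_zeros_cone one_ne_zero A B
  have hfib : ∀ u, bev 1 A u = 0 → bev 2 B u = 0 → ∃ j, line v j ⊆ zeros v (F.cone 1 A B) := by
    intro u hu hu'
    obtain ⟨j, hpj, hj⟩ := F.exists_line_fibre hv u
    refine ⟨j, fun i hi => ?_⟩
    by_cases hip : i = p
    · rwa [hip]
    · obtain ⟨⟨w, z⟩, rfl⟩ := F.surj i hip
      obtain rfl := (hj _ _).1 hi
      rw [F.mem_zeros_cone hA hB, hu, hu']
      ring
  by_cases hA0 : A = 0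
  · subst hA0
    right
    have hB0 : B ≠ 0 := by simpa using h0
    have hle := card_bev_zeros_le hB hB0
    obtain ⟨w, w', hww⟩ : ∃ w w', univ.filter (fun u => bev 2 B u = 0) ⊆ {w, w'} := by
      interval_cases hc : (univ.filter fun u => bev 2 B u = 0).card
      · rw [card_eq_zero.1 hc]; exact ⟨none, none, empty_subset _⟩
      · obtain ⟨w, hw⟩ := card_eq_one.1 hc
        exact ⟨w, w, by simp [hw]⟩
      · obtain ⟨w, w', -, hw⟩ := card_eq_two.1 hc
        exact ⟨w, w', by rw [hw]⟩
    obtain ⟨j, hpj, hj⟩ := F.exists_line_fibre hv w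
    obtain ⟨j', -, hj'⟩ := F.exists_line_fibre hv w'
    refine ⟨⟨j, j', fun i hi => ?_⟩, ?_⟩
    · by_cases hip : i = p
      · exact mem_union_left _ (by rwa [hip])
      · obtain ⟨⟨u, z⟩, rfl⟩ := F.surj i hip
        rw [F.mem_zeros_cone hA hB, bev_zero, mul_zero, zero_add] at hi
        have := hww (mem_filter.2 ⟨mem_univ u, hi⟩)
        rw [mem_union, hj, hj']
        simpa using this
    · by_cases hr : ∃ u, bev 2 B u = 0
      · obtain ⟨u, hu⟩ := hr
        exact Or.inr (hfib u (bev_zero _ _) hu)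
      · left
        push Not at hr
        refine eq_singleton_iff_unique_mem.2 ⟨hp, fun i hi => ?_⟩
        by_contra hip
        obtain ⟨⟨u, z⟩, rfl⟩ := F.surj i hip
        rw [F.mem_zeros_cone hA hB, bev_zero, mul_zero, zero_add] at hi
        exact hr u hi
  by_cases hc : Cop 1 A B
  · exact Or.inl hc
  right
  obtain ⟨u₀, hu₀⟩ := exists_bev_eq_zero hA
  obtain ⟨u, hu, hu'⟩ : ∃ u, bev 1 A u = 0 ∧ bev 2 B u = 0 := by
    by_contra! h
    exact hc (cop_of_root one_le_two hA0 hA hB hu₀ h)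
  refine ⟨?_, Or.inr (hfib u hu hu')⟩
  obtain ⟨a, ha, rfl⟩ := exists_eq_rootForm_mul (m := 0) hA hu
  obtain ⟨b, hb, rfl⟩ := exists_eq_rootForm_mul (m := 1) hB hu'
  have h1 := natDegree_rootForm u
  obtain ⟨j, hpj, hj⟩ := F.exists_line_fibre hv u
  have hq := Fintype.one_lt_card (α := K)
  obtain ⟨j', hj'⟩ := exists_line_of_isHomogeneous_one hv (F.cone_isHomogeneous 0 a b)
    (F.cone_ne_zero (by omega) ha hb (Or.inl (right_ne_zero_of_mul hA0)))
  refine ⟨j, j', fun i hi => ?_⟩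
  by_cases hip : i = p
  · exact mem_union_left _ (by rwa [hip])
  · obtain ⟨⟨w, z⟩, rfl⟩ := F.surj i hip
    rw [F.mem_zeros_cone hA hB, bev_mul h1 hb,
      show bev 1 (rootForm u * a) w = bev 1 (rootForm u) w * bev 0 a w from bev_mul h1 ha w] at hi
    have : bev 1 (rootForm u) w * (z * bev 0 a w + bev 1 b w) = 0 := by
      linear_combination hi
    rw [mem_union, hj, ← hj', F.mem_zeros_cone ha hb]
    exact (mul_eq_zero.1 this).imp bev_rootForm.1 id

/-- A pair with a common factor gives a single point or a conic containing a whole line; neither is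
possible for a nonsingular conic. -/
lemma smooth_cone_iff (hv : PlaneReps v) {A B : Polynomial K} (hA : A.natDegree ≤ 1)
    (hB : B.natDegree ≤ 2) : Smooth v (F.cone 1 A B) ↔ Cop 1 A B := by
  refine ⟨fun h => ?_, fun h => h.smooth F hv⟩
  have hq := Fintype.one_lt_card (α := K)
  refine (F.cop_or_subset_lines hv hA hB ?_).resolve_right fun hr => ?_
  · by_contra! hc
    rw [hc.1, hc.2, F.cone_zero] at h
    exact h.2.1 rfl
  · rcases hr.2 with hr | ⟨j, hj⟩
    · have := h.2.2.1
      rw [hr, card_singleton] at this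
      omega
    · have := h.2.2.2 j
      rw [inter_eq_right.2 hj, card_line hv] at this
      omega

end Frame

/-- A conic with at least two rational points is nonsingular or contained in two lines. -/
lemma smooth_or_subset_lines (hv : PlaneReps v) {f : MvPolynomial (Fin 3) K}
    (hf : f.IsHomogeneous 2) (h0 : f ≠ 0) {p : ι} (hp : p ∈ zeros v f) :
    Smooth v f ∨ ∃ j j', zeros v f ⊆ line v j ∪ line v j' := by
  obtain ⟨F⟩ := exists_frame hv p
  obtain ⟨A, B, hA, hB, rfl⟩ := F.exists_cone_conic hf (mem_zeros.1 hp)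
  refine (F.cop_or_subset_lines hv hA hB ?_).imp (fun h => h.smooth F hv) fun h => h.1
  by_contra! hc
  rw [hc.1, hc.2, F.cone_zero] at h0
  exact h0 rfl

/-- Two lines would hold at most six points of `T`. -/
lemma NoFour.smooth (hv : PlaneReps v) {T : Finset ι} (hT : NoFour v T)
    {f : MvPolynomial (Fin 3) K} (hf : f.IsHomogeneous 2) (h0 : f ≠ 0)
    (hc : 7 ≤ (T ∩ zeros v f).card) : Smooth v f := by
  obtain ⟨p, hp⟩ := card_pos.1 (show 0 < (T ∩ zeros v f).card by omega)
  refine (smooth_or_subset_lines hv hf h0 (mem_inter.1 hp).2).resolve_right ?_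
  rintro ⟨j, j', h⟩
  have h1 : T ∩ zeros v f ⊆ (T ∩ line v j) ∪ (T ∩ line v j') := by
    rw [← inter_union_distrib_left]
    exact inter_subset_inter_left h
  have h2 := (card_le_card h1).trans (card_union_le _ _)
  have := hT j
  have := hT j'
  omega

/-- Projecting from one common point, the other four lie in distinct directions, more than the
degree three of the cross product of the two pairs; the cross product is therefore zero. -/
lemma Smooth.eq_C_mul (hv : PlaneReps v) {f g : MvPolynomial (Fin 3) K} (hf : Smooth v f)
    (hg : g.IsHomogeneous 2) (hc : 5 ≤ (zeros v f ∩ zeros v g).card) :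
    ∃ c, g = MvPolynomial.C c * f := by
  obtain ⟨p, hp⟩ := card_pos.1 (show 0 < (zeros v f ∩ zeros v g).card by omega)
  rw [mem_inter, mem_zeros, mem_zeros] at hp
  obtain ⟨F⟩ := exists_frame hv p
  obtain ⟨A, B, hA, hB, rfl⟩ := F.exists_cone_conic hf.1 hp.1
  obtain ⟨a, b, ha, hb, rfl⟩ := F.exists_cone_conic hg hp.2
  have h := (F.smooth_cone_iff hv hA hB).1 hf
  obtain ⟨T, hT⟩ : ∃ T, T = (zeros v (F.cone 1 A B) ∩ zeros v (F.cone 1 a b)).erase p := ⟨_, rfl⟩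
  have hT4 : 4 ≤ T.card := by
    rw [hT, card_erase_of_mem (by simpa [mem_zeros] using hp)]
    omega
  have hz : ∀ u z, F.e (u, z) ∈ T → z * bev 1 A u + bev 2 B u = 0 ∧
      z * bev 1 a u + bev 2 b u = 0 := fun u z hu => by
    rw [hT, mem_erase, mem_inter, F.mem_zeros_cone hA hB, F.mem_zeros_cone ha hb] at hu
    exact hu.2
  rw [F.card_le_of_fibre (hT ▸ notMem_erase _ _) fun u z z' hu hu' =>
    h.unique_fibre (hz _ _ hu).1 (hz _ _ hu').1] at hT4
  have h1 := h.eq_of_bev ha hb (D := univ.filter fun u => ∃ z, F.e (u, z) ∈ T) (by omega) (by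
    intro u hu
    simp only [mem_filter, mem_univ, true_and] at hu
    obtain ⟨z, hu⟩ := hu
    obtain ⟨e1, e2⟩ := hz u z hu
    linear_combination bev 1 a u * e1 - bev 1 A u * e2)
  obtain ⟨c, rfl, rfl, hdeg⟩ := h.exists_factor ha hb h1
  refine ⟨c.coeff 0, ?_⟩
  have : c.natDegree ≤ 0 := by
    rcases hdeg with rfl | hdeg
    · simp
    · omega
  rw [← F.cone_C_mul, ← Polynomial.eq_C_of_natDegree_le_zero this]

lemma Smooth.C_mul {f : MvPolynomial (Fin 3) K} (hf : Smooth v f) {c : K} (hc : c ≠ 0) :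
    Smooth v (MvPolynomial.C c * f) := by
  have hz : zeros v (MvPolynomial.C c * f) = zeros v f := by
    ext i; simp [mem_zeros, hc]
  obtain ⟨h1, h2, h3⟩ := hf
  refine ⟨h1.C_mul c, mul_ne_zero (by simpa using hc) h2, ?_⟩
  rwa [hz]

/-- The forms of degree `d`. -/
def forms (K : Type*) [Field K] [Fintype K] (d : ℕ) : Finset (MvPolynomial (Fin 3) K) :=
  Set.Finite.toFinset (s := (Form K d : Set (MvPolynomial (Fin 3) K)))
    (@Set.toFinite _ _ (Module.finite_of_finite K (M := Form K d)))

lemma mem_forms {d : ℕ} {f : MvPolynomial (Fin 3) K} : f ∈ forms K d ↔ f.IsHomogeneous d := by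
  rw [forms, Set.Finite.mem_toFinset]; rfl

/-- The equations of nonsingular conics. -/
def smoothForms (v : ι → Fin 3 → K) : Finset (MvPolynomial (Fin 3) K) :=
  (forms K 2).filter fun f => Smooth v f

lemma mem_smoothForms {f : MvPolynomial (Fin 3) K} : f ∈ smoothForms v ↔ Smooth v f := by
  rw [smoothForms, mem_filter, mem_forms]
  exact ⟨fun h => h.2, fun h => ⟨h.1, h⟩⟩

/-- Projection from `p` identifies these equations with coprime pairs of degrees one and two. -/
lemma card_smoothForms_through (hv : PlaneReps v) (p : ι) :
    ((smoothForms v).filter fun f => p ∈ zeros v f).card = (copSet K 1).card := by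
  obtain ⟨F⟩ := exists_frame hv p
  have hq := Fintype.one_lt_card (α := K)
  symm
  refine card_bij (fun x _ => F.cone 1 x.1 x.2) ?_ ?_ ?_
  · rintro ⟨A, B⟩ h
    rw [mem_copSet] at h
    rw [mem_filter, mem_smoothForms]
    exact ⟨h.smooth F hv, F.point_mem_zeros_cone one_ne_zero A B⟩
  · rintro ⟨A, B⟩ h ⟨A', B'⟩ h' heq
    rw [mem_copSet] at h h'
    obtain ⟨rfl, rfl⟩ := F.cone_injective (by omega) h.natDegree_left h.natDegree_right
      h'.natDegree_left h'.natDegree_right heq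
    rfl
  · intro f hf
    rw [mem_filter, mem_smoothForms, mem_zeros] at hf
    obtain ⟨A, B, hA, hB, rfl⟩ := F.exists_cone_conic hf.1.1 hf.2
    exact ⟨(A, B), mem_copSet.2 ((F.smooth_cone_iff hv hA hB).1 hf.1), rfl⟩

/-- Double count of incidences between points and equations, each of which vanishes at `q + 1`
points. -/
lemma card_smoothForms (hv : PlaneReps v) :
    ((smoothForms v).card : ℤ) = ((Fintype.card K : ℤ) - 1) *
      ((Fintype.card K : ℤ) ^ 5 - Fintype.card K ^ 2) := by
  have h := card_mul_eq_card_mul (s := (univ : Finset ι)) (t := smoothForms v)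
    (fun p f => p ∈ zeros v f) (m := (copSet K 1).card) (n := Fintype.card K + 1)
    (fun p _ => card_smoothForms_through hv p) (fun f hf => by
      rw [bipartiteBelow, filter_univ_mem]
      exact (mem_smoothForms.1 hf).2.2.1)
  rw [card_univ, card_points hv] at h
  zify at h
  rw [card_copSet_one] at h
  have : (Fintype.card K : ℤ) + 1 ≠ 0 := by positivity
  apply mul_right_cancel₀ this
  rw [← h]
  ring

/-- Counting sets that determine a nonsingular conic. -/
lemma card_mul_of_smooth (hv : PlaneReps v) (𝒯 : Finset (Finset ι))
    (r : MvPolynomial (Fin 3) K → Finset ι → Prop)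
    (hC : ∀ f T (c : K), c ≠ 0 → r f T → r (MvPolynomial.C c * f) T)
    (h1 : ∀ T ∈ 𝒯, ∃ f, Smooth v f ∧ r f T)
    (h2 : ∀ f g T, Smooth v f → Smooth v g → r f T → r g T →
      5 ≤ (zeros v f ∩ zeros v g).card) {n : ℕ}
    (hn : ∀ f, Smooth v f → ∃ 𝒮 : Finset (Finset ι), 𝒮.card = n ∧
      ∀ T, T ∈ 𝒮 ↔ T ∈ 𝒯 ∧ r f T) :
    (𝒯.card : ℤ) = ((Fintype.card K : ℤ) ^ 5 - Fintype.card K ^ 2) * n := by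
  have hq := Fintype.one_lt_card (α := K)
  have h := card_mul_eq_card_mul (s := 𝒯) (t := smoothForms v)
    (fun T f => r f T) (m := Fintype.card K - 1) (n := n) (fun T hT => ?_) (fun f hf => ?_)
  · zify at h
    rw [card_smoothForms hv, Nat.cast_sub hq.le] at h
    have : (Fintype.card K : ℤ) - 1 ≠ 0 := by
      have : (1 : ℤ) < Fintype.card K := by exact_mod_cast hq
      omega
    apply mul_right_cancel₀ this
    push_cast at h
    rw [h]; ring
  · obtain ⟨f, hf, hrf⟩ := h1 T hT
    have : (smoothForms v).bipartiteAbove (fun T f => r f T) T =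
        (univ.erase (0 : K)).image fun c => MvPolynomial.C c * f := by
      ext g
      rw [mem_bipartiteAbove, mem_smoothForms, mem_image]
      constructor
      · rintro ⟨hg, hrg⟩
        obtain ⟨c, rfl⟩ := hf.eq_C_mul hv hg.1 (h2 f g T hf hg hrf hrg)
        refine ⟨c, mem_erase.2 ⟨?_, mem_univ _⟩, rfl⟩
        rintro rfl
        exact hg.2.1 (by simp)
      · rintro ⟨c, hc, rfl⟩
        rw [mem_erase] at hc
        exact ⟨hf.C_mul hc.1, hC f T c hc.1 hrf⟩
    rw [this, card_image_of_injective, card_erase_of_mem (mem_univ _), card_univ]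
    intro c c' hcc
    exact MvPolynomial.C_injective _ _ (mul_right_cancel₀ hf.2.1 hcc)
  · obtain ⟨𝒮, rfl, h𝒮⟩ := hn f (mem_smoothForms.1 hf)
    congr 1
    ext T
    rw [mem_bipartiteBelow, h𝒮]

lemma Smooth.noFour {f : MvPolynomial (Fin 3) K} (hf : Smooth v f) {T : Finset ι}
    (hT : T.card ≤ (T ∩ zeros v f).card + 1) : NoFour v T := by
  intro j
  have h1 := hf.2.2.2 j
  have h2 := card_inter_add_card_sdiff T (zeros v f)
  have h3 : T ∩ line v j ⊆ (zeros v f ∩ line v j) ∪ (T \ zeros v f) := by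
    intro i; simp only [mem_inter, mem_union, mem_sdiff]; tauto
  have := (card_le_card h3).trans (card_union_le _ _)
  omega

lemma zeros_C_mul {c : K} (hc : c ≠ 0) (f : MvPolynomial (Fin 3) K) :
    zeros v (MvPolynomial.C c * f) = zeros v f := by
  ext i; simp [mem_zeros, hc]

/-- Seven points with no four collinear force the conic to be nonsingular and unique; conversely,
any `m` of its `q + 1` points qualify. -/
lemma card_conicFam (hv : PlaneReps v) {m : ℕ} (hm : 7 ≤ m) :
    ((conicFam v m).card : ℤ) =
      ((Fintype.card K : ℤ) ^ 5 - Fintype.card K ^ 2) * (Fintype.card K + 1).choose m := by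
  refine card_mul_of_smooth hv _ (fun f T => T ⊆ zeros v f ∧ 7 ≤ T.card) ?_ ?_ ?_ ?_
  · rintro f T c hc ⟨h1, h2⟩
    exact ⟨by rwa [zeros_C_mul hc], h2⟩
  · intro T hT
    obtain ⟨h1, h2, f, h0, hf, hT⟩ := mem_conicFam.1 hT
    refine ⟨f, h2.smooth hv hf h0 ?_, hT, by omega⟩
    rw [inter_eq_left.2 hT]; omega
  · rintro f g T hf hg ⟨h1, h2⟩ ⟨h3, -⟩
    have := card_le_card (subset_inter h1 h3)
    omega
  · intro f hf
    refine ⟨powersetCard m (zeros v f), by rw [card_powersetCard, hf.2.2.1], fun T => ?_⟩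
    rw [mem_conicFam, mem_powersetCard]
    constructor
    · rintro ⟨h1, h2⟩
      refine ⟨⟨h2, hf.noFour ?_, f, hf.2.1, hf.1, h1⟩, h1, by omega⟩
      rw [inter_eq_left.2 h1]; omega
    · rintro ⟨⟨h1, -⟩, h2, -⟩; exact ⟨h2, h1⟩

lemma card_inter_eq (X : Finset ι) (n a b : ℕ) (h : n = a + b) :
    (univ.filter fun T : Finset ι => T.card = n ∧ (T ∩ X).card = a).card =
      X.card.choose a * (Fintype.card ι - X.card).choose b := by
  rw [← card_compl, ← card_subsets_two X Xᶜ disjoint_compl_right]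
  congr 1
  ext T
  have h1 := card_inter_add_card_sdiff T X
  rw [sdiff_eq_inter_compl] at h1
  simp only [mem_filter, mem_univ, true_and, union_compl, subset_univ]
  omega

/-- The sets of eight points, no four collinear, that have seven points on a conic. -/
lemma card_eight_on_conic (hv : PlaneReps v) :
    ((univ.filter fun T : Finset ι => T.card = 8 ∧ NoFour v T ∧ ¬ NoSeven v T).card : ℤ) =
      ((Fintype.card K : ℤ) ^ 5 - Fintype.card K ^ 2) *
        ((Fintype.card K + 1).choose 8 + (Fintype.card K + 1).choose 7 * Fintype.card K ^ 2) := by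
  have := card_mul_of_smooth hv
    (univ.filter fun T : Finset ι => T.card = 8 ∧ NoFour v T ∧ ¬ NoSeven v T)
    (fun f T => T.card = 8 ∧ 7 ≤ (T ∩ zeros v f).card)
    (n := (Fintype.card K + 1).choose 8 + (Fintype.card K + 1).choose 7 * Fintype.card K ^ 2)
    ?_ ?_ ?_ ?_
  · exact_mod_cast this
  · rintro f T c hc ⟨h1, h2⟩
    exact ⟨h1, by rwa [zeros_C_mul hc]⟩
  · intro T hT
    simp only [mem_filter, mem_univ, true_and] at hT
    obtain ⟨h1, h2, h3⟩ := hT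
    unfold NoSeven at h3
    push Not at h3
    obtain ⟨f, h0, hf, h3⟩ := h3
    exact ⟨f, h2.smooth hv hf h0 h3, h1, h3⟩
  -- Two subsets of seven points in a set of eight share at least six, so the conic is unique.
  · rintro f g T hf hg ⟨h1, h2⟩ ⟨-, h3⟩
    have h5 := card_inter_add_card_union (T ∩ zeros v f) (T ∩ zeros v g)
    have h6 : (T ∩ zeros v f ∪ T ∩ zeros v g).card ≤ T.card :=
      card_le_card (union_subset inter_subset_left inter_subset_left)
    have h7 : T ∩ zeros v f ∩ (T ∩ zeros v g) ⊆ zeros v f ∩ zeros v g := by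
      intro i; simp only [mem_inter]; tauto
    have := card_le_card h7
    omega
  · intro f hf
    have e1 := card_inter_eq (zeros v f) 8 8 0 rfl
    have e2 := card_inter_eq (zeros v f) 8 7 1 rfl
    have e3 : Fintype.card ι - (zeros v f).card = Fintype.card K ^ 2 := by
      rw [card_points hv, hf.2.2.1]; omega
    rw [hf.2.2.1, Nat.choose_zero_right, mul_one] at e1
    rw [e3, hf.2.2.1, Nat.choose_one_right] at e2
    rw [← e1, ← e2]
    refine ⟨_, card_union_of_disjoint ?_, fun T => ?_⟩
    · rw [disjoint_left]
      intro T hT hT'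
      simp only [mem_filter, mem_univ, true_and] at hT hT'
      omega
    · simp only [mem_union, mem_filter, mem_univ, true_and]
      constructor
      · intro h
        have h7 : T.card = 8 ∧ 7 ≤ (T ∩ zeros v f).card := by omega
        refine ⟨⟨h7.1, hf.noFour (by omega), fun h8 => ?_⟩, h7⟩
        have := h8 f hf.2.1 hf.1
        omega
      · rintro ⟨-, h1, h2⟩
        have := card_le_card (inter_subset_left : T ∩ zeros v f ⊆ T)
        omega

end Conics

/-! ### Counting sets of eight points with no four collinear and no seven on a conic -/

section EightSets

variable {K ι : Type*} [Field K] [Fintype K] [Fintype ι] {v : ι → Fin 3 → K}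

/-- The sets of eight points, no four collinear and no seven on a conic. -/
def goodEight (v : ι → Fin 3 → K) : Finset (Finset ι) :=
  univ.filter fun T => T.card = 8 ∧ NoFour v T ∧ NoSeven v T

lemma mem_goodEight {T : Finset ι} : T ∈ goodEight v ↔ T.card = 8 ∧ NoFour v T ∧ NoSeven v T := by
  simp [goodEight]

lemma card_subsets_two_lines (hv : PlaneReps v) {j j' : ι} (h : j ≠ j') (a b c d : ℕ) :
    (univ.filter fun T : Finset ι => (T ∩ (line v j \ line v j')).card = a ∧
      (T ∩ (line v j' \ line v j)).card = b ∧ (T ∩ (line v j ∩ line v j')).card = c ∧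
      (T ∩ (line v j ∪ line v j')ᶜ).card = d).card =
      (Fintype.card K).choose a * ((Fintype.card K).choose b * (Nat.choose 1 c *
        (Fintype.card K ^ 2 - Fintype.card K).choose d)) := by
  have h1 := card_line_sdiff hv h
  have h2 := card_line_sdiff hv h.symm
  have h3 := card_line_inter hv h
  have h4 : (line v j ∪ line v j')ᶜ.card = Fintype.card K ^ 2 - Fintype.card K := by
    have := card_union_add_card_inter (line v j) (line v j')
    rw [h3, card_line hv, card_line hv] at this
    rw [card_compl, card_points hv]
    omega
  have key := card_subsets_parts
    ![line v j \ line v j', line v j' \ line v j, line v j ∩ line v j', (line v j ∪ line v j')ᶜ] (by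
      have hd : ∀ i, i ∈ line v j ∨ i ∉ line v j := fun i => em _
      intro i i'; fin_cases i <;> fin_cases i' <;>
        simp [disjoint_left] <;> tauto) ![a, b, c, d]
  simp only [Fin.prod_univ_four, Matrix.cons_val_zero, Matrix.cons_val_one, Matrix.cons_val] at key
  rw [h1, h2, h3, h4] at key
  rw [← mul_assoc, ← mul_assoc, ← key]
  congr 1
  ext T
  simp only [mem_filter, mem_univ, true_and, Fin.forall_fin_succ]
  simp
  intro _ _ _ _ i hi
  simp [Fin.exists_fin_succ]
  tauto

/-- Without the node the split is 4 + 4. With it, both lines have at least three private points, and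
the eighth point is off both lines or a fourth private point of one of them. -/
lemma card_two_lines (hv : PlaneReps v) {j j' : ι} (h : j ≠ j') :
    (univ.filter fun T : Finset ι => T.card = 8 ∧ 4 ≤ (T ∩ line v j).card ∧
      4 ≤ (T ∩ line v j').card).card =
      (Fintype.card K).choose 4 ^ 2 +
        (Fintype.card K).choose 3 ^ 2 * (Fintype.card K ^ 2 - Fintype.card K) +
        2 * ((Fintype.card K).choose 4 * (Fintype.card K).choose 3) := by
  have hT : ∀ T : Finset ι,
      (T ∩ line v j).card = (T ∩ (line v j \ line v j')).card + (T ∩ (line v j ∩ line v j')).card ∧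
      (T ∩ line v j').card = (T ∩ (line v j' \ line v j)).card + (T ∩ (line v j ∩ line v j')).card ∧
      T.card = (T ∩ (line v j \ line v j')).card + (T ∩ (line v j' \ line v j)).card +
        (T ∩ (line v j ∩ line v j')).card + (T ∩ (line v j ∪ line v j')ᶜ).card ∧
      (T ∩ (line v j ∩ line v j')).card ≤ 1 := by
    intro T
    have e1 := card_inter_add_card_sdiff (T ∩ line v j) (line v j')
    have e2 := card_inter_add_card_sdiff (T ∩ line v j') (line v j)
    have e3 := card_inter_add_card_sdiff T (line v j ∪ line v j')
    have e4 := card_union_add_card_inter (T ∩ line v j) (T ∩ line v j')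
    have e5 := card_le_card (inter_subset_right : T ∩ (line v j ∩ line v j') ⊆ _)
    rw [card_line_inter hv h] at e5
    rw [← inter_union_distrib_left, ← inter_inter_distrib_left] at e4
    rw [inter_assoc, inter_sdiff_assoc] at e1 e2
    rw [inter_comm (line v j') (line v j)] at e2
    rw [sdiff_eq_inter_compl T] at e3
    omega
  rw [card_eq_sum_card_fiberwise (t := {(4, 4, 0, 0), (3, 3, 1, 1), (4, 3, 1, 0), (3, 4, 1, 0)})
    (f := fun T => ((T ∩ (line v j \ line v j')).card, (T ∩ (line v j' \ line v j)).card,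
      (T ∩ (line v j ∩ line v j')).card, (T ∩ (line v j ∪ line v j')ᶜ).card))]
  · have key : ∀ a b c d : ℕ, a + b + c + d = 8 → 4 ≤ a + c → 4 ≤ b + c →
        ((univ.filter fun T : Finset ι => T.card = 8 ∧ 4 ≤ (T ∩ line v j).card ∧
          4 ≤ (T ∩ line v j').card).filter fun T => ((T ∩ (line v j \ line v j')).card,
            (T ∩ (line v j' \ line v j)).card, (T ∩ (line v j ∩ line v j')).card,
            (T ∩ (line v j ∪ line v j')ᶜ).card) = (a, b, c, d)).card =
        (Fintype.card K).choose a * ((Fintype.card K).choose b * (Nat.choose 1 c *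
          (Fintype.card K ^ 2 - Fintype.card K).choose d)) := by
      intro a b c d h8 h4 h4'
      rw [← card_subsets_two_lines hv h]
      congr 1
      ext T
      have := hT T
      simp only [mem_filter, mem_univ, true_and, Prod.mk.injEq]
      omega
    rw [sum_insert (by simp), sum_insert (by simp), sum_insert (by simp), sum_singleton,
      key 4 4 0 0 rfl le_rfl le_rfl, key 3 3 1 1 rfl le_rfl le_rfl,
      key 4 3 1 0 rfl (by norm_num) (by norm_num), key 3 4 1 0 rfl (by norm_num) (by norm_num)]
    simp
    ring
  · intro T hT8
    have := hT T
    simp only [coe_filter, mem_univ, true_and, Set.mem_ofPred_eq] at hT8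
    simp only [coe_insert, coe_singleton, Set.mem_insert_iff, Set.mem_singleton_iff, Prod.mk.injEq]
    omega

lemma card_one_line (hv : PlaneReps v) (j : ι) :
    (univ.filter fun T : Finset ι => T.card = 8 ∧ 4 ≤ (T ∩ line v j).card).card =
      ∑ k ∈ Icc 4 8, (Fintype.card K + 1).choose k * (Fintype.card K ^ 2).choose (8 - k) := by
  rw [card_eq_sum_card_fiberwise (t := Icc 4 8) (f := fun T => (T ∩ line v j).card)]
  · refine Finset.sum_congr rfl fun k hk => ?_
    rw [mem_Icc] at hk
    have := card_inter_eq (line v j) 8 k (8 - k) (by omega)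
    rw [card_line hv, card_points hv, show Fintype.card K ^ 2 + Fintype.card K + 1 -
      (Fintype.card K + 1) = Fintype.card K ^ 2 by omega] at this
    rw [← this, filter_filter]
    congr 1
    ext T
    simp only [mem_filter, mem_univ, true_and]
    omega
  · intro T hT
    have := card_le_card (inter_subset_left : T ∩ line v j ⊆ T)
    simp only [coe_filter, mem_univ, true_and, Set.mem_ofPred_eq] at hT
    simp only [coe_Icc, Set.mem_Icc]
    omega

/-- At most two lines contain four of eight given points. -/
lemma card_rich_lines_le (hv : PlaneReps v) {T : Finset ι} (hT : T.card = 8) :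
    (univ.filter fun j => 4 ≤ (T ∩ line v j).card).card ≤ 2 := by
  by_contra! hc
  obtain ⟨j, j', j'', hj, hj', hj'', h1, h2, h3⟩ := two_lt_card_iff.1 hc
  simp only [mem_filter, mem_univ, true_and] at hj hj' hj''
  have e1 := card_union_add_card_inter (T ∩ line v j) (T ∩ line v j')
  have e2 : (T ∩ line v j ∩ (T ∩ line v j')).card ≤ 1 := by
    rw [← card_line_inter hv h1]
    exact card_le_card fun i => by simp only [mem_inter]; tauto
  have e3 := card_inter_line_le_two hv (T := T ∩ line v j ∪ T ∩ line v j') (j := j) (j' := j')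
    (k := j'') (union_subset_union inter_subset_right inter_subset_right) h2.symm h3.symm
  have e4 := card_inter_add_card_sdiff (T ∩ line v j'') (T ∩ line v j ∪ T ∩ line v j')
  have e5 := card_inter_add_card_sdiff T (T ∩ line v j ∪ T ∩ line v j')
  have e6 : (T ∩ (T ∩ line v j ∪ T ∩ line v j')).card = (T ∩ line v j ∪ T ∩ line v j').card := by
    rw [inter_eq_right.2 (union_subset inter_subset_left inter_subset_left)]
  have e7 := card_le_card (sdiff_subset_sdiff (inter_subset_left : T ∩ line v j'' ⊆ T)
    (le_refl (T ∩ line v j ∪ T ∩ line v j')))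
  have e8 : (T ∩ line v j'' ∩ (T ∩ line v j ∪ T ∩ line v j')).card ≤
      ((T ∩ line v j ∪ T ∩ line v j') ∩ line v j'').card :=
    card_le_card fun i => by simp only [mem_inter, mem_union]; tauto
  omega

/-- Inclusion-exclusion over the lines with four points of `T`, which stops at pairs since there are
at most two such lines. -/
lemma card_not_noFour (hv : PlaneReps v) :
    ((univ.filter fun T : Finset ι => T.card = 8 ∧ ¬ NoFour v T).card : ℤ) =
      (Fintype.card ι : ℤ) * ∑ k ∈ Icc 4 8,
        (Fintype.card K + 1).choose k * (Fintype.card K ^ 2).choose (8 - k) -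
      (Fintype.card ι).choose 2 * ((Fintype.card K).choose 4 ^ 2 +
        (Fintype.card K).choose 3 ^ 2 * ((Fintype.card K : ℤ) ^ 2 - Fintype.card K) +
        2 * ((Fintype.card K).choose 4 * (Fintype.card K).choose 3)) := by
  set n : Finset ι → ℕ := fun T => (univ.filter fun j => 4 ≤ (T ∩ line v j).card).card with hn
  set 𝒯 := univ.filter fun T : Finset ι => T.card = 8 with h𝒯
  have h1 : ∑ T ∈ 𝒯, (n T : ℤ) = (Fintype.card ι : ℤ) * ∑ k ∈ Icc 4 8,
      (Fintype.card K + 1).choose k * (Fintype.card K ^ 2).choose (8 - k) := by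
    have : ∀ T, (n T : ℤ) = ∑ j, if 4 ≤ (T ∩ line v j).card then 1 else 0 := fun T => by
      rw [hn]; simp only [card_filter]; push_cast; rfl
    simp only [this]
    rw [sum_comm]
    rw [Finset.sum_congr rfl (g := fun _ => (∑ k ∈ Icc 4 8, ((Fintype.card K + 1).choose k : ℤ) *
      (Fintype.card K ^ 2).choose (8 - k))), sum_const, card_univ, nsmul_eq_mul]
    · push_cast; rfl
    intro j _
    rw [← Finset.sum_filter, h𝒯, filter_filter, sum_const, nsmul_one]
    have := card_one_line hv j
    exact_mod_cast this
  have h2 : ∑ T ∈ 𝒯, (n T : ℤ) * (n T - 1) = (Fintype.card ι : ℤ) * ((Fintype.card ι : ℤ) - 1) *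
      ((Fintype.card K).choose 4 ^ 2 +
        (Fintype.card K).choose 3 ^ 2 * ((Fintype.card K : ℤ) ^ 2 - Fintype.card K) +
        2 * ((Fintype.card K).choose 4 * (Fintype.card K).choose 3)) := by
    have : ∀ T, (n T : ℤ) * (n T - 1) = ∑ x ∈ (univ : Finset ι).offDiag,
        if 4 ≤ (T ∩ line v x.1).card ∧ 4 ≤ (T ∩ line v x.2).card then 1 else 0 := fun T => by
      rw [← Finset.sum_filter, sum_const, nsmul_one]
      have e : (univ : Finset ι).offDiag.filter (fun x => 4 ≤ (T ∩ line v x.1).card ∧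
          4 ≤ (T ∩ line v x.2).card) =
          (univ.filter fun j => 4 ≤ (T ∩ line v j).card).offDiag := by
        ext x; simp only [mem_filter, mem_offDiag, mem_univ, true_and]; tauto
      rw [e, offDiag_card, Nat.cast_sub (Nat.le_mul_self _), hn]
      push_cast; ring
    simp only [this]
    rw [sum_comm]
    rw [Finset.sum_congr rfl (g := fun _ => (((Fintype.card K).choose 4 : ℤ) ^ 2 +
        (Fintype.card K).choose 3 ^ 2 * ((Fintype.card K : ℤ) ^ 2 - Fintype.card K) +
        2 * ((Fintype.card K).choose 4 * (Fintype.card K).choose 3))), sum_const, nsmul_eq_mul,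
        offDiag_card, card_univ, Nat.cast_sub (Nat.le_mul_self _)]
    · push_cast; ring
    intro x hx
    rw [← Finset.sum_filter, h𝒯, filter_filter, sum_const, nsmul_one,
      card_two_lines hv (mem_offDiag.1 hx).2.2]
    push_cast
    rw [Nat.cast_sub (Nat.le_self_pow two_ne_zero _)]
    push_cast
    ring
  have h3 : ((univ.filter fun T : Finset ι => T.card = 8 ∧ ¬ NoFour v T).card : ℤ) =
      ∑ T ∈ 𝒯, if 1 ≤ n T then 1 else 0 := by
    rw [← Finset.sum_filter, h𝒯, filter_filter, sum_const, nsmul_one]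
    congr 2
    ext T
    simp only [mem_filter, mem_univ, true_and, hn, Nat.one_le_iff_ne_zero,
      ← Nat.pos_iff_ne_zero, card_pos]
    refine and_congr_right fun _ => ?_
    unfold NoFour
    push Not
    exact ⟨fun ⟨j, hj⟩ => ⟨j, mem_filter.2 ⟨mem_univ j, hj⟩⟩, fun ⟨j, hj⟩ => ⟨j, (mem_filter.1 hj).2⟩⟩
  have h4 := two_mul_choose_two (Fintype.card ι)
  zify at h4
  rw [Nat.cast_sub (by rw [card_points hv]; omega)] at h4
  -- For `n ≤ 2` the indicator of `n ≥ 1` is `n - n (n - 1) / 2`.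
  have h5 : 2 * ∑ T ∈ 𝒯, (if 1 ≤ n T then 1 else 0 : ℤ) =
      2 * ∑ T ∈ 𝒯, (n T : ℤ) - ∑ T ∈ 𝒯, (n T : ℤ) * (n T - 1) := by
    rw [mul_sum, mul_sum, ← sum_sub_distrib]
    refine Finset.sum_congr rfl fun T hT => ?_
    have : n T ≤ 2 := card_rich_lines_le hv (mem_filter.1 hT).2
    interval_cases n T <;> simp
  rw [h1, h2, ← h3] at h5
  push_cast at h4
  rw [← h4] at h5
  refine mul_left_cancel₀ (two_ne_zero (α := ℤ)) ?_
  linear_combination h5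

lemma card_goodEight (hv : PlaneReps v) :
    ((goodEight v).card : ℤ) = (Fintype.card ι).choose 8 -
      ((Fintype.card ι : ℤ) * ∑ k ∈ Icc 4 8,
        (Fintype.card K + 1).choose k * (Fintype.card K ^ 2).choose (8 - k) -
      (Fintype.card ι).choose 2 * ((Fintype.card K).choose 4 ^ 2 +
        (Fintype.card K).choose 3 ^ 2 * ((Fintype.card K : ℤ) ^ 2 - Fintype.card K) +
        2 * ((Fintype.card K).choose 4 * (Fintype.card K).choose 3))) -
      ((Fintype.card K : ℤ) ^ 5 - Fintype.card K ^ 2) *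
        ((Fintype.card K + 1).choose 8 + (Fintype.card K + 1).choose 7 * Fintype.card K ^ 2) := by
  rw [← card_not_noFour hv, ← card_eight_on_conic hv]
  have h0 : (univ.filter fun T : Finset ι => T.card = 8).card = (Fintype.card ι).choose 8 := by
    rw [← card_univ, ← card_powersetCard]; congr 1; ext T; simp
  have h1 := card_filter_add_card_filter_not (s := univ.filter fun T : Finset ι => T.card = 8)
    fun T => NoFour v T
  have h2 := card_filter_add_card_filter_not
    (s := univ.filter fun T : Finset ι => T.card = 8 ∧ NoFour v T) fun T => NoSeven v T
  simp only [filter_filter, and_assoc] at h1 h2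
  rw [← h0, goodEight, ← h1, ← h2]
  push_cast
  ring

end EightSets

/-! ### Factors and syzygies of forms -/

section Divisors

variable {K : Type*} [Field K]

open MvPolynomial in
/-- Factors of forms are forms. -/
lemma isHomogeneous_of_mul {σ : Type*} {f g : MvPolynomial σ K} {n : ℕ}
    (h : (f * g).IsHomogeneous n) (h0 : f * g ≠ 0) :
    ∃ a b, f.IsHomogeneous a ∧ g.IsHomogeneous b ∧ a + b = n := by
  have hf0 := left_ne_zero_of_mul h0
  have hg0 := right_ne_zero_of_mul h0
  have hle : ∀ (p : MvPolynomial σ K) (m : σ →₀ ℕ), p.coeff m ≠ 0 →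
      (p : MvPowerSeries σ K).order ≤ m.degree := fun p m hm =>
    MvPowerSeries.order_le (by rwa [MvPolynomial.coeff_coe])
  have hdeg : ∀ (p : MvPolynomial σ K) (m : σ →₀ ℕ), p.coeff m ≠ 0 → m.degree ≤ p.totalDegree :=
    fun p m hm => by
      have := le_totalDegree (mem_support_iff.2 hm)
      simpa [Finsupp.degree_apply, Finsupp.sum] using this
  have hle' : ∀ p : MvPolynomial σ K, p ≠ 0 → (p : MvPowerSeries σ K).order ≤ p.totalDegree := by
    intro p hp
    obtain ⟨m, hm⟩ := MvPolynomial.ne_zero_iff.1 hp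
    exact (hle p m hm).trans (by exact_mod_cast hdeg p m hm)
  -- Both the lowest and the highest degree are additive on products. They agree on the product,
  -- hence on each factor, which is therefore homogeneous.
  have hn : (n : ℕ∞) ≤ ((f * g : MvPolynomial σ K) : MvPowerSeries σ K).order := by
    refine MvPowerSeries.le_order fun m hm => ?_
    rw [MvPolynomial.coeff_coe]
    refine h.coeff_eq_zero ?_
    rintro rfl
    exact lt_irrefl _ hm
  rw [MvPolynomial.coe_mul, MvPowerSeries.order_mul] at hn
  have ht := totalDegree_mul_of_isDomain hf0 hg0
  rw [h.totalDegree h0] at ht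
  have h1 := hle' f hf0
  have h2 := hle' g hg0
  obtain ⟨a, ha⟩ := ENat.ne_top_iff_exists.1 (ne_top_of_le_ne_top (ENat.natCast_ne_top _) h1)
  obtain ⟨b, hb⟩ := ENat.ne_top_iff_exists.1 (ne_top_of_le_ne_top (ENat.natCast_ne_top _) h2)
  rw [← ha, ← hb] at hn
  rw [← ha] at h1
  rw [← hb] at h2
  norm_cast at hn h1 h2
  have key : ∀ (p : MvPolynomial σ K), (p : MvPowerSeries σ K).order = p.totalDegree →
      p.IsHomogeneous p.totalDegree := by
    intro p hp
    rw [MvPolynomial.IsHomogeneous, MvPolynomial.IsWeightedHomogeneous]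
    intro m hm
    have e1 := hle p m hm
    have e2 := hdeg p m hm
    rw [hp] at e1
    norm_cast at e1
    have : Finsupp.weight 1 m = m.degree := by rw [Finsupp.degree_eq_weight_one]; rfl
    omega
  refine ⟨_, _, key f ?_, key g ?_, ht.symm⟩
  · rw [← ha]; norm_cast; omega
  · rw [← hb]; norm_cast; omega

open MvPolynomial in
lemma eq_C_of_isHomogeneous_zero {σ : Type*} {f : MvPolynomial σ K} (h : f.IsHomogeneous 0) :
    f = C (f.coeff 0) :=
  totalDegree_eq_zero_iff_eq_C.1 (Nat.le_zero.1 h.totalDegree_le)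

open MvPolynomial in
/-- Syzygies of a coprime pair of forms. -/
lemma exists_C_of_isRelPrime {d : ℕ} {f g a b : MvPolynomial (Fin 3) K} (hfg : IsRelPrime f g)
    (hf : f.IsHomogeneous d) (hf0 : f ≠ 0) {e : ℕ} (hed : e ≤ d)
    (hb : b.IsHomogeneous e) (hab : a * f = b * g) :
    ∃ c : K, a = C c * g ∧ b = C c * f ∧ (e < d → c = 0) := by
  have h1 : f ∣ b * g := ⟨a, by rw [← hab, mul_comm]⟩
  obtain ⟨c, rfl⟩ := hfg.dvd_of_dvd_mul_right h1
  have h2 : a = c * g := by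
    apply mul_right_cancel₀ hf0
    rw [hab]; ring
  by_cases hc : c = 0
  · exact ⟨0, by simp [h2, hc], by simp [hc], fun _ => rfl⟩
  · have h3 := hb.totalDegree (mul_ne_zero hf0 hc)
    rw [totalDegree_mul_of_isDomain hf0 hc, hf.totalDegree hf0] at h3
    have h4 := totalDegree_eq_zero_iff_eq_C.1 (show c.totalDegree = 0 by omega)
    exact ⟨c.coeff 0, by rw [← h4, h2], by rw [← h4, mul_comm], fun h => by omega⟩

open MvPolynomial in
lemma isHomogeneous_right_of_mul {σ : Type*} {f g : MvPolynomial σ K} {a b : ℕ}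
    (hf : f.IsHomogeneous a) (hf0 : f ≠ 0) (h : (f * g).IsHomogeneous (a + b)) :
    g.IsHomogeneous b := by
  by_cases hg : g = 0
  · rw [hg]; exact isHomogeneous_zero _ _ _
  · obtain ⟨a', b', ha', hb', hab⟩ := isHomogeneous_of_mul h (mul_ne_zero hf0 hg)
    have := ha'.inj_right hf hf0
    obtain rfl : b' = b := by omega
    exact hb'

open MvPolynomial in
lemma isRelPrime_of_isHomogeneous_one {x y : MvPolynomial (Fin 3) K} (hx : x.IsHomogeneous 1)
    (hy : y.IsHomogeneous 1) (h : ∀ s t : K, C s * x + C t * y = 0 → s = 0 ∧ t = 0) :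
    IsRelPrime x y := by
  have hx0 : x ≠ 0 := by
    rintro rfl
    exact one_ne_zero (h 1 0 (by simp)).1
  have hy0 : y ≠ 0 := by
    rintro rfl
    exact one_ne_zero (h 0 1 (by simp)).2
  rintro d ⟨x', rfl⟩ ⟨y', rfl⟩
  have hd0 := left_ne_zero_of_mul hx0
  obtain ⟨a, b, ha, hb, hab⟩ := isHomogeneous_of_mul hx hx0
  have hc' := isHomogeneous_right_of_mul (g := y') (b := b) ha hd0 (by rwa [hab])
  have : a = 0 ∨ b = 0 := by omega
  rcases this with rfl | rfl
  · have := eq_C_of_isHomogeneous_zero ha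
    rw [this] at hd0 ⊢
    exact (isUnit_iff_ne_zero.2 (by rintro h; simp [h] at hd0)).map C
  · exfalso
    obtain ⟨r, rfl⟩ : ∃ r, x' = C r := ⟨_, eq_C_of_isHomogeneous_zero hb⟩
    obtain ⟨r', rfl⟩ : ∃ r, y' = C r := ⟨_, eq_C_of_isHomogeneous_zero hc'⟩
    have h1 := (h r' (-r) (by rw [C_neg]; ring)).1
    rw [h1, C_0, mul_zero] at hy0
    exact hy0 rfl

end Divisors

/-! ### The pencil of cubics through eight points in general position -/

section Pencils

variable {K ι : Type*} [Field K] [Fintype K] [Fintype ι] {v : ι → Fin 3 → K}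

lemma Rel.eq_zero_of_goodEight (hv : PlaneReps v) {T : Finset ι} (hT : T ∈ goodEight v)
    {c : ι → K} (h : Rel v 3 c) (hc : supp c ⊆ T) : c = 0 := by
  obtain ⟨h8, h4, h7⟩ := mem_goodEight.1 hT
  by_contra h0
  have := h.supp_eq_of_noSeven hv h4 h7 (by omega) h0 hc
  omega

lemma finrank_vanishing_three (hv : PlaneReps v) {T : Finset ι} (hT : T ∈ goodEight v) :
    Module.finrank K (vanishing v 3 T) = 2 := by
  have := finrank_vanishing (v := v) (d := 3) (T := T) fun c h hc => h.eq_zero_of_goodEight hv hT hc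
  rw [(mem_goodEight.1 hT).1] at this
  simp [Nat.choose] at this
  omega

/-- A relation in degree `d + 1` vanishes if its products with all lines vanish. -/
lemma Rel.eq_zero_of_succ (hv : PlaneReps v) {d : ℕ} {T : Finset ι}
    (hT : ∀ c : ι → K, Rel v d c → supp c ⊆ T → c = 0) {c : ι → K} (h : Rel v (d + 1) c)
    (hc : supp c ⊆ T) : c = 0 := by
  funext i
  obtain ⟨j, hj⟩ := exists_notMem_line hv i
  have h1 := hT _ (h.mul (isHomogeneous_lin (v j)))
    (by rw [supp_mul]; exact sdiff_subset.trans hc)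
  have h2 := congrFun h1 i
  simp only [Pi.zero_apply, smul_eq_mul, mul_eq_zero] at h2
  rw [← mem_zeros, zeros_lin] at h2
  exact h2.resolve_left hj

/-- A relation in degree `d + 1` supported on a point outside `T` and `T`, where `T` supports
no relation in degree `d`. -/
lemma Rel.eq_zero_of_insert (hv : PlaneReps v) {d : ℕ} {T : Finset ι} {p : ι} (hp : p ∉ T)
    (hT : ∀ c : ι → K, Rel v d c → supp c ⊆ T → c = 0) {c : ι → K} (h : Rel v (d + 1) c)
    (hc : supp c ⊆ insert p T) : c = 0 := by
  have h1 : ∀ i, i ≠ p → c i = 0 := by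
    intro i hi
    obtain ⟨j, hj, hpj⟩ := exists_line_separating hv hi
    have h1 := hT _ (h.mul (isHomogeneous_lin (v j))) (by
      rw [supp_mul, zeros_lin]
      intro k hk
      rw [mem_sdiff] at hk
      refine (mem_insert.1 (hc hk.1)).resolve_left ?_
      rintro rfl
      exact hk.2 hpj)
    have h2 := congrFun h1 i
    simp only [Pi.zero_apply, smul_eq_mul, mul_eq_zero] at h2
    rw [← mem_zeros, zeros_lin] at h2
    exact h2.resolve_left hj
  refine h.eq_zero hv ((card_le_card (fun i hi => ?_ : supp c ⊆ {p})).trans (by simp))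
  by_contra hip
  exact mem_supp.1 hi (h1 i (by simpa using hip))

open MvPolynomial in
/-- The cubics through a set of eight points in general position form a pencil without common
component. -/
lemma exists_pencil (hv : PlaneReps v) {T : Finset ι} (hT : T ∈ goodEight v) :
    ∃ f g : MvPolynomial (Fin 3) K, f ∈ vanishing v 3 T ∧ g ∈ vanishing v 3 T ∧ f ≠ 0 ∧ g ≠ 0 ∧
      (∀ s t : K, C s * f + C t * g = 0 → s = 0 ∧ t = 0) ∧ IsRelPrime f g ∧
      ∀ k ∈ vanishing v 3 T, ∃ s t : K, k = C s * f + C t * g := by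
  have h2 := finrank_vanishing_three hv hT
  obtain ⟨h8, h4, h7⟩ := mem_goodEight.1 hT
  obtain ⟨b⟩ : Nonempty (Module.Basis (Fin 2) K (vanishing v 3 T)) :=
    ⟨Module.finBasisOfFinrankEq K _ h2⟩
  have hind : ∀ s t : K, C s * (b 0 : MvPolynomial (Fin 3) K) + C t * (b 1 : MvPolynomial (Fin 3) K) = 0 →
      s = 0 ∧ t = 0 := by
    intro s t hst
    have := LinearIndependent.pair_iff.1 (show LinearIndependent K ![b 0, b 1] by
      convert b.linearIndependent using 1
      ext i; fin_cases i <;> rfl) s t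
    apply this
    ext1
    simpa [smul_eq_C_mul] using hst
  have hf := mem_vanishing.1 (b 0).2
  have hg := mem_vanishing.1 (b 1).2
  have hf0 : (b 0 : MvPolynomial (Fin 3) K) ≠ 0 := fun h => one_ne_zero (hind 1 0 (by simp [h])).1
  have hg0 : (b 1 : MvPolynomial (Fin 3) K) ≠ 0 := fun h => one_ne_zero (hind 0 1 (by simp [h])).2
  refine ⟨b 0, b 1, (b 0).2, (b 1).2, hf0, hg0, hind, ?_, fun k hk => ?_⟩
  · generalize (b 0 : MvPolynomial (Fin 3) K) = f at *
    generalize (b 1 : MvPolynomial (Fin 3) K) = g at *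
    rintro d ⟨f', rfl⟩ ⟨g', rfl⟩
    have hd0 := left_ne_zero_of_mul hf0
    obtain ⟨e, m, hd, hf', hem⟩ := isHomogeneous_of_mul hf.1 hf0
    have hg' := isHomogeneous_right_of_mul (b := m) hd hd0 (by rw [hem]; exact hg.1)
    by_cases he : e = 0
    · subst he
      have := eq_C_of_isHomogeneous_zero hd
      rw [this] at hd0 ⊢
      exact (isUnit_iff_ne_zero.2 (by rintro h; simp [h] at hd0)).map C
    exfalso
    have hT' : ∀ i ∈ T \ zeros v d, eval (v i) f' = 0 ∧ eval (v i) g' = 0 := by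
      intro i hi
      rw [mem_sdiff, mem_zeros] at hi
      have e1 := hf.2 i hi.1
      have e2 := hg.2 i hi.1
      rw [map_mul, mul_eq_zero] at e1 e2
      exact ⟨e1.resolve_left hi.2, e2.resolve_left hi.2⟩
    -- Off a common component of degree `e` there remain enough points (5, 2 or 0 for `e = 1, 2, 3`)
    -- imposing independent conditions on the cofactors of degree `m = 3 - e` to leave a single
    -- cofactor up to scalars. The two cubics would then be proportional.
    obtain ⟨T', hT'', hcard, hrel⟩ : ∃ T' ⊆ T \ zeros v d, T'.card + 1 = (m + 2).choose 2 ∧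
        ∀ c : ι → K, Rel v m c → supp c ⊆ T' → c = 0 := by
      have hc := card_inter_add_card_sdiff T (zeros v d)
      have : e = 1 ∧ m = 2 ∨ e = 2 ∧ m = 1 ∨ e = 3 ∧ m = 0 := by omega
      rcases this with ⟨rfl, rfl⟩ | ⟨rfl, rfl⟩ | ⟨rfl, rfl⟩
      · obtain ⟨j, hj⟩ := exists_line_of_isHomogeneous_one hv hd hd0
        have := h4 j
        obtain ⟨T', h1, h2⟩ := exists_subset_card_eq (s := T \ zeros v d) (n := 5)
          (by rw [hj] at hc ⊢; omega)
        refine ⟨T', h1, by rw [h2]; rfl, fun c hc hs => ?_⟩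
        obtain ⟨j', hj'⟩ := hc.exists_line hv ((card_le_card hs).trans (by omega))
        refine hc.eq_zero hv ((card_le_card (subset_inter (hs.trans (h1.trans sdiff_subset)) hj')).trans
          (h4 j'))
      · have := h7 d hd0 hd
        obtain ⟨T', h1, h2⟩ := exists_subset_card_eq (s := T \ zeros v d) (n := 2) (by omega)
        exact ⟨T', h1, by rw [h2]; rfl, fun c hc hs =>
          hc.eq_zero hv ((card_le_card hs).trans (by omega))⟩
      · exact ⟨∅, empty_subset _, rfl, fun c hc hs =>
          hc.eq_zero hv ((card_le_card hs).trans (by simp))⟩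
    have h1 := finrank_vanishing hrel
    obtain ⟨w, -, hw⟩ := finrank_eq_one_iff'.1 (show Module.finrank K (vanishing v m T') = 1 by omega)
    obtain ⟨s, hs⟩ := hw ⟨f', mem_vanishing.2 ⟨hf', fun i hi => (hT' i (hT'' hi)).1⟩⟩
    obtain ⟨t, ht⟩ := hw ⟨g', mem_vanishing.2 ⟨hg', fun i hi => (hT' i (hT'' hi)).2⟩⟩
    have hs' := congrArg Subtype.val hs
    have ht' := congrArg Subtype.val ht
    simp only [Submodule.coe_smul, smul_eq_C_mul] at hs' ht'
    have h3 := (hind t (-s) (by rw [← hs', ← ht', C_neg]; ring)).1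
    rw [h3, C_0, zero_mul] at ht'
    exact right_ne_zero_of_mul hg0 ht'.symm
  · refine ⟨b.repr ⟨k, hk⟩ 0, b.repr ⟨k, hk⟩ 1, ?_⟩
    have := congrArg Subtype.val (b.sum_repr ⟨k, hk⟩)
    rw [Fin.sum_univ_two] at this
    simpa [smul_eq_C_mul] using this.symm

end Pencils

/-! ### The ninth base point, by linkage -/

section NinthPoint

variable {K ι : Type*} [Field K] [Fintype K] [Fintype ι] {v : ι → Fin 3 → K}

open MvPolynomial

lemma isHomogeneous_coe {d : ℕ} (x : Form K d) : (x : MvPolynomial (Fin 3) K).IsHomogeneous d := x.2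

lemma mem_neg_form {d : ℕ} (x : Form K d) : (-(x : MvPolynomial (Fin 3) K)).IsHomogeneous d :=
  (Form K d).neg_mem x.2

lemma mul_mem_vanishing {d e n : ℕ} (hn : e + d = n) {T : Finset ι} {f x : MvPolynomial (Fin 3) K}
    (hf : f ∈ vanishing v d T) (hx : x.IsHomogeneous e) : x * f ∈ vanishing v n T := by
  subst hn
  rw [mem_vanishing] at hf ⊢
  exact ⟨hx.mul hf.1, fun i hi => by rw [map_mul, hf.2 i hi, mul_zero]⟩

lemma exists_independent_kernel {V W : Type*} [AddCommGroup V] [Module K V] [AddCommGroup W]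
    [Module K W] [FiniteDimensional K V] (Ψ : V →ₗ[K] W) {S : Submodule K W} [FiniteDimensional K S]
    (hS : ∀ x, Ψ x ∈ S) (h : Module.finrank K S + 2 ≤ Module.finrank K V) :
    ∃ x y, Ψ x = 0 ∧ Ψ y = 0 ∧ ∀ s t : K, s • x + t • y = 0 → s = 0 ∧ t = 0 := by
  have h1 : Module.finrank K (LinearMap.range Ψ) ≤ Module.finrank K S :=
    Submodule.finrank_mono (by rintro _ ⟨x, rfl⟩; exact hS x)
  have h2 := LinearMap.finrank_range_add_finrank_ker Ψ
  obtain ⟨x, hx⟩ := (Module.finrank_pos_iff_exists_ne_zero (R := K)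
    (M := LinearMap.ker Ψ)).1 (by omega)
  obtain ⟨y, hy⟩ := exists_linearIndependent_pair_of_one_lt_finrank
    (show 1 < Module.finrank K (LinearMap.ker Ψ) by omega) hx
  rw [LinearIndependent.pair_iff] at hy
  exact ⟨x, y, x.2, y.2, fun s t hst => hy s t (Subtype.ext hst)⟩

/-- The quartics through eight points in general position are spanned by the multiples of the
cubics and one further quartic. -/
lemma exists_quartic (hv : PlaneReps v) {T : Finset ι} (hT : T ∈ goodEight v)
    {f g : MvPolynomial (Fin 3) K} (hf : f ∈ vanishing v 3 T) (hg : g ∈ vanishing v 3 T)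
    (hf0 : f ≠ 0) (hfg : IsRelPrime f g) :
    ∃ h ∈ vanishing v 4 T, (∀ x y, x.IsHomogeneous 1 → y.IsHomogeneous 1 → h ≠ x * f + y * g) ∧
      ∀ k ∈ vanishing v 4 T, ∃ x y, x.IsHomogeneous 1 ∧ y.IsHomogeneous 1 ∧
        ∃ γ : K, k = x * f + y * g + C γ * h := by
  let Φ : Form K 1 × Form K 1 →ₗ[K] MvPolynomial (Fin 3) K :=
    (LinearMap.mulRight K f ∘ₗ (Form K 1).subtype).coprod
      (LinearMap.mulRight K g ∘ₗ (Form K 1).subtype)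
  have hΦ : ∀ x, Φ x = x.1 * f + x.2 * g := fun x => rfl
  have hle : LinearMap.range Φ ≤ vanishing v 4 T := by
    rintro _ ⟨x, rfl⟩
    rw [hΦ]
    refine add_mem ?_ ?_
    · exact mul_mem_vanishing (by norm_num) hf (isHomogeneous_coe x.1)
    · exact mul_mem_vanishing (by norm_num) hg (isHomogeneous_coe x.2)
  have hinj : Function.Injective Φ := by
    rw [injective_iff_map_eq_zero]
    rintro ⟨x, y⟩ h0
    rw [hΦ] at h0
    obtain ⟨c, h1, h2, hc⟩ := exists_C_of_isRelPrime (a := (x : MvPolynomial (Fin 3) K))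
      (b := -(y : MvPolynomial (Fin 3) K)) (e := 1) hfg
      (mem_vanishing.1 hf).1 hf0 (by omega) (mem_neg_form y) (by linear_combination h0)
    rw [hc (by omega), C_0, zero_mul] at h1 h2
    ext1
    · exact Subtype.ext h1
    · exact Subtype.ext (neg_eq_zero.1 h2)
  -- There is no linear syzygy between coprime cubics, so the multiples have dimension 6, against
  -- `15 - 8 = 7` for all quartics through `T`: exactly one further generator.
  have h6 : Module.finrank K (LinearMap.range Φ) = 6 := by
    rw [LinearMap.finrank_range_of_inj hinj, Module.finrank_prod, finrank_form]
    rfl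
  have h7 : Module.finrank K (vanishing v 4 T) = 7 := by
    have := finrank_vanishing (v := v) (d := 4) (T := T) fun c hc hs =>
      hc.eq_zero_of_succ hv (fun c hc hs => hc.eq_zero_of_goodEight hv hT hs) hs
    rw [(mem_goodEight.1 hT).1, show Nat.choose (4 + 2) 2 = 15 from rfl] at this
    omega
  have hfin : FiniteDimensional K (vanishing v 4 T) := Module.finite_of_finrank_pos (by omega)
  obtain ⟨h, hh, hn⟩ := SetLike.exists_of_lt (lt_of_le_of_ne hle fun h => by rw [h] at h6; omega)
  refine ⟨h, hh, fun x y hx hy hxy => hn ⟨(⟨x, hx⟩, ⟨y, hy⟩), hxy.symm⟩, fun k hk => ?_⟩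
  have hsup : LinearMap.range Φ ⊔ K ∙ h = vanishing v 4 T := by
    have hle' : LinearMap.range Φ ⊔ K ∙ h ≤ vanishing v 4 T :=
      sup_le hle ((Submodule.span_singleton_le_iff_mem _ _).2 hh)
    have := Submodule.finiteDimensional_of_le hle'
    refine Submodule.eq_of_le_of_finrank_le hle' ?_
    have hlt : LinearMap.range Φ < LinearMap.range Φ ⊔ K ∙ h := by
      refine lt_of_le_of_ne le_sup_left fun he => hn ?_
      rw [he]
      exact Submodule.mem_sup_right (Submodule.mem_span_singleton_self h)
    have := Submodule.finrank_lt_finrank_of_lt hlt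
    omega
  rw [← hsup] at hk
  obtain ⟨_, ⟨⟨x, y⟩, rfl⟩, _, hz, rfl⟩ := Submodule.mem_sup.1 hk
  obtain ⟨γ, rfl⟩ := Submodule.mem_span_singleton.1 hz
  exact ⟨x, y, x.2, y.2, γ, by rw [hΦ, smul_eq_C_mul]⟩

/-- Triples of a linear form and two quadratic forms have dimension `3 + 6 + 6 = 15`, while quintics
through `T` have dimension `21 - 8 = 13`. The kernel has dimension at least two, and coprimality of
`f` and `g` makes its elements determined by their linear parts. -/
lemma exists_linear_multipliers (hv : PlaneReps v) {T : Finset ι} (hT : T ∈ goodEight v)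
    {f g h : MvPolynomial (Fin 3) K} (hf : f ∈ vanishing v 3 T) (hg : g ∈ vanishing v 3 T)
    (hf0 : f ≠ 0) (hfg : IsRelPrime f g) (hh : h ∈ vanishing v 4 T) :
    ∃ l₁ l₂ a b c e : MvPolynomial (Fin 3) K, l₁.IsHomogeneous 1 ∧ l₂.IsHomogeneous 1 ∧
      a.IsHomogeneous 2 ∧ b.IsHomogeneous 2 ∧ c.IsHomogeneous 2 ∧ e.IsHomogeneous 2 ∧
      (∀ s t : K, C s * l₁ + C t * l₂ = 0 → s = 0 ∧ t = 0) ∧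
      l₁ * h = a * f + b * g ∧ l₂ * h = c * f + e * g := by
  let Ψ : Form K 1 × Form K 2 × Form K 2 →ₗ[K] MvPolynomial (Fin 3) K :=
    (LinearMap.mulRight K h ∘ₗ (Form K 1).subtype).coprod
      ((LinearMap.mulRight K f ∘ₗ (Form K 2).subtype).coprod
        (LinearMap.mulRight K g ∘ₗ (Form K 2).subtype))
  have hΨ : ∀ x, Ψ x = x.1 * h + (x.2.1 * f + x.2.2 * g) := fun x => rfl
  have h13 : Module.finrank K (vanishing v 5 T) = 13 := by
    have := finrank_vanishing (v := v) (d := 5) (T := T) fun c hc hs =>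
      hc.eq_zero_of_succ hv (fun c hc hs =>
        hc.eq_zero_of_succ hv (fun c hc hs => hc.eq_zero_of_goodEight hv hT hs) hs) hs
    rw [(mem_goodEight.1 hT).1, show Nat.choose (5 + 2) 2 = 21 from rfl] at this
    omega
  have hfin : FiniteDimensional K (vanishing v 5 T) := Module.finite_of_finrank_pos (by omega)
  have hle : ∀ x, Ψ x ∈ vanishing v 5 T := by
    intro x
    rw [hΨ]
    refine add_mem ?_ (add_mem ?_ ?_)
    · exact mul_mem_vanishing (by norm_num) hh (isHomogeneous_coe x.1)
    · exact mul_mem_vanishing (by norm_num) hf (isHomogeneous_coe x.2.1)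
    · exact mul_mem_vanishing (by norm_num) hg (isHomogeneous_coe x.2.2)
  have h15 : Module.finrank K (Form K 1 × Form K 2 × Form K 2) = 15 := by
    rw [Module.finrank_prod, Module.finrank_prod, finrank_form, finrank_form]
    rfl
  obtain ⟨x, y, hx', hy', hxy⟩ := exists_independent_kernel Ψ hle (by omega)
  have hker : ∀ z, Ψ z = 0 → z.1 = 0 → z = 0 := by
    intro z hz hz0
    rw [hΨ, hz0, ZeroMemClass.coe_zero, zero_mul, zero_add] at hz
    obtain ⟨c, h1, h2, hc⟩ := exists_C_of_isRelPrime (a := (z.2.1 : MvPolynomial (Fin 3) K))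
      (b := -(z.2.2 : MvPolynomial (Fin 3) K)) (e := 2) hfg
      (mem_vanishing.1 hf).1 hf0 (by omega) (mem_neg_form _) (by linear_combination hz)
    rw [hc (by omega), C_0, zero_mul] at h1 h2
    exact Prod.ext hz0 (Prod.ext (Subtype.ext h1) (Subtype.ext (neg_eq_zero.1 h2)))
  have hx'' := hΨ x
  have hy'' := hΨ y
  rw [hx'] at hx''
  rw [hy'] at hy''
  refine ⟨x.1, y.1, -x.2.1, -x.2.2, -y.2.1, -y.2.2, x.1.2, y.1.2, mem_neg_form _, mem_neg_form _,
    mem_neg_form _, mem_neg_form _, fun s t hst => ?_,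
    by linear_combination -hx'', by linear_combination -hy''⟩
  refine hxy s t (hker (s • x + t • y) ?_ (Subtype.ext ?_))
  · rw [map_add, map_smul, map_smul, hx', hy', smul_zero, smul_zero, add_zero]
  · rw [← smul_eq_C_mul, ← smul_eq_C_mul] at hst
    exact hst

/-- Two independent linear forms have exactly one common zero. -/
lemma exists_common_zero (hv : PlaneReps v) {x y : MvPolynomial (Fin 3) K}
    (hx : x.IsHomogeneous 1) (hy : y.IsHomogeneous 1)
    (h : ∀ s t : K, C s * x + C t * y = 0 → s = 0 ∧ t = 0) :
    ∃ p, ∀ i, (eval (v i) x = 0 ∧ eval (v i) y = 0) ↔ i = p := by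
  obtain ⟨a, rfl⟩ := exists_lin_of_isHomogeneous_one hx
  obtain ⟨b, rfl⟩ := exists_lin_of_isHomogeneous_one hy
  have ha : a ≠ 0 := by
    rintro rfl
    exact one_ne_zero (h 1 0 (by simp [lin])).1
  have hb : b ≠ 0 := by
    rintro rfl
    exact one_ne_zero (h 0 1 (by simp [lin])).2
  obtain ⟨j, r, hr, hj⟩ := hv.exists_smul ha
  obtain ⟨j', r', hr', hj'⟩ := hv.exists_smul hb
  have hne : j ≠ j' := by
    rintro rfl
    rw [hj] at hj'
    have := (h r (-r') (by
      have e : ∀ (s : K) (w : Fin 3 → K), C s * lin w = lin (s • w) := fun s w => by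
        simp [lin, Finset.mul_sum, mul_assoc]
      rw [C_neg, neg_mul, e, e, hj', add_neg_cancel])).1
    exact hr this
  obtain ⟨p, hp⟩ := card_eq_one.1 (card_line_inter hv hne)
  refine ⟨p, fun i => ?_⟩
  have := Finset.ext_iff.1 hp i
  rw [mem_inter, mem_singleton, mem_line, mem_line, hj, hj', smul_dotProduct, smul_dotProduct] at this
  rw [eval_lin, eval_lin, ← this]
  simp [hr, hr']

/-- The derivative at `w` in the direction `z`. -/
def dirDeriv (w z : Fin 3 → K) (f : MvPolynomial (Fin 3) K) : K :=
  ∑ i, z i * eval w (pderiv i f)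

lemma dirDeriv_add (w z : Fin 3 → K) (f g : MvPolynomial (Fin 3) K) :
    dirDeriv w z (f + g) = dirDeriv w z f + dirDeriv w z g := by
  simp [dirDeriv, mul_add, Finset.sum_add_distrib]

lemma dirDeriv_mul (w z : Fin 3 → K) (f g : MvPolynomial (Fin 3) K) :
    dirDeriv w z (f * g) = eval w f * dirDeriv w z g + eval w g * dirDeriv w z f := by
  simp only [dirDeriv, Derivation.leibniz, smul_eq_mul, map_add, map_mul, mul_add,
    Finset.sum_add_distrib, Finset.mul_sum]
  congr 1 <;> exact Finset.sum_congr rfl fun i _ => by ring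

lemma dirDeriv_C_mul (w z : Fin 3 → K) (c : K) (f : MvPolynomial (Fin 3) K) :
    dirDeriv w z (C c * f) = c * dirDeriv w z f := by
  rw [dirDeriv_mul]
  simp [dirDeriv]

lemma dirDeriv_lin (w z a : Fin 3 → K) : dirDeriv w z (lin a) = a ⬝ᵥ z := by
  simp [dirDeriv, lin, pderiv_X, Pi.single_apply, dotProduct, mul_comm]

lemma dirDeriv_eq_zero_of_singularAt {p : ι} {f : MvPolynomial (Fin 3) K} (h : SingularAt v p f)
    (z : Fin 3 → K) : dirDeriv (v p) z f = 0 := by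
  obtain ⟨x, y, G, H, -, -, -, -, hx, hy, hG, hH, rfl⟩ := h
  simp [dirDeriv_add, dirDeriv_mul, hx, hy, hG, hH]

/-- Every cubic has a tangent direction at any point. -/
lemma exists_tangent (hv : PlaneReps v) (p : ι) (f : MvPolynomial (Fin 3) K) :
    ∃ i, i ≠ p ∧ dirDeriv (v p) (v i) f = 0 := by
  set D : Fin 3 → K := fun i => eval (v p) (pderiv i f) with hD
  have hd : ∀ z, dirDeriv (v p) z f = D ⬝ᵥ z := fun z => by
    simp [dirDeriv, dotProduct, hD, mul_comm]
  have hq := Fintype.one_lt_card (α := K)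
  have : Nontrivial ι := by
    rw [← Fintype.one_lt_card_iff_nontrivial, card_points hv]
    omega
  by_cases h0 : D = 0
  · obtain ⟨i, hi⟩ := exists_ne p
    exact ⟨i, hi, by rw [hd, h0, zero_dotProduct]⟩
  · obtain ⟨j, c, hc, hj⟩ := hv.exists_smul h0
    obtain ⟨i, hi, hip⟩ := exists_mem_ne (s := line v j) (by rw [card_line hv]; omega) p
    rw [mem_line, hj, smul_dotProduct, smul_eq_mul, mul_eq_zero] at hi
    exact ⟨i, hip, by rw [hd]; exact hi.resolve_left hc⟩

/-- A multiplier of the extra quartic vanishes at any common zero of the cubics outside `T`. -/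
lemma false_of_common_zero (hv : PlaneReps v) {T : Finset ι} (hT : T ∈ goodEight v)
    {f g h : MvPolynomial (Fin 3) K} {p : ι} (hp : p ∉ T)
    (hf : eval (v p) f = 0) (hg : eval (v p) g = 0)
    (hspan : ∀ k ∈ vanishing v 4 T, ∃ x y, x.IsHomogeneous 1 ∧ y.IsHomogeneous 1 ∧
      ∃ γ : K, k = x * f + y * g + C γ * h)
    {l a b : MvPolynomial (Fin 3) K} (hl : eval (v p) l ≠ 0) (hlh : l * h = a * f + b * g) :
    False := by
  have hh : eval (v p) h = 0 := by
    have := congrArg (eval (v p)) hlh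
    simp only [map_mul, map_add, hf, hg, mul_zero, add_zero] at this
    exact (mul_eq_zero.1 this).resolve_left hl
  -- All quartics through `T` would pass through `p`, yet `T` together with `p` imposes independent
  -- conditions on quartics.
  have hle : vanishing v 4 T ≤ vanishing v 4 (insert p T) := by
    intro k hk
    obtain ⟨x, y, -, -, γ, hxy⟩ := hspan k hk
    rw [mem_vanishing] at hk ⊢
    refine ⟨hk.1, fun i hi => ?_⟩
    rcases mem_insert.1 hi with rfl | hi
    · rw [hxy]
      simp [hf, hg, hh]
    · exact hk.2 i hi
  have h1 := finrank_vanishing_ge (v := v) 4 T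
  have h2 := finrank_vanishing (v := v) (d := 4) (T := insert p T) fun c hc hs =>
    hc.eq_zero_of_insert hv hp (fun c hc hs => hc.eq_zero_of_goodEight hv hT hs) hs
  rw [card_insert_of_notMem hp] at h2
  have hfin : FiniteDimensional K (vanishing v 4 (insert p T)) :=
    Module.finite_of_finrank_pos (by rw [(mem_goodEight.1 hT).1] at h2; simp [Nat.choose] at h2; omega)
  have := Submodule.finrank_mono hle
  omega

/-- A multiplier of the extra quartic vanishes at any point of `T` at which some cubic is
singular. -/
lemma false_of_singularAt (hv : PlaneReps v) {T : Finset ι} (hT : T ∈ goodEight v)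
    {f g h : MvPolynomial (Fin 3) K} {p : ι} (hp : p ∈ T)
    (hf : f ∈ vanishing v 3 T) (hg : g ∈ vanishing v 3 T) (hh : h ∈ vanishing v 4 T)
    (hspan : ∀ k ∈ vanishing v 4 T, ∃ x y, x.IsHomogeneous 1 ∧ y.IsHomogeneous 1 ∧
      ∃ γ : K, k = x * f + y * g + C γ * h)
    {s t : K} (hst : s ≠ 0) (hs : SingularAt v p (C s * f + C t * g))
    {l a b : MvPolynomial (Fin 3) K} (hl : eval (v p) l ≠ 0) (hlh : l * h = a * f + b * g) :
    False := by
  -- A tangent direction of `g` at `p` is one of `f` too, since a combination with nonzero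
  -- coefficient at `f` is singular there. Differentiating `l h = a f + b g` makes it tangent to
  -- `h`, and then to every quartic through `T`.
  obtain ⟨i, hip, hig⟩ := exists_tangent hv p g
  have hif : dirDeriv (v p) (v i) f = 0 := by
    have := dirDeriv_eq_zero_of_singularAt hs (v i)
    rw [dirDeriv_add, dirDeriv_C_mul, dirDeriv_C_mul, hig, mul_zero, add_zero] at this
    exact (mul_eq_zero.1 this).resolve_left hst
  have hf0 := (mem_vanishing.1 hf).2 p hp
  have hg0 := (mem_vanishing.1 hg).2 p hp
  have hh0 := (mem_vanishing.1 hh).2 p hp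
  have hih : dirDeriv (v p) (v i) h = 0 := by
    have := congrArg (dirDeriv (v p) (v i)) hlh
    simp only [dirDeriv_add, dirDeriv_mul, hif, hig, hf0, hg0, hh0, mul_zero, zero_mul,
      add_zero] at this
    exact (mul_eq_zero.1 this).resolve_left hl
  -- The contradiction is a quartic through `T` transversal to that direction: a line through `p` in
  -- another direction times a cubic through the other seven points and not through `p`.
  obtain ⟨j, hj, hpj⟩ := exists_line_separating hv hip
  obtain ⟨k, hk, hkp⟩ : ∃ k ∈ vanishing v 3 (T.erase p), eval (v p) k ≠ 0 := by
    by_contra! hc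
    have h1 := finrank_vanishing_ge (v := v) 3 (T.erase p)
    have h2 := finrank_vanishing_three hv hT
    have h3 : vanishing v 3 (T.erase p) ≤ vanishing v 3 T := fun k hk => by
      have := hc k hk
      rw [mem_vanishing] at hk ⊢
      refine ⟨hk.1, fun i hi => ?_⟩
      by_cases h : i = p
      · rwa [h]
      · exact hk.2 i (mem_erase.2 ⟨h, hi⟩)
    have hfin : FiniteDimensional K (vanishing v 3 T) := Module.finite_of_finrank_pos (by omega)
    have h4 := Submodule.finrank_mono h3
    rw [card_erase_of_mem hp, (mem_goodEight.1 hT).1] at h1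
    simp [Nat.choose] at h1
    omega
  have hm : lin (v j) * k ∈ vanishing v 4 T := by
    rw [mem_vanishing] at hk ⊢
    refine ⟨(isHomogeneous_lin (v j)).mul hk.1, fun i hi => ?_⟩
    rw [map_mul, mul_eq_zero]
    by_cases h : i = p
    · left; rwa [h, ← mem_zeros, zeros_lin]
    · exact Or.inr (hk.2 i (mem_erase.2 ⟨h, hi⟩))
  obtain ⟨x, y, -, -, γ, hxy⟩ := hspan _ hm
  have := congrArg (dirDeriv (v p) (v i)) hxy
  rw [dirDeriv_add, dirDeriv_add, dirDeriv_C_mul, dirDeriv_mul, dirDeriv_mul, dirDeriv_mul, hif,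
    hig, hih, hf0, hg0, dirDeriv_lin, eval_lin, mem_line.1 hpj] at this
  simp only [zero_mul, mul_zero, add_zero, zero_add, mul_eq_zero] at this
  exact this.elim hkp fun h => hj (mem_line.2 h)

/-- The ninth base point of the pencil of cubics through eight points in general position, which
may be one of the eight points. -/
theorem exists_ninth_point (hv : PlaneReps v) {T : Finset ι} (hT : T ∈ goodEight v) :
    ∃ p, ∀ p', ((p' ∉ T ∧ ∀ f ∈ vanishing v 3 T, eval (v p') f = 0) ∨
      (p' ∈ T ∧ ∃ f ∈ vanishing v 3 T, f ≠ 0 ∧ SingularAt v p' f)) ↔ p' = p := by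
  obtain ⟨f, g, hf, hg, hf0, hg0, hind, hfg, hV⟩ := exists_pencil hv hT
  obtain ⟨h, hh, hn, hspan⟩ := exists_quartic hv hT hf hg hf0 hfg
  obtain ⟨l₁, l₂, a, b, c, e, hl₁, hl₂, ha, hb, hc, he, hl, h1, h2⟩ :=
    exists_linear_multipliers hv hT hf hg hf0 hfg hh
  obtain ⟨p, hp⟩ := exists_common_zero hv hl₁ hl₂ hl
  refine ⟨p, fun p' => ⟨fun hp' => ?_, ?_⟩⟩
  · by_contra hne
    obtain ⟨l, a, b, hl, hlh⟩ : ∃ l a b, eval (v p') l ≠ 0 ∧ l * h = a * f + b * g := by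
      by_cases h0 : eval (v p') l₁ = 0
      · exact ⟨l₂, c, e, fun h0' => hne ((hp p').1 ⟨h0, h0'⟩), h2⟩
      · exact ⟨l₁, a, b, h0, h1⟩
    rcases hp' with ⟨hpT, hp'⟩ | ⟨hpT, F, hF, hF0, hs⟩
    · exact false_of_common_zero hv hT hpT (hp' f hf) (hp' g hg) hspan hl hlh
    · obtain ⟨s, t, rfl⟩ := hV F hF
      by_cases h0 : s = 0
      · have ht : t ≠ 0 := by
          rintro rfl
          exact hF0 (by simp [h0])
        refine false_of_singularAt (f := g) (g := f) hv hT hpT hg hf hh (fun k hk => ?_) ht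
          (t := s) (by rwa [add_comm]) hl (hlh.trans (add_comm _ _))
        obtain ⟨x, y, hx, hy, γ, rfl⟩ := hspan k hk
        exact ⟨y, x, hy, hx, γ, by ring⟩
      · exact false_of_singularAt hv hT hpT hf hg hh hspan h0 hs hl hlh
  · rintro rfl
    obtain ⟨hp₁, hp₂⟩ := (hp p').2 rfl
    have hl₁0 : l₁ ≠ 0 := by
      rintro rfl
      exact one_ne_zero (hl 1 0 (by simp)).1
    -- Eliminating `h` gives `(l₁ c - l₂ a) f = (l₂ b - l₁ e) g`. All four factors are cubics, so
    -- the brackets are `r g` and `r f` for one constant `r`.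
    obtain ⟨r, hr₁, hr₂, -⟩ := exists_C_of_isRelPrime (a := l₁ * c - l₂ * a)
      (b := l₂ * b - l₁ * e) hfg (mem_vanishing.1 hf).1 hf0 le_rfl
      ((hl₂.mul hb).sub (hl₁.mul he)) (by linear_combination l₂ * h1 - l₁ * h2)
    -- If `r = 0`, then `l₁` divides both `a` and `b`, and cancelling it puts `h` in the ideal of
    -- `f` and `g`.
    have hr : r ≠ 0 := by
      rintro rfl
      rw [C_0, zero_mul] at hr₁ hr₂
      have hrel := isRelPrime_of_isHomogeneous_one hl₁ hl₂ hl
      obtain ⟨a', rfl⟩ := hrel.dvd_of_dvd_mul_left (z := a) ⟨c, by linear_combination -hr₁⟩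
      obtain ⟨b', rfl⟩ := hrel.dvd_of_dvd_mul_left (z := b) ⟨e, by linear_combination hr₂⟩
      refine hn a' b' (isHomogeneous_right_of_mul hl₁ hl₁0 ha)
        (isHomogeneous_right_of_mul hl₁ hl₁0 hb) (mul_left_cancel₀ hl₁0 ?_)
      linear_combination h1
    have hdet : C r * h = b * c - a * e := by
      apply mul_left_cancel₀ hl₁0
      linear_combination C r * h1 - a * hr₂ - b * hr₁
    have hCr : (C r : MvPolynomial (Fin 3) K) ≠ 0 := by simpa using hr
    by_cases hpT : p' ∈ T
    · right
      refine ⟨hpT, ?_⟩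
      have hd := congrArg (eval (v p')) hdet
      simp only [map_mul, map_sub, (mem_vanishing.1 hh).2 p' hpT, mul_zero] at hd
      -- Since `r h = b c - a e` vanishes at `p'`, the matrix of multipliers is singular there. A
      -- kernel vector makes both quadratic factors vanish at `p'` in `r (s f + t g) = l₁ (t c - s
      -- e) + l₂ (s b - t a)`, so this cubic is singular at `p'`.
      obtain ⟨s, t, hst, e1, e2⟩ : ∃ s t : K, (s ≠ 0 ∨ t ≠ 0) ∧
          s * eval (v p') b = t * eval (v p') a ∧ s * eval (v p') e = t * eval (v p') c := by
        by_cases h0 : eval (v p') a = 0 ∧ eval (v p') b = 0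
        · by_cases h0' : eval (v p') c = 0 ∧ eval (v p') e = 0
          · exact ⟨1, 0, Or.inl one_ne_zero, by simp [h0], by simp [h0']⟩
          · refine ⟨eval (v p') c, eval (v p') e, ?_, by simp [h0], mul_comm _ _⟩
            by_contra! hc
            exact h0' hc
        · refine ⟨eval (v p') a, eval (v p') b, ?_, mul_comm _ _, by linear_combination hd⟩
          by_contra! hc
          exact h0 hc
      refine ⟨C s * f + C t * g, ?_, fun h0 => ?_, l₁, l₂, C r⁻¹ * (C t * c - C s * e),
        C r⁻¹ * (C s * b - C t * a), hl₁, hl₂, ?_, ?_, hp₁, hp₂, ?_, ?_, ?_⟩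
      · rw [← smul_eq_C_mul, ← smul_eq_C_mul]
        exact add_mem (Submodule.smul_mem _ _ hf) (Submodule.smul_mem _ _ hg)
      · obtain ⟨rfl, rfl⟩ := hind _ _ h0
        simp at hst
      · exact ((hc.C_mul _).sub (he.C_mul _)).C_mul _
      · exact ((hb.C_mul _).sub (ha.C_mul _)).C_mul _
      · simp only [map_mul, map_sub, eval_C]
        linear_combination -r⁻¹ * e2
      · simp only [map_mul, map_sub, eval_C]
        linear_combination r⁻¹ * e1
      · apply mul_left_cancel₀ hCr
        have : (C r * C r⁻¹ : MvPolynomial (Fin 3) K) = 1 := by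
          rw [← C_mul, mul_inv_cancel₀ hr, C_1]
        linear_combination -C s * hr₂ - C t * hr₁ -
          (l₁ * (C t * c - C s * e) + l₂ * (C s * b - C t * a)) * this
    · left
      refine ⟨hpT, fun k hk => ?_⟩
      have e1 := congrArg (eval (v p')) hr₁
      have e2 := congrArg (eval (v p')) hr₂
      simp only [map_mul, map_sub, eval_C, hp₁, hp₂, zero_mul, sub_zero] at e1 e2
      obtain ⟨s, t, rfl⟩ := hV k hk
      rw [map_add, map_mul, map_mul, (mul_eq_zero.1 e1.symm).resolve_left hr,
        (mul_eq_zero.1 e2.symm).resolve_left hr, mul_zero, mul_zero, add_zero]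

end NinthPoint

/-! ### Configurations on a cubic with a double point are in general position -/

section SingularCubics

variable {K ι : Type*} [Field K] [Fintype K] [Fintype ι] {v : ι → Fin 3 → K} {p : ι}

/-- A point, given by its direction and height, lies on the curve `z A(u) + B(u) = 0`. -/
def OnCurve (k : ℕ) (A B : Polynomial K) (x : Option K × K) : Prop :=
  x.2 * bev k A x.1 + bev (k + 1) B x.1 = 0

/-- `U` consists of two points off the curve in each direction of `E`, and `2 k + 3` points of the
curve in other directions. -/
structure Adm (k : ℕ) (A B : Polynomial K) (E : Finset (Option K)) (U : Finset (Option K × K)) :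
    Prop where
  on : ∀ x ∈ U, x.1 ∉ E → OnCurve k A B x
  off : ∀ x ∈ U, x.1 ∈ E → ¬ OnCurve k A B x
  two : ∀ u ∈ E, (U.filter fun x => x.1 = u).card = 2
  card_on : (U.filter fun x => x.1 ∉ E).card = 2 * k + 3
  card_add : E.card + k = 2

lemma Cop.injOn_fst {k : ℕ} {A B : Polynomial K} (h : Cop k A B) {V : Finset (Option K × K)}
    (hV : ∀ x ∈ V, OnCurve k A B x) : Set.InjOn Prod.fst (V : Set (Option K × K)) := by
  rintro ⟨u, z⟩ hx ⟨u', z'⟩ hx' (rfl : u = u')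
  rw [h.unique_fibre (z := z) (z' := z') (hV _ (mem_coe.1 hx)) (hV _ (mem_coe.1 hx'))]

lemma card_filter_split (V : Finset (Option K × K)) (E : Finset (Option K)) :
    V.card = (V.filter fun x => x.1 ∉ E).card + ∑ u ∈ E, (V.filter fun x => x.1 = u).card := by
  rw [← card_filter_add_card_filter_not (s := V) (fun x => x.1 ∉ E)]
  congr 1
  rw [card_eq_sum_card_fiberwise (f := Prod.fst) (t := E) (fun x hx => by
    have := (mem_filter.1 hx).2
    simpa using this)]
  refine Finset.sum_congr rfl fun u hu => ?_
  rw [filter_filter]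
  congr 1
  ext x
  simp only [mem_filter, not_not]
  constructor
  · rintro ⟨h1, -, h2⟩; exact ⟨h1, h2⟩
  · rintro ⟨h1, rfl⟩; exact ⟨h1, hu, rfl⟩

lemma card_filter_le_add (U : Finset (Option K × K)) (E : Finset (Option K))
    (P : Option K × K → Prop) [DecidablePred P] {m n : ℕ}
    (hm : ((U.filter P).filter fun x => x.1 ∉ E).card ≤ m)
    (hn : ∑ u ∈ E, ((U.filter P).filter fun x => x.1 = u).card ≤ n) :
    (U.filter P).card ≤ m + n := by
  rw [card_filter_split _ E]
  exact add_le_add hm hn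

namespace Adm

variable {k : ℕ} {A B : Polynomial K} {E : Finset (Option K)} {U : Finset (Option K × K)}

lemma card_eq (h : Adm k A B E U) : U.card = 7 := by
  rw [card_filter_split U E, h.card_on, sum_congr rfl h.two, sum_const, smul_eq_mul]
  have := h.card_add
  omega

lemma card_fibre_le (h : Adm k A B E U) (hc : Cop k A B) {u : Option K} (hu : u ∉ E) :
    (U.filter fun x => x.1 = u).card ≤ 1 := by
  rw [card_le_one]
  intro x hx y hy
  rw [mem_filter] at hx hy
  refine hc.injOn_fst (V := U.filter fun x => x.1 ∉ E) (fun x hx => ?_) ?_ ?_ (hx.2.trans hy.2.symm)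
  · rw [mem_filter] at hx
    exact h.on x hx.1 hx.2
  · exact mem_coe.2 (mem_filter.2 ⟨hx.1, by rwa [hx.2]⟩)
  · exact mem_coe.2 (mem_filter.2 ⟨hy.1, by rwa [hy.2]⟩)

/-- The curve has at most one point other than the vertex in each direction, so `E`, and with it
`k`, can be read off from `U`. -/
lemma directions_eq (h : Adm k A B E U) (hc : Cop k A B) :
    E = univ.filter fun u => (U.filter fun x => x.1 = u).card = 2 := by
  ext u
  rw [mem_filter]
  refine ⟨fun hu => ⟨mem_univ u, h.two u hu⟩, fun hu => ?_⟩
  by_contra hn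
  have := h.card_fibre_le hc hn
  omega

/-- The cross product of the two pairs has degree `2 k + 1` and vanishes in the `2 k + 3` directions
of the points on the curve. -/
lemma exists_C_mul (h : Adm k A B E U) (hc : Cop k A B) {A' B' : Polynomial K}
    (h' : Adm k A' B' E U) (hc' : Cop k A' B') :
    ∃ c : K, c ≠ 0 ∧ A' = Polynomial.C c * A ∧ B' = Polynomial.C c * B := by
  have hV : ∀ x ∈ U.filter fun x => x.1 ∉ E, OnCurve k A B x := fun x hx => by
    rw [mem_filter] at hx; exact h.on x hx.1 hx.2
  have h1 := hc.eq_of_bev hc'.natDegree_left hc'.natDegree_right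
    (D := (U.filter fun x => x.1 ∉ E).image Prod.fst)
    (by rw [card_image_of_injOn (hc.injOn_fst hV), h.card_on]; omega) (by
      intro u hu
      obtain ⟨x, hx, rfl⟩ := mem_image.1 hu
      have e1 := hV x hx
      rw [mem_filter] at hx
      have e2 := h'.on x hx.1 hx.2
      unfold OnCurve at e1 e2
      linear_combination bev k A' x.1 * e1 - bev k A x.1 * e2)
  obtain ⟨c, rfl, rfl, hd⟩ := hc.exists_factor hc'.natDegree_left hc'.natDegree_right h1
  have hd' : c.natDegree ≤ 0 := by
    rcases hd with rfl | hd
    · simp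
    · omega
  rw [Polynomial.eq_C_of_natDegree_le_zero hd'] at hc' ⊢
  refine ⟨c.coeff 0, fun h0 => hc'.ne_zero ?_, rfl, rfl⟩
  rw [h0, Polynomial.C_0, zero_mul]

lemma C_mul (h : Adm k A B E U) {c : K} (hc : c ≠ 0) :
    Adm k (Polynomial.C c * A) (Polynomial.C c * B) E U := by
  have : ∀ x, OnCurve k (Polynomial.C c * A) (Polynomial.C c * B) x ↔ OnCurve k A B x := by
    intro x
    rw [OnCurve, OnCurve, bev_C_mul, bev_C_mul]
    have : x.2 * (c * bev k A x.1) + c * bev (k + 1) B x.1 =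
      c * (x.2 * bev k A x.1 + bev (k + 1) B x.1) := by ring
    rw [this, mul_eq_zero]
    simp [hc]
  exact ⟨fun x hx hE => (this x).2 (h.on x hx hE), fun x hx hE => fun ho => h.off x hx hE ((this x).1 ho),
    h.two, h.card_on, h.card_add⟩

lemma card_filter_on_le (h : Adm k A B E U) (P : Option K × K → Prop) [DecidablePred P] :
    ((U.filter P).filter fun x => x.1 ∉ E).card ≤ 2 * k + 3 := by
  rw [← h.card_on]
  exact card_le_card (filter_subset_filter _ (filter_subset _ _))

lemma card_filter_fibre_le (h : Adm k A B E U) (P : Option K × K → Prop) [DecidablePred P] {u : Option K}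
    (hu : u ∈ E) : ((U.filter P).filter fun x => x.1 = u).card ≤ 2 := by
  rw [← h.two u hu]
  exact card_le_card (filter_subset_filter _ (filter_subset _ _))

lemma onCurve_of_mem (h : Adm k A B E U) {P : Option K × K → Prop} [DecidablePred P] {x : Option K × K}
    (hx : x ∈ (U.filter P).filter fun x => x.1 ∉ E) : OnCurve k A B x ∧ P x := by
  simp only [mem_filter] at hx
  exact ⟨h.on x hx.1.1 hx.2, hx.1.2⟩

/-- A line through `p` is a single direction. Any other line is the curve itself (`k = 0`), with its
three points and none of the others, or it meets the curve in at most `k + 1` directions and each of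
the `2 - k` directions of `E` in one point. -/
lemma card_line_le (h : Adm k A B E U) (hc : Cop k A B) (F : Frame v p) (hv : PlaneReps v) (j : ι) :
    (U.filter fun x => F.e x ∈ line v j).card ≤ if p ∈ line v j then 2 else 3 := by
  obtain ⟨a, b, ha, hb, h0, hp, hl⟩ := F.exists_line_eq hv j
  have hE := h.card_add
  split_ifs with hpj
  · have ha0 := hp.1 hpj
    subst ha0
    obtain ⟨w, hw⟩ := exists_unique_bev hb (by simpa using h0)
    have hs : (U.filter fun x => F.e x ∈ line v j) ⊆ U.filter fun x => x.1 = w := by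
      rintro ⟨u, z⟩ hx
      rw [mem_filter, hl, bev_zero, mul_zero, zero_add] at hx
      have := Finset.ext_iff.1 hw u
      simp only [mem_filter, mem_univ, true_and, mem_singleton] at this
      exact mem_filter.2 ⟨hx.1, this.1 hx.2⟩
    refine (card_le_card hs).trans ?_
    by_cases hwE : w ∈ E
    · exact (h.two w hwE).le
    · exact (h.card_fibre_le hc hwE).trans one_le_two
  · have ha0 : a ≠ 0 := fun h => hpj (hp.2 h)
    have hau : ∀ u, bev 0 a u ≠ 0 := by
      obtain ⟨r, rfl⟩ : ∃ r, a = Polynomial.C r := ⟨_, Polynomial.eq_C_of_natDegree_le_zero ha⟩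
      intro u
      cases u <;> simpa [bev] using ha0
    by_cases hab : a * B = b * A
    · have hk : k = 0 := by
        obtain ⟨c, rfl, rfl, hd⟩ := hc.exists_factor ha hb hab
        rcases hd with rfl | hd
        · simp at ha0
        · omega
      subst hk
      refine (card_filter_le_add U E _ (h.card_filter_on_le _) (n := 0) (le_of_eq ?_))
      refine Finset.sum_eq_zero fun u hu => card_eq_zero.2 (filter_eq_empty_iff.2 ?_)
      rintro ⟨w, z⟩ hx (rfl : w = u)
      rw [mem_filter, hl] at hx
      refine h.off _ hx.1 hu ?_
      have e1 : bev 0 a w * bev 1 B w = bev 1 b w * bev 0 A w := by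
        have e2 := congrArg (fun P => bev (0 + 1) P w) hab
        have e3 : bev (0 + 1) (b * A) w = bev 1 b w * bev 0 A w :=
          bev_mul (m := 1) (n := 0) hb hc.natDegree_left w
        rwa [bev_mul ha hc.natDegree_right, e3] at e2
      apply mul_left_cancel₀ (hau w)
      linear_combination e1 + bev 0 A w * hx.2
    · refine (card_filter_le_add U E _ (m := k + 1) (n := E.card) ?_ ?_).trans (by omega)
      · by_contra! hlt
        refine hab (hc.eq_of_bev (l := 0) ha hb (D := ((U.filter fun x => F.e x ∈ line v j).filter
          fun x => x.1 ∉ E).image Prod.fst) ?_ ?_)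
        · rw [card_image_of_injOn (hc.injOn_fst fun x hx => (h.onCurve_of_mem hx).1)]
          omega
        · intro u hu
          obtain ⟨⟨u, z⟩, hx, rfl⟩ := mem_image.1 hu
          obtain ⟨e1, e2⟩ := h.onCurve_of_mem hx
          rw [hl] at e2
          simp only [OnCurve] at e1 ⊢
          linear_combination bev 0 a u * e1 - bev k A u * e2
      · rw [card_eq_sum_ones]
        refine Finset.sum_le_sum fun u hu => ?_
        rw [card_le_one]
        rintro ⟨w, z⟩ hx ⟨w', z'⟩ hy
        simp only [mem_filter, hl] at hx hy
        obtain ⟨⟨-, hx⟩, rfl⟩ := hx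
        obtain ⟨⟨-, hy⟩, rfl⟩ := hy
        rw [mul_right_cancel₀ (hau w') (show z * bev 0 a w' = z' * bev 0 a w' by
          linear_combination hx - hy)]

/-- If the conic contains the curve, the rest is given by a cofactor of degree at most `1 - k`,
whence at most `2 k + 3 + 2 (1 - k) = 5` points. Otherwise the cross product has degree `k + 2`, and
zeros in directions of `E` where the conic contains the whole line are charged to the same bound. -/
lemma card_conic_le_of_mem (h : Adm k A B E U) (hc : Cop k A B) (F : Frame v p)
    {a b : Polynomial K} (ha : a.natDegree ≤ 1) (hb : b.natDegree ≤ 2) (h0 : a ≠ 0 ∨ b ≠ 0) :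
    (U.filter fun x => F.e x ∈ zeros v (F.cone 1 a b)).card ≤ 5 := by
  have hE := h.card_add
  have hz : ∀ u z, F.e (u, z) ∈ zeros v (F.cone 1 a b) ↔ z * bev 1 a u + bev 2 b u = 0 :=
    fun u z => F.mem_zeros_cone ha hb
  by_cases hab : a * B = b * A
  · obtain ⟨c, rfl, rfl, hd⟩ := hc.exists_factor ha hb hab
    have hc0 : c ≠ 0 := by
      rintro rfl
      simp at h0
    have hd := hd.resolve_left hc0
    have hroots := card_bev_zeros_le (m := 1 - k) (P := c) (by omega) hc0
    refine (card_filter_le_add U E _ (h.card_filter_on_le _)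
      (n := 2 * (E.filter fun u => bev (1 - k) c u = 0).card) ?_).trans ?_
    · rw [card_filter, mul_sum]
      refine Finset.sum_le_sum fun u hu => ?_
      split_ifs with hcu
      · exact h.card_filter_fibre_le _ hu
      · refine (card_eq_zero.2 (filter_eq_empty_iff.2 ?_)).le
        rintro ⟨w, z⟩ hx (rfl : w = u)
        rw [mem_filter, hz] at hx
        refine h.off _ hx.1 hu ?_
        have e1 : bev 1 (c * A) w = bev (1 - k) c w * bev k A w := by
          rw [← bev_mul (by omega) hc.natDegree_left, Nat.sub_add_cancel (by omega)]
        have e2 : bev 2 (c * B) w = bev (1 - k) c w * bev (k + 1) B w := by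
          rw [← bev_mul (by omega) hc.natDegree_right, ← add_assoc, Nat.sub_add_cancel (by omega)]
        rw [e1, e2] at hx
        apply mul_left_cancel₀ hcu
        linear_combination hx.2
    · have := card_le_card (filter_subset_filter (fun u => bev (1 - k) c u = 0) (subset_univ E))
      omega
  · set V := (U.filter fun x => F.e x ∈ zeros v (F.cone 1 a b)).filter fun x => x.1 ∉ E with hV
    have hVon : ∀ x ∈ V, OnCurve k A B x := fun x hx => (h.onCurve_of_mem hx).1
    have hdisj : Disjoint (V.image Prod.fst) (E.filter fun u => bev 1 a u = 0 ∧ bev 2 b u = 0) := by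
      rw [disjoint_left]
      intro u hu hu'
      obtain ⟨x, hx, rfl⟩ := mem_image.1 hu
      exact (mem_filter.1 hx).2 (mem_filter.1 hu').1
    have hD : V.card + (E.filter fun u => bev 1 a u = 0 ∧ bev 2 b u = 0).card ≤ k + 2 := by
      by_contra! hlt
      refine hab (hc.eq_of_bev (l := 1) ha hb (D := V.image Prod.fst ∪
        E.filter fun u => bev 1 a u = 0 ∧ bev 2 b u = 0) ?_ ?_)
      · rw [card_union_of_disjoint hdisj, card_image_of_injOn (hc.injOn_fst hVon)]
        omega
      · intro u hu
        rcases mem_union.1 hu with hu | hu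
        · obtain ⟨⟨u, z⟩, hx, rfl⟩ := mem_image.1 hu
          obtain ⟨e1, e2⟩ := h.onCurve_of_mem hx
          rw [hz] at e2
          simp only [OnCurve] at e1 ⊢
          linear_combination bev 1 a u * e1 - bev k A u * e2
        · rw [mem_filter] at hu
          simp [hu.2]
    refine (card_filter_le_add U E _ (m := V.card)
      (n := E.card + (E.filter fun u => bev 1 a u = 0 ∧ bev 2 b u = 0).card) le_rfl ?_).trans
      (by omega)
    rw [card_filter, card_eq_sum_ones, ← sum_add_distrib]
    refine Finset.sum_le_sum fun u hu => ?_
    split_ifs with hcu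
    · exact h.card_filter_fibre_le _ hu
    · rw [card_le_one]
      rintro ⟨w, z⟩ hx ⟨w', z'⟩ hy
      simp only [mem_filter, hz] at hx hy
      obtain ⟨⟨-, hx⟩, rfl⟩ := hx
      obtain ⟨⟨-, hy⟩, rfl⟩ := hy
      have ha' : bev 1 a w' ≠ 0 := fun h0 => hcu ⟨h0, by simpa [h0] using hx⟩
      rw [mul_right_cancel₀ ha' (show z * bev 1 a w' = z' * bev 1 a w' by
        linear_combination hx - hy)]

/-- `R` is the resultant of the two equations in the height, a binary form of degree `2 k + 2`; if
it is nonzero the bound is `2 k + 2 + 2 (2 - k) = 6`. -/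
lemma card_conic_le_of_notMem (h : Adm k A B E U) (hc : Cop k A B)
    {a b : Polynomial K} (ha : a.natDegree ≤ 1) (hb : b.natDegree ≤ 2)
    (P : Option K × K → Prop) [DecidablePred P]
    (hP : ∀ u z, P (u, z) → z ^ 2 + z * bev 1 a u + bev 2 b u = 0) :
    (U.filter P).card ≤ 6 := by
  have hE := h.card_add
  have hA := hc.natDegree_left
  have hB := hc.natDegree_right
  set R := B * B - a * (A * B) + b * (A * A) with hR
  have hdA : (A * A).natDegree ≤ k + k := Polynomial.natDegree_mul_le.trans (by omega)
  have hdAB : (A * B).natDegree ≤ k + (k + 1) := Polynomial.natDegree_mul_le.trans (by omega)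
  have hRbev : ∀ u, bev (2 * k + 2) R u = bev (k + 1) B u * bev (k + 1) B u -
      bev 1 a u * (bev k A u * bev (k + 1) B u) + bev 2 b u * (bev k A u * bev k A u) := by
    intro u
    rw [hR, bev_add, bev_sub]
    congr 1
    · congr 1
      · rw [show 2 * k + 2 = (k + 1) + (k + 1) by ring, bev_mul hB hB]
      · rw [show 2 * k + 2 = 1 + (k + (k + 1)) by ring, bev_mul ha hdAB, bev_mul hA hB]
    · rw [show 2 * k + 2 = 2 + (k + k) by ring, bev_mul hb hdA, bev_mul hA hA]
  have hRd : R.natDegree ≤ 2 * k + 2 := by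
    refine (Polynomial.natDegree_add_le _ _).trans (max_le ((Polynomial.natDegree_sub_le _ _).trans
      (max_le ?_ ?_)) ?_) <;> exact Polynomial.natDegree_mul_le.trans (by omega)
  by_cases hR0 : R = 0
  -- If `R = 0` then `A` divides `B²`, so by coprimality it has no zeros, even at infinity; the
  -- curve is a line contained in the conic.
  · have hk : k = 0 := by
      by_contra hk
      have hdvd : A ∣ B * B := ⟨a * B - b * A, by linear_combination hR0⟩
      have hu : IsUnit A := hc.coprime.isUnit_of_dvd' dvd_rfl
        (hc.coprime.dvd_of_dvd_mul_right hdvd)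
      have hA0 : bev k A none = 0 :=
        Polynomial.coeff_eq_zero_of_natDegree_lt (by
          rw [Polynomial.natDegree_eq_zero_of_isUnit hu]; omega)
      have := hRbev none
      rw [hR0, bev_zero, hA0] at this
      have hB0 : bev (k + 1) B none * bev (k + 1) B none = 0 := by linear_combination -this
      exact hc.bev_ne_zero hA0 (mul_self_eq_zero.1 hB0)
    subst hk
    refine (card_filter_le_add U E _ (h.card_filter_on_le _) (n := E.card) ?_).trans (by omega)
    rw [card_eq_sum_ones]
    refine Finset.sum_le_sum fun u hu => ?_
    rw [card_le_one]
    rintro ⟨w, z⟩ hx ⟨w', z'⟩ hy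
    simp only [mem_filter] at hx hy
    obtain ⟨⟨hxU, hx⟩, rfl⟩ := hx
    obtain ⟨⟨hyU, hy⟩, rfl⟩ := hy
    have e1 := hP _ _ hx
    have e2 := hP _ _ hy
    by_contra hne
    have hzz : z - z' ≠ 0 := fun h0 => hne (by rw [sub_eq_zero.1 h0])
    have e3 : z + z' + bev 1 a w' = 0 := by
      apply mul_left_cancel₀ hzz
      linear_combination e1 - e2
    have e4 := hRbev w'
    rw [hR0, bev_zero] at e4
    -- `z` and `z'` are the two roots of the conic in this direction, so the product of the values
    -- of the line at them is the resultant. One of the two points would lie on the line, against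
    -- `off`.
    have e5 : (z * bev 0 A w' + bev 1 B w') * (z' * bev 0 A w' + bev 1 B w') = 0 := by
      linear_combination -e4 + (bev 0 A w' * bev 1 B w' + z * bev 0 A w' ^ 2) * e3 -
        bev 0 A w' ^ 2 * e1
    rcases mul_eq_zero.1 e5 with e | e
    · exact h.off _ hxU hu e
    · exact h.off _ hyU hu e
  · refine (card_filter_le_add U E _ (m := 2 * k + 2) (n := E.card * 2) ?_ ?_).trans (by omega)
    · by_contra! hlt
      refine hR0 (eq_zero_of_bev_eq_zero hRd (D := ((U.filter P).filter
        fun x => x.1 ∉ E).image Prod.fst) ?_ ?_)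
      · rwa [card_image_of_injOn (hc.injOn_fst fun x hx => (h.onCurve_of_mem hx).1)]
      · intro u hu
        obtain ⟨⟨u, z⟩, hx, rfl⟩ := mem_image.1 hu
        obtain ⟨e1, e2⟩ := h.onCurve_of_mem hx
        have e3 := hP _ _ e2
        simp only [OnCurve] at e1
        rw [hRbev]
        simp only
        linear_combination (bev (k + 1) B u - z * bev k A u - bev 1 a u * bev k A u) * e1 +
          bev k A u ^ 2 * e3
    · exact Finset.sum_le_card_nsmul _ _ _ fun u hu => h.card_filter_fibre_le _ hu

end Adm

namespace Frame

variable (F : Frame v p)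

/-- The point `p` together with the points with coordinates in `U`. -/
def pts (U : Finset (Option K × K)) : Finset ι := insert p (U.image F.e)

lemma mem_pts {U : Finset (Option K × K)} {x : Option K × K} : F.e x ∈ F.pts U ↔ x ∈ U := by
  rw [pts, mem_insert, mem_image]
  constructor
  · rintro (h | ⟨y, hy, h⟩)
    · exact absurd h (F.ne x)
    · rwa [← F.inj h]
  · exact fun h => Or.inr ⟨x, h, rfl⟩

lemma self_mem_pts (U : Finset (Option K × K)) : p ∈ F.pts U := mem_insert_self _ _

lemma pts_injective : Function.Injective F.pts := fun U U' h => by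
  ext x
  rw [← F.mem_pts, h, F.mem_pts]

lemma exists_eq_pts {T : Finset ι} (hp : p ∈ T) : ∃ U, T = F.pts U := by
  refine ⟨univ.filter fun x => F.e x ∈ T, ?_⟩
  ext i
  by_cases hi : i = p
  · subst hi
    simp [hp, F.self_mem_pts]
  · obtain ⟨x, rfl⟩ := F.surj i hi
    simp [F.mem_pts]

lemma card_pts_inter (U : Finset (Option K × K)) (Z : Finset ι) :
    (F.pts U ∩ Z).card = (U.filter fun x => F.e x ∈ Z).card + if p ∈ Z then 1 else 0 := by
  have h1 : (F.pts U ∩ Z).erase p = (U.filter fun x => F.e x ∈ Z).image F.e := by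
    ext i
    by_cases hi : i = p
    · subst hi
      simp [F.ne]
    · obtain ⟨x, rfl⟩ := F.surj i hi
      rw [mem_erase, mem_inter, F.mem_pts, F.inj.mem_finset_image, mem_filter]
      simp [hi]
  rw [← card_image_of_injective _ F.inj, ← h1]
  split_ifs with hp
  · rw [card_erase_add_one (mem_inter.2 ⟨F.self_mem_pts U, hp⟩)]
  · rw [erase_eq_of_notMem (fun h => hp (mem_inter.1 h).2), add_zero]

lemma card_pts (U : Finset (Option K × K)) : (F.pts U).card = U.card + 1 := by
  simpa using F.card_pts_inter U univ

end Frame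

/-- The bounds 3 for lines and 6 for conics are those just proved, with `p` added where the line or
conic passes through it. -/
lemma Adm.goodEight {k : ℕ} {A B : Polynomial K} {E : Finset (Option K)}
    {U : Finset (Option K × K)} (h : Adm k A B E U) (hc : Cop k A B) (hv : PlaneReps v)
    (F : Frame v p) : F.pts U ∈ goodEight v := by
  refine mem_goodEight.2 ⟨by rw [F.card_pts, h.card_eq], fun j => ?_, fun f hf0 hf => ?_⟩
  · have := h.card_line_le hc F hv j
    rw [F.card_pts_inter]
    split_ifs at * <;> omega
  · rw [F.card_pts_inter]
    split_ifs with hp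
    · obtain ⟨a, b, ha, hb, rfl⟩ := F.exists_cone_conic hf (mem_zeros.1 hp)
      have := h.card_conic_le_of_mem hc F ha hb (by
        by_contra! hab
        rw [hab.1, hab.2, F.cone_zero] at hf0
        exact hf0 rfl)
      omega
    · obtain ⟨a, b, ha, hb, hz⟩ := F.exists_conic_eq hf (fun h0 => hp (mem_zeros.2 h0))
      exact h.card_conic_le_of_notMem hc ha hb _ hz

end SingularCubics

/-! ### Parametrising the configurations with a singular cubic -/

section SingularCount

variable {K ι : Type*} [Field K] [Fintype K] [Fintype ι] {v : ι → Fin 3 → K} {p : ι}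

lemma natDegree_prod_rootForm (E : Finset (Option K)) :
    (∏ u ∈ E, rootForm u).natDegree ≤ E.card := by
  refine (Polynomial.natDegree_prod_le _ _).trans ?_
  rw [card_eq_sum_ones]
  exact Finset.sum_le_sum fun u _ => natDegree_rootForm u

lemma bev_prod_rootForm {E : Finset (Option K)} {u : Option K} (hu : u ∈ E) :
    bev E.card (∏ u ∈ E, rootForm u) u = 0 := by
  rw [← mul_prod_erase _ _ hu, ← card_erase_add_one hu, add_comm,
    bev_mul (natDegree_rootForm u) (natDegree_prod_rootForm _), bev_rootForm.2 rfl, zero_mul]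

/-- Eight points in general position containing `p` and lying on a cubic singular at `p`. -/
def singularFam (v : ι → Fin 3 → K) (p : ι) : Finset (Finset ι) :=
  (goodEight v).filter fun T => p ∈ T ∧ ∃ f ∈ vanishing v 3 T, f ≠ 0 ∧ SingularAt v p f

/-- The singular cubic is the curve together with the lines through `p` in the directions of `E`. -/
lemma Adm.mem_singularFam {k : ℕ} {A B : Polynomial K} {E : Finset (Option K)}
    {U : Finset (Option K × K)} (h : Adm k A B E U) (hc : Cop k A B) (hv : PlaneReps v)
    (hq : 2 < Fintype.card K) (F : Frame v p) : F.pts U ∈ singularFam v p := by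
  have hE := h.card_add
  set g : Polynomial K := ∏ u ∈ E, rootForm u with hg
  have hgd : g.natDegree ≤ E.card := natDegree_prod_rootForm E
  have hg0 : g ≠ 0 := prod_ne_zero_iff.2 fun u _ => rootForm_ne_zero u
  have hA := hc.natDegree_left
  have hB := hc.natDegree_right
  have hA' : (g * A).natDegree ≤ 2 := Polynomial.natDegree_mul_le.trans (by omega)
  have hB' : (g * B).natDegree ≤ 3 := Polynomial.natDegree_mul_le.trans (by omega)
  have eA : ∀ u, bev 2 (g * A) u = bev E.card g u * bev k A u := fun u => by
    rw [← bev_mul hgd hA, hE]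
  have eB : ∀ u, bev 3 (g * B) u = bev E.card g u * bev (k + 1) B u := fun u => by
    rw [← bev_mul hgd hB, ← add_assoc, hE]
  refine mem_filter.2 ⟨h.goodEight hc hv F, F.self_mem_pts U, F.cone 2 (g * A) (g * B),
    mem_vanishing.2 ⟨F.cone_isHomogeneous _ _ _, fun i hi => ?_⟩,
    F.cone_ne_zero (by omega) hA' hB' (Or.inl (mul_ne_zero hg0 hc.ne_zero)), F.singularAt_cone _ _⟩
  rw [← mem_zeros]
  by_cases hip : i = p
  · rw [hip]; exact F.point_mem_zeros_cone two_ne_zero _ _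
  · obtain ⟨⟨u, z⟩, rfl⟩ := F.surj i hip
    rw [F.mem_pts] at hi
    rw [F.mem_zeros_cone hA' hB', eA, eB]
    by_cases hu : u ∈ E
    · rw [hg, bev_prod_rootForm hu]; ring
    · have := h.on _ hi hu
      simp only [OnCurve] at this
      linear_combination bev E.card g u * this

lemma Frame.card_fibre_le_two (F : Frame v p) (hv : PlaneReps v) {U : Finset (Option K × K)}
    (h4 : NoFour v (F.pts U)) (u : Option K) : (U.filter fun x => x.1 = u).card ≤ 2 := by
  obtain ⟨j, hp, hj⟩ := F.exists_line_fibre hv u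
  have := h4 j
  rw [F.card_pts_inter, if_pos hp] at this
  rw [show (U.filter fun x => x.1 = u) = U.filter fun x => F.e x ∈ line v j from
    filter_congr fun x _ => (hj x.1 x.2).symm]
  omega

/-- The residual curve is a line, a conic through `p` or a cubic for `k = 0, 1, 2`: at most 3
points, 6 minus the point `p`, or all 7. -/
lemma Frame.card_onCurve_le (F : Frame v p) (hv : PlaneReps v) (hq : 2 < Fintype.card K)
    {U : Finset (Option K × K)} (hU : F.pts U ∈ goodEight v) {k : ℕ} (hk : k ≤ 2)
    {A B : Polynomial K} (hc : Cop k A B) :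
    (U.filter fun x => OnCurve k A B x).card ≤ 2 * k + 3 := by
  obtain ⟨h8, h4, h7⟩ := mem_goodEight.1 hU
  have hz : (U.filter fun x => OnCurve k A B x) =
      U.filter fun x => F.e x ∈ zeros v (F.cone k A B) :=
    filter_congr fun x _ => (F.mem_zeros_cone hc.natDegree_left hc.natDegree_right).symm
  have h0 := F.cone_ne_zero (by omega) hc.natDegree_left hc.natDegree_right (Or.inl hc.ne_zero)
  interval_cases k
  · obtain ⟨j, hj⟩ := exists_line_of_isHomogeneous_one hv (F.cone_isHomogeneous 0 A B) h0
    have := h4 j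
    rw [F.card_pts_inter] at this
    rw [hz, hj]
    omega
  · have := h7 _ h0 (F.cone_isHomogeneous 1 A B)
    rw [F.card_pts_inter, if_pos (F.point_mem_zeros_cone one_ne_zero A B)] at this
    rw [hz]
    omega
  · rw [F.card_pts] at h8
    have := card_filter_le U fun x => OnCurve 2 A B x
    omega

/-- With `A = 0` the cubic would consist of at most three rational lines through `p`, holding at
most six further points. So the gcd splits off, and the bounds `2 k + 3` on the curve and 2 in each
of at most `2 - k` directions add up to exactly 7. -/
lemma exists_adm (hv : PlaneReps v) (hq : 2 < Fintype.card K) (F : Frame v p)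
    {U : Finset (Option K × K)} (hU : F.pts U ∈ singularFam v p) :
    ∃ k ≤ 2, ∃ A B E, Cop k A B ∧ Adm k A B E U := by
  obtain ⟨hgood, -, f, hf, hf0, hs⟩ := mem_filter.1 hU
  obtain ⟨h8, h4, h7⟩ := mem_goodEight.1 hgood
  rw [F.card_pts] at h8
  have hfib := F.card_fibre_le_two hv h4
  obtain ⟨A, B, hA, hB, rfl⟩ := F.exists_cone_of_singularAt hs
  have hon : ∀ x ∈ U, OnCurve 2 A B x := fun x hx => by
    rw [← F.mem_pts] at hx
    exact (F.mem_zeros_cone hA hB).1 (mem_zeros.2 ((mem_vanishing.1 hf).2 _ hx))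
  have hA0 : A ≠ 0 := by
    rintro rfl
    have hB0 : B ≠ 0 := by
      rintro rfl
      rw [F.cone_zero] at hf0
      exact hf0 rfl
    have h1 := card_bev_zeros_le hB hB0
    have h2 := card_filter_split U (univ.filter fun u => bev 3 B u = 0)
    rw [card_eq_zero.2 (filter_eq_empty_iff.2 fun x hx => by
      have := hon x hx
      rw [OnCurve, bev_zero, mul_zero, zero_add] at this
      simpa using this)] at h2
    have h3 := Finset.sum_le_card_nsmul (univ.filter fun u => bev 3 B u = 0) _ 2 fun u _ => hfib u
    rw [smul_eq_mul] at h3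
    omega
  obtain ⟨k, hk, g, A, B, hg0, hg, hc, rfl, rfl⟩ := exists_cop hA0 hA hB
  have hV := F.card_onCurve_le hv hq hgood hk hc
  have hE := card_bev_zeros_le hg hg0
  set E := univ.filter fun u => bev (2 - k) g u = 0 with hEdef
  set V := U.filter fun x => OnCurve k A B x with hVdef
  set V' := U.filter fun x => ¬ OnCurve k A B x with hV'def
  have hVV' : V.card + V'.card = U.card := card_filter_add_card_filter_not _
  have hmem : ∀ x ∈ U, x.1 ∉ E → OnCurve k A B x := by
    intro x hx hxE
    have h1 := hon x hx
    have eA := bev_mul hg hc.natDegree_left x.1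
    have eB := bev_mul hg hc.natDegree_right x.1
    rw [Nat.sub_add_cancel hk] at eA
    rw [← add_assoc, Nat.sub_add_cancel hk] at eB
    rw [OnCurve, eA, eB] at h1
    have hgx : bev (2 - k) g x.1 ≠ 0 := by simpa [hEdef] using hxE
    apply mul_left_cancel₀ hgx
    linear_combination h1
  have hsplit := card_filter_split V' E
  have hempty : (V'.filter fun x => x.1 ∉ E) = ∅ := filter_eq_empty_iff.2 fun x hx hxE =>
    (mem_filter.1 hx).2 (hmem x (mem_filter.1 hx).1 hxE)
  rw [hempty, card_empty, zero_add] at hsplit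
  have hle : ∀ u, (V'.filter fun x => x.1 = u).card ≤ (U.filter fun x => x.1 = u).card := fun u =>
    card_le_card (filter_subset_filter _ (filter_subset _ _))
  have hsum := Finset.sum_le_card_nsmul E _ 2 fun u _ => (hle u).trans (hfib u)
  rw [smul_eq_mul] at hsum
  -- All inequalities are forced to be equalities; in particular the common factor has `2 - k`
  -- distinct rational zeros.
  have hEc : E.card + k = 2 := by omega
  have heq : ∀ u ∈ E, (V'.filter fun x => x.1 = u).card = 2 := by
    refine (Finset.sum_eq_sum_iff_of_le fun u _ => (hle u).trans (hfib u)).1 ?_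
    rw [sum_const, smul_eq_mul]
    omega
  have hoff : ∀ x ∈ U, x.1 ∈ E → ¬ OnCurve k A B x := by
    intro x hx hxE
    have h1 := eq_of_subset_of_card_le (filter_subset_filter (fun y => y.1 = x.1)
      (filter_subset _ _ : V' ⊆ U)) ((hfib x.1).trans (heq x.1 hxE).ge)
    have h2 : x ∈ V'.filter fun y => y.1 = x.1 := h1 ▸ mem_filter.2 ⟨hx, rfl⟩
    exact (mem_filter.1 (mem_filter.1 h2).1).2
  refine ⟨k, hk, A, B, E, hc, hmem, hoff, fun u hu => le_antisymm (hfib u) ((heq u hu).ge.trans (hle u)),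
    ?_, hEc⟩
  rw [show (U.filter fun x => x.1 ∉ E) = V from filter_congr fun x hx =>
    ⟨hmem x hx, fun ho hxE => hoff x hx hxE ho⟩]
  omega

/-- The configurations of seven points other than `p` attached to coprime pairs of degree `k`. -/
def admSet (K : Type*) [Field K] [Fintype K] (k : ℕ) : Finset (Finset (Option K × K)) :=
  univ.filter fun U => ∃ A B E, Cop k A B ∧ Adm k A B E U

/-- The three values of `k` do not overlap, because `k` is determined by the number of directions
carrying two points. -/
lemma card_singularFam (hv : PlaneReps v) (hq : 2 < Fintype.card K) (p : ι) :
    (singularFam v p).card = ∑ k ∈ range 3, (admSet K k).card := by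
  obtain ⟨F⟩ := exists_frame hv p
  have h1 : singularFam v p = ((range 3).biUnion fun k => admSet K k).image F.pts := by
    ext T
    rw [mem_image]
    constructor
    · intro hT
      obtain ⟨U, rfl⟩ := F.exists_eq_pts (mem_filter.1 hT).2.1
      obtain ⟨k, hk, h⟩ := exists_adm hv hq F hT
      exact ⟨U, mem_biUnion.2 ⟨k, mem_range.2 (by omega), mem_filter.2 ⟨mem_univ _, h⟩⟩, rfl⟩
    · rintro ⟨U, hU, rfl⟩
      obtain ⟨k, -, hU⟩ := mem_biUnion.1 hU
      obtain ⟨A, B, E, hc, h⟩ := (mem_filter.1 hU).2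
      exact h.mem_singularFam hc hv hq F
  rw [h1, card_image_of_injective _ F.pts_injective, card_biUnion]
  intro k _ k' _ hkk
  rw [Function.onFun, disjoint_left]
  intro U hU hU'
  obtain ⟨A, B, E, hc, h⟩ := (mem_filter.1 hU).2
  obtain ⟨A', B', E', hc', h'⟩ := (mem_filter.1 hU').2
  have e1 := h.card_add
  have e2 := h'.card_add
  rw [h.directions_eq hc] at e1
  rw [h'.directions_eq hc'] at e2
  omega

/-- A configuration determines `E`, and the coprime pair up to one of the `q - 1` nonzero scalars.
-/
lemma card_admSet_mul (k : ℕ) :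
    (admSet K k).card * (Fintype.card K - 1) =
      ∑ x ∈ copSet K k, ∑ E ∈ powersetCard (2 - k) univ,
        (univ.filter fun U => Adm k x.1 x.2 E U).card := by
  have h := sum_card_bipartiteAbove_eq_sum_card_bipartiteBelow (s := admSet K k) (t := copSet K k)
    (fun U x => ∃ E, Adm k x.1 x.2 E U)
  rw [Finset.sum_congr rfl (g := fun _ => Fintype.card K - 1), sum_const, smul_eq_mul] at h
  · rw [h]
    refine Finset.sum_congr rfl fun x hx => ?_
    rw [mem_copSet] at hx
    rw [← card_biUnion]
    · congr 1
      ext U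
      simp only [mem_bipartiteBelow, mem_biUnion, mem_powersetCard, mem_filter, mem_univ, true_and,
        subset_univ, admSet]
      constructor
      · rintro ⟨-, E, hE⟩
        have := hE.card_add
        exact ⟨E, by omega, hE⟩
      · rintro ⟨E, -, hE⟩
        exact ⟨⟨_, _, E, hx, hE⟩, E, hE⟩
    · intro E _ E' _ hEE
      rw [Function.onFun, disjoint_left]
      intro U hU hU'
      exact hEE (((mem_filter.1 hU).2.directions_eq hx).trans
        ((mem_filter.1 hU').2.directions_eq hx).symm)
  · intro U hU
    obtain ⟨A, B, E, hc, hadm⟩ := (mem_filter.1 hU).2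
    have : (copSet K k).bipartiteAbove (fun U x => ∃ E, Adm k x.1 x.2 E U) U =
        (univ.erase (0 : K)).image fun c => (Polynomial.C c * A, Polynomial.C c * B) := by
      ext ⟨A', B'⟩
      simp only [mem_bipartiteAbove, mem_copSet, mem_image, mem_erase, mem_univ, and_true,
        Prod.mk.injEq]
      constructor
      · rintro ⟨hc', E', hadm'⟩
        obtain rfl : E' = E := (hadm'.directions_eq hc').trans (hadm.directions_eq hc).symm
        obtain ⟨c, h0, rfl, rfl⟩ := hadm.exists_C_mul hc hadm' hc'
        exact ⟨c, h0, rfl, rfl⟩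
      · rintro ⟨c, h0, rfl, rfl⟩
        exact ⟨hc.C_mul h0, E, hadm.C_mul h0⟩
    rw [this, card_image_of_injective, card_erase_of_mem (mem_univ _), card_univ]
    intro c c' hcc
    simp only [Prod.mk.injEq] at hcc
    exact Polynomial.C_injective (mul_right_cancel₀ hc.ne_zero hcc.1)

end SingularCount

/-! ### Counting configurations by the degree of the residual curve -/

section CountAdm

variable {K : Type*} [Field K] [Fintype K] {k : ℕ} {A B : Polynomial K} {E : Finset (Option K)}
  {U : Finset (Option K × K)}

/-- The points of the curve in directions outside `E`. -/
def onSet (k : ℕ) (A B : Polynomial K) (E : Finset (Option K)) : Finset (Option K × K) :=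
  univ.filter fun x => OnCurve k A B x ∧ x.1 ∉ E

/-- The points off the curve in direction `u`. -/
def offSet (k : ℕ) (A B : Polynomial K) (u : Option K) : Finset (Option K × K) :=
  univ.filter fun x => ¬ OnCurve k A B x ∧ x.1 = u

lemma mem_onSet {x : Option K × K} : x ∈ onSet k A B E ↔ OnCurve k A B x ∧ x.1 ∉ E := by
  simp [onSet]

lemma mem_offSet {u : Option K} {x : Option K × K} :
    x ∈ offSet k A B u ↔ ¬ OnCurve k A B x ∧ x.1 = u := by
  simp [offSet]

lemma Cop.card_onSet (h : Cop k A B) (E : Finset (Option K)) :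
    (onSet k A B E).card = (univ.filter fun u => bev k A u ≠ 0 ∧ u ∉ E).card := by
  rw [← card_image_of_injOn (f := Prod.fst) (h.injOn_fst fun x hx => (mem_onSet.1 hx).1)]
  congr 1
  ext u
  simp only [mem_image, mem_onSet, mem_filter, mem_univ, true_and]
  constructor
  · rintro ⟨x, ⟨hx, hE⟩, rfl⟩
    exact ⟨fun h0 => h.bev_ne_zero h0 (by rwa [OnCurve, h0, mul_zero, zero_add] at hx), hE⟩
  · rintro ⟨h0, hE⟩
    obtain ⟨z, hz⟩ := exists_fibre (B := B) h0
    exact ⟨(u, z), ⟨hz, hE⟩, rfl⟩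

lemma Cop.card_offSet (h : Cop k A B) (u : Option K) :
    (offSet k A B u).card = Fintype.card K - if bev k A u ≠ 0 then 1 else 0 := by
  have h1 : (offSet k A B u).card = (univ.filter fun z : K => ¬ OnCurve k A B (u, z)).card := by
    rw [← card_image_of_injective (univ.filter fun z : K => ¬ OnCurve k A B (u, z))
      (Prod.mk_right_injective u)]
    congr 1
    ext ⟨w, z⟩
    simp only [mem_offSet, mem_image, mem_filter, mem_univ, true_and, Prod.mk.injEq]
    constructor
    · rintro ⟨hz, rfl⟩; exact ⟨z, hz, rfl, rfl⟩
    · rintro ⟨z, hz, rfl, rfl⟩; exact ⟨hz, rfl⟩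
  have h2 : (univ.filter fun z : K => OnCurve k A B (u, z)).card =
      if bev k A u ≠ 0 then 1 else 0 := by
    split_ifs with h0
    · obtain ⟨z, hz⟩ := exists_fibre (B := B) h0
      refine card_eq_one.2 ⟨z, eq_singleton_iff_unique_mem.2 ⟨mem_filter.2 ⟨mem_univ z, hz⟩, ?_⟩⟩
      intro z' hz'
      exact h.unique_fibre (mem_filter.1 hz').2 hz
    · rw [not_not] at h0
      refine card_eq_zero.2 (filter_eq_empty_iff.2 fun z _ hz => h.bev_ne_zero h0 ?_)
      rwa [OnCurve, h0, mul_zero, zero_add] at hz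
  have h3 := card_filter_add_card_filter_not (s := (univ : Finset K)) fun z => OnCurve k A B (u, z)
  rw [card_univ] at h3
  omega

lemma adm_iff : Adm k A B E U ↔ U ⊆ E.biUnion (offSet k A B) ∪ onSet k A B E ∧
    (∀ u ∈ E, (U ∩ offSet k A B u).card = 2) ∧ (U ∩ onSet k A B E).card = 2 * k + 3 ∧
    E.card + k = 2 := by
  have key : U ⊆ E.biUnion (offSet k A B) ∪ onSet k A B E →
      (∀ u ∈ E, U ∩ offSet k A B u = U.filter fun x => x.1 = u) ∧
      U ∩ onSet k A B E = U.filter fun x => x.1 ∉ E := by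
    intro hU
    have hU' : ∀ x ∈ U, (x.1 ∈ E ∧ ¬ OnCurve k A B x) ∨ (OnCurve k A B x ∧ x.1 ∉ E) := by
      intro x hx
      have := hU hx
      simp only [mem_union, mem_biUnion, mem_offSet, mem_onSet] at this
      obtain ⟨u, hu, h, rfl⟩ | h := this
      · exact Or.inl ⟨hu, h⟩
      · exact Or.inr h
    constructor
    · intro u hu
      ext x
      simp only [mem_inter, mem_offSet, mem_filter, and_congr_right_iff]
      intro hx
      refine ⟨fun h => h.2, ?_⟩
      rintro rfl
      exact ⟨((hU' x hx).resolve_right fun h => h.2 hu).2, rfl⟩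
    · ext x
      simp only [mem_inter, mem_onSet, mem_filter, and_congr_right_iff]
      intro hx
      exact ⟨fun h => h.2, fun h => (hU' x hx).resolve_left fun h' => h h'.1⟩
  constructor
  · intro h
    have hU : U ⊆ E.biUnion (offSet k A B) ∪ onSet k A B E := by
      intro x hx
      simp only [mem_union, mem_biUnion, mem_offSet, mem_onSet]
      by_cases hE : x.1 ∈ E
      · exact Or.inl ⟨_, hE, h.off x hx hE, rfl⟩
      · exact Or.inr ⟨h.on x hx hE, hE⟩
    refine ⟨hU, fun u hu => ?_, ?_, h.card_add⟩
    · rw [(key hU).1 u hu, h.two u hu]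
    · rw [(key hU).2, h.card_on]
  · rintro ⟨hU, h2, h3, h4⟩
    refine ⟨fun x hx hE => ?_, fun x hx hE ho => ?_, fun u hu => ?_, ?_, h4⟩
    · have := hU hx
      simp only [mem_union, mem_biUnion, mem_offSet, mem_onSet] at this
      obtain ⟨u, hu, -, rfl⟩ | h := this
      · exact absurd hu hE
      · exact h.1
    · have := hU hx
      simp only [mem_union, mem_biUnion, mem_offSet, mem_onSet] at this
      obtain ⟨u, hu, h, rfl⟩ | h := this
      · exact h ho
      · exact h.2 hE
    · rw [← (key hU).1 u hu, h2 u hu]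
    · rw [← (key hU).2, h3]

lemma disjoint_offSet_onSet {u : Option K} :
    Disjoint (offSet k A B u) (onSet k A B E) := by
  rw [disjoint_left]
  intro x hx hx'
  exact (mem_offSet.1 hx).1 (mem_onSet.1 hx').1

lemma disjoint_offSet {u u' : Option K} (hu : u ≠ u') :
    Disjoint (offSet k A B u) (offSet k A B u') := by
  rw [disjoint_left]
  intro x hx hx'
  exact hu ((mem_offSet.1 hx).2.symm.trans (mem_offSet.1 hx').2)

/-- An irreducible cubic has one further point in each direction that is not a zero of `A`, and all
seven points lie on it. -/
lemma card_adm_two (h : Cop 2 A B) :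
    ∑ E ∈ powersetCard (2 - 2) univ, (univ.filter fun U => Adm 2 A B E U).card =
      (Fintype.card K + 1 - rootCount 2 A).choose 7 := by
  have h1 := card_filter_add_card_filter_not (s := (univ : Finset (Option K))) fun u => bev 2 A u = 0
  rw [card_univ_option] at h1
  have h2 := h.card_onSet ∅
  simp only [notMem_empty, not_false_eq_true, and_true] at h2
  rw [Nat.sub_self, powersetCard_zero, sum_singleton,
    show Fintype.card K + 1 - rootCount 2 A = (onSet 2 A B ∅).card by
      rw [h2, rootCount]; simp only [ne_eq]; omega, ← card_powersetCard]
  congr 1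
  ext U
  rw [mem_filter, adm_iff, mem_powersetCard]
  simp only [mem_univ, true_and, biUnion_empty, empty_union, notMem_empty, card_empty, zero_add,
    false_imp_iff, implies_true, and_true, and_congr_right_iff]
  intro hU
  rw [inter_eq_left.2 hU]

/-- The direction of the line may be the tangent `w` of the conic, with `q` points off the conic and
`q` left on it, or one of the `q` secants, with `q - 1` of each. -/
lemma card_adm_one (h : Cop 1 A B) :
    ∑ E ∈ powersetCard (2 - 1) univ, (univ.filter fun U => Adm 1 A B E U).card =
      (Fintype.card K).choose 2 * (Fintype.card K).choose 5 +
      Fintype.card K * ((Fintype.card K - 1).choose 2 * (Fintype.card K - 1).choose 5) := by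
  obtain ⟨w, hw⟩ := exists_unique_bev h.natDegree_left h.ne_zero
  have hw' : ∀ u, bev 1 A u = 0 ↔ u = w := fun u => by
    simpa using Finset.ext_iff.1 hw u
  have key : ∀ u, (univ.filter fun U => Adm 1 A B {u} U).card =
      (offSet 1 A B u).card.choose 2 * (onSet 1 A B {u}).card.choose 5 := by
    intro u
    rw [← card_subsets_two _ _ disjoint_offSet_onSet]
    congr 1
    ext U
    simp only [mem_filter, mem_univ, true_and, adm_iff, singleton_biUnion, mem_singleton,
      forall_eq, card_singleton, Nat.reduceMul, Nat.reduceAdd, and_true]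
    convert Iff.rfl
  have hon : ∀ u, (onSet 1 A B {u}).card = ((univ.erase w).erase u).card := by
    intro u
    rw [h.card_onSet]
    congr 1
    ext x
    simp only [mem_filter, mem_univ, true_and, mem_singleton, ne_eq, hw', mem_erase, and_true]
    tauto
  have hcw : (univ.erase w).card = Fintype.card K := by
    rw [card_erase_of_mem (mem_univ w), card_univ_option, Nat.add_sub_cancel]
  rw [show 2 - 1 = 1 from rfl, powersetCard_one, sum_map, ← add_sum_erase _ _ (mem_univ w)]
  congr 1
  · rw [Function.Embedding.coeFn_mk, key, h.card_offSet, if_neg (by simp [hw']), hon,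
      erase_eq_of_notMem (notMem_erase _ _), hcw, Nat.sub_zero]
  · rw [Finset.sum_congr rfl (g := fun _ =>
      (Fintype.card K - 1).choose 2 * (Fintype.card K - 1).choose 5), sum_const, hcw, smul_eq_mul]
    intro u hu
    rw [Function.Embedding.coeFn_mk, key, h.card_offSet,
      if_pos (by rw [Ne, hw']; exact ne_of_mem_erase hu), hon, card_erase_of_mem hu, hcw]

/-- Three lines, two of them through `p`: two points on each of these off the third line, and three
points of the third line off these. -/
lemma card_adm_zero (h : Cop 0 A B) :
    ∑ E ∈ powersetCard (2 - 0) univ, (univ.filter fun U => Adm 0 A B E U).card =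
      (Fintype.card K + 1).choose 2 * ((Fintype.card K - 1).choose 2 *
        ((Fintype.card K - 1).choose 2 * (Fintype.card K - 1).choose 3)) := by
  rw [Finset.sum_congr rfl (g := fun _ => (Fintype.card K - 1).choose 2 *
    ((Fintype.card K - 1).choose 2 * (Fintype.card K - 1).choose 3)), sum_const, card_powersetCard,
    card_univ_option, smul_eq_mul]
  intro E hE
  obtain ⟨u, u', hne, rfl⟩ := card_eq_two.1 (mem_powersetCard.1 hE).2
  have hoff : ∀ u, (offSet 0 A B u).card = Fintype.card K - 1 := fun u => by
    rw [h.card_offSet, if_pos (h.bev_zero_ne_zero u)]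
  have hon : (onSet 0 A B {u, u'}).card = Fintype.card K - 1 := by
    rw [h.card_onSet, show (univ.filter fun x => bev 0 A x ≠ 0 ∧ x ∉ ({u, u'} : Finset _)) =
      {u, u'}ᶜ by ext x; simp [h.bev_zero_ne_zero], card_compl, card_pair hne, Fintype.card_option]
    omega
  have key := card_subsets_three _ _ _ (disjoint_offSet (k := 0) (A := A) (B := B) hne)
    (disjoint_offSet_onSet (E := {u, u'})) (disjoint_offSet_onSet (E := {u, u'})) 2 2 3
  rw [hoff, hoff, hon] at key
  rw [← key]
  congr 1
  ext U
  simp only [mem_filter, mem_univ, true_and, adm_iff, biUnion_insert, singleton_biUnion,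
    mem_insert, mem_singleton, forall_eq_or_imp, forall_eq, card_pair hne, mul_zero, zero_add,
    and_true, union_assoc, and_assoc, add_zero]
  convert Iff.rfl

lemma cast_card_admSet_mul (k : ℕ) : ((admSet K k).card : ℤ) * ((Fintype.card K : ℤ) - 1) =
    ∑ x ∈ copSet K k, ((∑ E ∈ powersetCard (2 - k) univ,
      (univ.filter fun U => Adm k x.1 x.2 E U).card : ℕ) : ℤ) := by
  have h := congrArg (Nat.cast (R := ℤ)) (card_admSet_mul (K := K) k)
  rw [Nat.cast_mul, Nat.cast_sub Fintype.card_pos, Nat.cast_one] at h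
  rw [h, Nat.cast_sum]

lemma card_copSet_zero :
    ((copSet K 0).card : ℤ) = ((Fintype.card K : ℤ) - 1) * (Fintype.card K : ℤ) ^ 2 := by
  have h := sum_copSet (K := K) 0 (fun _ => (1 : ℤ))
  rw [Finset.sum_const, nsmul_one] at h
  rw [h, Finset.sum_congr rfl (g := fun _ => (Fintype.card K : ℤ) ^ 2), sum_const, nsmul_eq_mul,
    card_erase_polys, zero_add, pow_one]
  intro A hA
  rw [mem_erase, mem_polys] at hA
  rw [nsmul_one, card_cop_zero hA.2 hA.1]

lemma card_admSet_zero : ((admSet K 0).card : ℤ) * ((Fintype.card K : ℤ) - 1) =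
    ((Fintype.card K : ℤ) - 1) * (Fintype.card K : ℤ) ^ 2 *
      ((Fintype.card K + 1).choose 2 * ((Fintype.card K - 1).choose 2 *
        ((Fintype.card K - 1).choose 2 * (Fintype.card K - 1).choose 3)) : ℕ) := by
  rw [cast_card_admSet_mul, Finset.sum_congr rfl fun x hx =>
    congrArg Nat.cast (card_adm_zero (mem_copSet.1 hx)), sum_const, nsmul_eq_mul, card_copSet_zero]

lemma card_admSet_one : ((admSet K 1).card : ℤ) * ((Fintype.card K : ℤ) - 1) =
    ((Fintype.card K : ℤ) ^ 2 - 1) * ((Fintype.card K : ℤ) ^ 3 - Fintype.card K ^ 2) *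
      ((Fintype.card K).choose 2 * (Fintype.card K).choose 5 +
        Fintype.card K * ((Fintype.card K - 1).choose 2 * (Fintype.card K - 1).choose 5) : ℕ) := by
  rw [cast_card_admSet_mul, Finset.sum_congr rfl fun x hx =>
    congrArg Nat.cast (card_adm_one (mem_copSet.1 hx)), sum_const, nsmul_eq_mul, card_copSet_one]

/-- The three terms are the numbers 0, 1 and 2 of rational zeros of `A`; the factor 2 clears the
denominators of `card_rootCount_two`. -/
lemma card_admSet_two : 2 * (((admSet K 2).card : ℤ) * ((Fintype.card K : ℤ) - 1)) =
    (Fintype.card K : ℤ) * ((Fintype.card K : ℤ) - 1) ^ 2 *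
      ((Fintype.card K : ℤ) ^ 4 - Fintype.card K ^ 2) * (Fintype.card K + 1).choose 7 +
    2 * (((Fintype.card K : ℤ) + 1) * ((Fintype.card K : ℤ) - 1)) *
      ((Fintype.card K : ℤ) ^ 4 - Fintype.card K ^ 3) * (Fintype.card K).choose 7 +
    ((Fintype.card K : ℤ) + 1) * Fintype.card K * ((Fintype.card K : ℤ) - 1) *
      ((Fintype.card K : ℤ) ^ 4 - 2 * Fintype.card K ^ 3 + Fintype.card K ^ 2) *
      (Fintype.card K - 1).choose 7 := by
  obtain ⟨h2, h1, h0⟩ := card_rootCount_two (K := K)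
  rw [cast_card_admSet_mul, Finset.sum_congr rfl fun x hx =>
    congrArg Nat.cast (card_adm_two (mem_copSet.1 hx)),
    sum_copSet 2 fun A => (((Fintype.card K + 1 - rootCount 2 A).choose 7 : ℕ) : ℤ)]
  have key : ∀ A ∈ (polys K 2).erase 0, ((polys K (2 + 1)).filter fun B => Cop 2 A B).card •
      (((Fintype.card K + 1 - rootCount 2 A).choose 7 : ℕ) : ℤ) =
      (if rootCount 2 A = 0 then
        ((Fintype.card K : ℤ) ^ 4 - Fintype.card K ^ 2) * (Fintype.card K + 1).choose 7 else 0) +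
      (if rootCount 2 A = 1 then
        ((Fintype.card K : ℤ) ^ 4 - Fintype.card K ^ 3) * (Fintype.card K).choose 7 else 0) +
      if rootCount 2 A = 2 then
        ((Fintype.card K : ℤ) ^ 4 - 2 * Fintype.card K ^ 3 + Fintype.card K ^ 2) *
        (Fintype.card K - 1).choose 7 else 0 := by
    intro A hA
    rw [mem_erase, mem_polys] at hA
    have hle : rootCount 2 A ≤ 2 := card_bev_zeros_le hA.2 hA.1
    rw [nsmul_eq_mul, card_cop_two hA.2 hA.1]
    generalize rootCount 2 A = r at hle
    interval_cases r <;> simp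
  rw [Finset.sum_congr rfl key, sum_add_distrib, sum_add_distrib, ← sum_filter, ← sum_filter,
    ← sum_filter, sum_const, sum_const, sum_const, nsmul_eq_mul, nsmul_eq_mul, nsmul_eq_mul, h1,
    ← h0, ← h2]
  ring

end CountAdm

/-! ### Sets of nine points with dependent conditions on cubics -/

section NineSets

variable {K ι : Type*} [Field K] [Fintype K] [Fintype ι] {v : ι → Fin 3 → K}

lemma erase_mem_goodEight {S : Finset ι} {p : ι} (hS : S ∈ baseFam v) (hp : p ∈ S) :
    S.erase p ∈ goodEight v := by
  obtain ⟨h9, h4, h7, -⟩ := mem_baseFam.1 hS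
  refine mem_goodEight.2 ⟨by rw [card_erase_of_mem hp, h9], fun j => ?_, fun f hf0 hf => ?_⟩
  · exact (card_le_card (inter_subset_inter_right (erase_subset _ _))).trans (h4 j)
  · exact (card_le_card (inter_subset_inter_right (erase_subset _ _))).trans (h7 f hf0 hf)

/-- The points imposing no condition on the cubics through eight points in general position. -/
lemma insert_mem_baseFam_iff (hv : PlaneReps v) {T : Finset ι} (hT : T ∈ goodEight v) {p : ι}
    (hp : p ∉ T) :
    insert p T ∈ baseFam v ↔ ∀ f ∈ vanishing v 3 T, MvPolynomial.eval (v p) f = 0 := by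
  obtain ⟨h8, h4, h7⟩ := mem_goodEight.1 hT
  have h9 : (insert p T).card = 9 := by rw [card_insert_of_notMem hp, h8]
  constructor
  · intro hS f hf
    obtain ⟨-, h4', h7', c, hc0, hc, hs⟩ := mem_baseFam.1 hS
    have hcS := (hc.supp_eq_of_noSeven hv h4' h7' h9.le hc0 hs).1
    have hcp : c p ≠ 0 := mem_supp.1 (hcS ▸ mem_insert_self p T)
    rw [mem_vanishing] at hf
    have h := hc f hf.1
    rw [Finset.sum_eq_single p, smul_eq_mul] at h
    · exact (mul_eq_zero.1 h).resolve_right hcp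
    · intro i _ hip
      by_cases hi : i ∈ T
      · rw [hf.2 i hi, zero_smul]
      · have : c i = 0 := by
          by_contra h0
          exact ((mem_insert.1 (hs (mem_supp.2 h0))).elim hip hi)
        rw [this, smul_zero]
    · exact fun h => absurd (mem_univ p) h
  · intro hp0
    obtain ⟨c, hc, hs, hc0⟩ : ∃ c : ι → K, Rel v 3 c ∧ supp c ⊆ insert p T ∧ c ≠ 0 := by
      by_contra! hno
      have h1 := finrank_vanishing hno
      have h2 : vanishing v 3 (insert p T) = vanishing v 3 T := by
        ext f
        simp only [mem_vanishing, mem_insert, forall_eq_or_imp]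
        exact ⟨fun h => ⟨h.1, h.2.2⟩, fun h => ⟨h.1, hp0 f (mem_vanishing.2 h), h.2⟩⟩
      rw [h2, finrank_vanishing_three hv hT, h9] at h1
      simp [Nat.choose] at h1
    have hX : ∀ X : Finset ι, (insert p T ∩ X).card ≤ (T ∩ X).card + 1 ∧
        (p ∉ X → insert p T ∩ X = T ∩ X) := fun X => by
      refine ⟨?_, fun h => insert_inter_of_notMem h⟩
      refine (card_le_card (t := insert p (T ∩ X)) ?_).trans (card_insert_le _ _)
      intro i
      simp only [mem_inter, mem_insert]
      tauto
    have h5 : NoFive v (insert p T) := fun j => (hX _).1.trans (Nat.succ_le_succ (h4 j))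
    -- One extra point still leaves no five collinear, so a support has at least eight points. Hence
    -- no line or conic in question contains it, and the residual bounds apply.
    have hns : ∀ X : Finset ι, (insert p T ∩ X).card ≤ 7 → ¬ supp c ⊆ X := fun X hXc hcX =>
      hc0 (hc.eq_zero_of_noFive hv (h5.mono inter_subset_left) hXc (subset_inter hs hcX))
    refine mem_baseFam.2 ⟨h9, fun j => ?_, fun f hf0 hf => ?_, c, hc0, hc, hs⟩
    · by_contra! hj
      have hpj : p ∈ line v j := by
        by_contra hpj
        rw [(hX _).2 hpj] at hj
        exact absurd (h4 j) (by omega)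
      have h1 := hc.mul (d := 2) (isHomogeneous_lin (v j))
      have h2 := supp_mul (v := v) c (lin (v j))
      rw [zeros_lin] at h2
      have h3 := card_inter_add_card_sdiff (insert p T) (line v j)
      have h6 : supp c \ line v j ⊆ insert p T \ line v j := sdiff_subset_sdiff hs subset_rfl
      have hle := card_le_card h6
      obtain ⟨j', hj'⟩ := h1.exists_line hv (by rw [h2]; omega)
      have h4' := Rel.card_sdiff_ge (d := 2) hv hc (isHomogeneous_lin (v j))
        (by rw [zeros_lin]; exact hns _ ((h5 j).trans (by norm_num)))
      rw [h2] at hj'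
      rw [zeros_lin] at h4'
      have := card_le_card (subset_inter (show supp c \ line v j ⊆ T from fun i hi => by
        have := mem_sdiff.1 (h6 hi)
        refine (mem_insert.1 this.1).resolve_left ?_
        rintro rfl
        exact this.2 hpj) hj')
      have := h4 j'
      omega
    · by_contra! hf7
      have h1 := (hX (zeros v f)).1
      have h2 := h7 f hf0 hf
      have h3 := Rel.card_sdiff_ge (d := 1) hv hc hf (hns _ (by omega))
      have h6 := card_le_card (sdiff_subset_sdiff hs (subset_refl (zeros v f)))
      have h8 := card_inter_add_card_sdiff (insert p T) (zeros v f)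
      omega

/-- Each set of eight points in general position either extends uniquely to a base locus of a pencil
of cubics or has a unique point at which a cubic of its pencil is singular. -/
lemma card_goodEight_eq (hv : PlaneReps v) :
    (goodEight v).card = 9 * (baseFam v).card + ∑ p, (singularFam v p).card := by
  have h0 : ∀ T ∈ goodEight v, (univ.filter fun p => (p ∉ T ∧ insert p T ∈ baseFam v) ∨
      T ∈ singularFam v p).card = 1 := by
    intro T hT
    obtain ⟨p, hp⟩ := exists_ninth_point hv hT
    refine card_eq_one.2 ⟨p, ?_⟩
    ext p'
    rw [mem_filter, mem_singleton, ← hp p', singularFam, mem_filter]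
    simp only [mem_univ, hT, true_and]
    refine or_congr_left (and_congr_right fun h => ?_)
    rw [insert_mem_baseFam_iff hv hT h]
  have h1 := sum_card_bipartiteAbove_eq_sum_card_bipartiteBelow (s := goodEight v)
    (t := (univ : Finset ι)) fun T p => (p ∉ T ∧ insert p T ∈ baseFam v) ∨ T ∈ singularFam v p
  simp only [bipartiteBelow, bipartiteAbove] at h1
  rw [Finset.sum_congr rfl h0, sum_const, smul_eq_mul, mul_one] at h1
  -- The ninth points outside `T` correspond to sets of `baseFam` with a marked point; deleting the
  -- marked point inverts the insertion.
  have h2 : ∀ p, ((goodEight v).filter fun T => (p ∉ T ∧ insert p T ∈ baseFam v) ∨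
      T ∈ singularFam v p).card =
      ((baseFam v).filter fun S => p ∈ S).card + (singularFam v p).card := by
    intro p
    rw [filter_or, card_union_of_disjoint]
    · congr 1
      · refine card_bij' (fun T _ => insert p T) (fun S _ => S.erase p) ?_ ?_ ?_ ?_
        · intro T hT
          exact mem_filter.2 ⟨(mem_filter.1 hT).2.2, mem_insert_self _ _⟩
        · intro S hS
          obtain ⟨hS, hp⟩ := mem_filter.1 hS
          exact mem_filter.2 ⟨erase_mem_goodEight hS hp, notMem_erase _ _, by rwa [insert_erase hp]⟩
        · intro T hT
          exact erase_insert (mem_filter.1 hT).2.1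
        · intro S hS
          exact insert_erase (mem_filter.1 hS).2
      · rw [filter_mem_eq_inter, inter_eq_right.2 (show singularFam v p ⊆ _ from filter_subset _ _)]
    · rw [disjoint_filter]
      exact fun T _ h h' => h.1 (mem_filter.1 h').2.1
  have h3 : ∑ p, ((baseFam v).filter fun S => p ∈ S).card = 9 * (baseFam v).card := by
    have := sum_card_bipartiteAbove_eq_sum_card_bipartiteBelow (s := baseFam v)
      (t := (univ : Finset ι)) fun S p => p ∈ S
    simp only [bipartiteBelow, bipartiteAbove] at this
    rw [← this, Finset.sum_congr rfl (g := fun _ => 9), sum_const, smul_eq_mul, mul_comm]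
    intro S hS
    rw [filter_mem_eq_inter, univ_inter, (mem_baseFam.1 hS).1]
  rw [h1, ← h3, ← sum_add_distrib]
  exact Finset.sum_congr rfl fun p _ => h2 p

end NineSets

/-! ### The number of base loci -/

section BaseLoci

variable {K ι : Type*} [Field K] [Fintype K] [Fintype ι] {v : ι → Fin 3 → K}

/-- Valid also for `n < k`, where the product vanishes, so small `q` needs no separate treatment in
the polynomial identities. -/
lemma cast_choose_eq_prod (n k : ℕ) :
    (n.choose k : ℚ) = (∏ i ∈ range k, ((n : ℚ) - i)) / (k.factorial : ℚ) := by
  rw [Nat.cast_choose_eq_descPochhammer_div, descPochhammer_eval_eq_prod_range]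

lemma card_baseFam_mul (hv : PlaneReps v) (hq : 2 < Fintype.card K) (x : ℚ)
    (hx : x = Fintype.card K) :
    18 * (x - 1) * ((baseFam v).card : ℚ) = 2 * (x - 1) * ((goodEight v).card : ℚ) -
      (x ^ 2 + x + 1) * (2 * (x - 1) * (admSet K 0).card + 2 * (x - 1) * (admSet K 1).card +
        2 * (x - 1) * (admSet K 2).card) := by
  have h := congrArg (Nat.cast (R := ℚ)) (card_goodEight_eq hv)
  rw [Finset.sum_congr rfl fun p _ => card_singularFam hv hq p, sum_const, card_univ,
    card_points hv] at h
  simp only [sum_range_succ, range_zero, sum_empty, zero_add, smul_eq_mul] at h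
  push_cast at h
  rw [← hx] at h
  linear_combination -2 * (x - 1) * h

/-- `card_goodEight_eq` solved for the base loci. All other counts are polynomials in `q`, and
multiplying by `q - 1` avoids dividing in the counts of `admSet`. -/
theorem card_baseFam (hv : PlaneReps v) (hq : 2 < Fintype.card K) :
    ((baseFam v).card : ℚ) = I9 (Fintype.card K) := by
  obtain ⟨x, hx⟩ : ∃ x : ℚ, x = Fintype.card K := ⟨_, rfl⟩
  have hx1 : x - 1 ≠ 0 := by
    rw [hx, sub_ne_zero]
    exact_mod_cast (by omega : Fintype.card K ≠ 1)
  have hb := card_baseFam_mul hv hq x hx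
  have hG := congrArg (Int.cast (R := ℚ)) (card_goodEight hv)
  have h0 := congrArg (Int.cast (R := ℚ)) (card_admSet_zero (K := K))
  have h1 := congrArg (Int.cast (R := ℚ)) (card_admSet_one (K := K))
  have h2 := congrArg (Int.cast (R := ℚ)) (card_admSet_two (K := K))
  rw [card_points hv] at hG
  have hI : Icc 4 8 = {4, 5, 6, 7, 8} := rfl
  have hcast : ((Fintype.card K - 1 : ℕ) : ℚ) = x - 1 := by
    rw [Nat.cast_sub Fintype.card_pos, Nat.cast_one, hx]
  rw [hI, sum_insert (by decide), sum_insert (by decide), sum_insert (by decide),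
    sum_insert (by decide), sum_singleton] at hG
  push_cast at hG h0 h1 h2
  simp only [cast_choose_eq_prod, prod_range_succ, range_zero, prod_empty, one_mul, hcast,
    Nat.factorial, Nat.cast_add, Nat.cast_one, Nat.cast_pow, Nat.cast_mul,
    Nat.cast_ofNat, Nat.cast_zero, ← hx] at hG h0 h1 h2
  rw [← hx, I9, Nat.factorial]
  apply mul_left_cancel₀ hx1
  linear_combination (1 / 18 : ℚ) * hb + (x - 1) / 9 * hG - (x ^ 2 + x + 1) / 9 * (h0 + h1) -
    (x ^ 2 + x + 1) / 18 * h2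

end BaseLoci

/-! ### From enumerators to numbers of relations -/

section Enumerators

variable {K : Type*} [Field K] [Fintype K] {N : ℕ} {v : Fin N → Fin 3 → K}

lemma mem_dualCode_iff {c : Fin N → K} : c ∈ dualCode (projReedMuller 3 v) ↔ Rel v 3 c := by
  constructor
  · intro h f hf
    have := h _ (Submodule.mem_map.2 ⟨f, hf, rfl⟩)
    simpa [dotProduct, MvPolynomial.aeval_eq_eval] using this
  · rintro h _ ⟨f, hf, rfl⟩
    simpa [dotProduct, MvPolynomial.aeval_eq_eval] using h f hf

/-- The coefficients of a binary form given by a sum of monomials. -/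
lemma coeff_of_sum_eq {α : Type*} (s : Finset α) (w : α → ℕ) (B : ℕ → ℚ)
    (h : ∑ c ∈ s, (MvPolynomial.X 0 ^ (N - w c) * MvPolynomial.X 1 ^ w c :
        MvPolynomial (Fin 2) ℚ) =
      ∑ i ∈ range (N + 1),
        MvPolynomial.C (B i) * MvPolynomial.X 0 ^ (N - i) * MvPolynomial.X 1 ^ i)
    {k : ℕ} (hk : k ≤ N) : B k = ((s.filter fun c => w c = k).card : ℚ) := by
  -- Setting the variable `0` to 1 loses nothing, because the exponents of the variable `1` separate
  -- the terms.
  have h1 := congrArg (fun P => (MvPolynomial.aeval (R := ℚ)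
    ![(1 : Polynomial ℚ), Polynomial.X] P).coeff k) h
  simp only [map_sum, map_mul, map_pow, MvPolynomial.aeval_X, Matrix.cons_val_zero,
    Matrix.cons_val_one, one_pow, one_mul, mul_one, Polynomial.finsetSum_coeff,
    Polynomial.coeff_X_pow, MvPolynomial.aeval_C, Polynomial.algebraMap_apply,
    Polynomial.coeff_C_mul, Algebra.algebraMap_self, RingHom.id_apply] at h1
  rw [Finset.sum_boole] at h1
  simp only [mul_ite, mul_one, mul_zero] at h1
  rw [Finset.sum_ite_eq, if_pos (by simp; omega)] at h1
  rw [← h1]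
  congr 2
  ext c
  simp [eq_comm]

lemma coeff_weightEnumerator {B : ℕ → ℚ}
    (hB : weightEnumerator (dualCode (projReedMuller 3 v) : Set (Fin N → K)) =
      ∑ i ∈ range (N + 1),
        MvPolynomial.C (B i) * MvPolynomial.X 0 ^ (N - i) * MvPolynomial.X 1 ^ i)
    {k : ℕ} (hk : k ≤ N) : B k = relWeight v K k := by
  rw [weightEnumerator, Fintype.card_fin] at hB
  rw [coeff_of_sum_eq _ _ _ hB hk, relWeight, filter_filter]
  congr 2
  ext c
  simp only [mem_filter, mem_univ, true_and, SetLike.mem_coe, mem_dualCode_iff]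
  rfl

/-- Pairs of codewords become single relations with coefficients in `K × K`, so that one
classification of supports serves both enumerators. -/
lemma rel_prod_iff {d : ℕ} {c : Fin N → K × K} :
    Rel v d c ↔ Rel v d (fun i => (c i).1) ∧ Rel v d (fun i => (c i).2) := by
  simp only [Rel, ← forall_and]
  refine forall_congr' fun f => ?_
  rw [Prod.ext_iff, Prod.fst_sum, Prod.snd_sum]
  rfl

lemma pairWeight_eq (c : Fin N → K × K) :
    pairWeight (fun i => (c i).1) (fun i => (c i).2) = (supp c).card := by
  rw [pairWeight]
  congr 1
  ext i
  simp [mem_supp, Prod.ext_iff]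

lemma coeff_secondWeightEnumerator {B : ℕ → ℚ}
    (hB : secondWeightEnumerator (dualCode (projReedMuller 3 v) : Set (Fin N → K)) =
      ∑ i ∈ range (N + 1),
        MvPolynomial.C (B i) * MvPolynomial.X 0 ^ (N - i) * MvPolynomial.X 1 ^ i)
    {k : ℕ} (hk : k ≤ N) : B k = relWeight v (K × K) k := by
  set F : Finset (Fin N → K) :=
    univ.filter fun c => c ∈ (dualCode (projReedMuller 3 v) : Set (Fin N → K)) with hF
  have h' : ∑ c ∈ F ×ˢ F, (MvPolynomial.X 0 ^ (N - pairWeight c.1 c.2) *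
      MvPolynomial.X 1 ^ pairWeight c.1 c.2 : MvPolynomial (Fin 2) ℚ) =
      ∑ i ∈ range (N + 1),
        MvPolynomial.C (B i) * MvPolynomial.X 0 ^ (N - i) * MvPolynomial.X 1 ^ i := by
    rw [← hB, secondWeightEnumerator, Finset.sum_product, Fintype.card_fin]
    exact Finset.sum_congr (by ext; simp [hF]) fun x _ =>
      Finset.sum_congr (by ext; simp [hF]) fun y _ => rfl
  have h1 := coeff_of_sum_eq (F ×ˢ F) (fun c => pairWeight c.1 c.2) B h' hk
  rw [h1, relWeight]
  refine congrArg Nat.cast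
    (card_equiv (Equiv.arrowProdEquivProdArrow (Fin N) (fun _ => K) fun _ => K).symm ?_)
  rintro ⟨c₁, c₂⟩
  have e : (Equiv.arrowProdEquivProdArrow (Fin N) (fun _ => K) fun _ => K).symm (c₁, c₂) =
      fun i => (c₁ i, c₂ i) := rfl
  rw [e, mem_filter, mem_filter, mem_product, hF, mem_filter, mem_filter, SetLike.mem_coe,
    SetLike.mem_coe, mem_dualCode_iff, mem_dualCode_iff, rel_prod_iff, ← pairWeight_eq]
  simp

end Enumerators

end PlaneCubics
end

open PlaneCubics in
theorem mainTheorem7 {K : Type*} [Field K] [Fintype K] (q : ℕ) (hq : Fintype.card K = q)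
    (hq2 : 2 < q)
    -- an ordering of the points of the projective plane, with a choice of representatives
    (v : Fin (q ^ 2 + q + 1) → Fin 3 → K) (hv0 : ∀ i, v i ≠ 0)
    (hv : Function.Bijective fun i => Projectivization.mk K (v i) (hv0 i))
    (B₂ B : ℕ → ℚ)
    (hB₂ : secondWeightEnumerator (dualCode (projReedMuller 3 v) : Set (Fin (q ^ 2 + q + 1) → K)) =
      ∑ i ∈ Finset.range (q ^ 2 + q + 1 + 1),
        MvPolynomial.C (B₂ i) * MvPolynomial.X 0 ^ (q ^ 2 + q + 1 - i) * MvPolynomial.X 1 ^ i)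
    (hB : weightEnumerator (dualCode (projReedMuller 3 v) : Set (Fin (q ^ 2 + q + 1) → K)) =
      ∑ i ∈ Finset.range (q ^ 2 + q + 1 + 1),
        MvPolynomial.C (B i) * MvPolynomial.X 0 ^ (q ^ 2 + q + 1 - i) * MvPolynomial.X 1 ^ i) :
    B₂ 0 = 1 ∧ B₂ 1 = 0 ∧ B₂ 2 = 0 ∧ B₂ 3 = 0 ∧ B₂ 4 = 0 ∧
    B₂ 5 = 2 * B 5 + (q ^ 2 + q + 1) * (Nat.choose (q + 1) 5 : ℚ) * g3 q 5 ∧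
    B₂ 6 = 2 * B 6 + (q ^ 2 + q + 1) * (Nat.choose (q + 1) 6 : ℚ) * g3 q 6 ∧
    B₂ 7 = 2 * B 7 + (q ^ 2 + q + 1) * (Nat.choose (q + 1) 7 : ℚ) * g3 q 7 ∧
    B₂ 8 = 2 * B 8 + (q ^ 2 + q + 1) * (Nat.choose (q + 1) 8 : ℚ) * g3 q 8
      + ((q : ℚ) ^ 5 - q ^ 2) * (Nat.choose (q + 1) 8 : ℚ) * ((q : ℚ) - 1) ^ 2
      + (Nat.choose (q ^ 2 + q + 1) 2 : ℚ) * (Nat.choose q 4 : ℚ) ^ 2 * ((q : ℚ) - 1) ^ 2 ∧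
    B₂ 9 = 2 * B 9 + (q ^ 2 + q + 1) * (Nat.choose (q + 1) 9 : ℚ) * g3 q 9
      + 2 * (Nat.choose (q ^ 2 + q + 1) 2 : ℚ) * (Nat.choose q 4 : ℚ) * (Nat.choose q 5 : ℚ)
        * ((q : ℚ) ^ 4 - 8 * q ^ 2 + 12 * q - 5)
      + (Nat.choose (q ^ 2 + q + 1) 2 : ℚ) * (Nat.choose q 4 : ℚ) ^ 2
        * ((q : ℚ) ^ 4 - 5 * q ^ 2 + 6 * q - 2)
      + ((q : ℚ) ^ 5 - q ^ 2) * (Nat.choose (q + 1) 9 : ℚ)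
        * ((q : ℚ) ^ 4 - 11 * q ^ 2 + 18 * q - 8)
      + I9 q * ((q : ℚ) - 1) ^ 2 := by
  have hP : PlaneReps v := ⟨hv0, hv⟩
  have hN : 9 ≤ q ^ 2 + q + 1 := by nlinarith
  have hB₂' : ∀ k, k ≤ 9 → B₂ k = relWeight v (K × K) k := fun k hk =>
    coeff_secondWeightEnumerator hB₂ (hk.trans hN)
  have hB' : ∀ k, k ≤ 9 → B k = relWeight v K k := fun k hk =>
    coeff_weightEnumerator hB (hk.trans hN)
  have hz : ∀ k, k ≠ 0 → k ≤ 4 → B₂ k = 0 := fun k h0 h4 => by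
    rw [hB₂' k (by omega), relWeight_eq_zero hP h0 h4, Nat.cast_zero]
  have cast : ∀ {a : ℕ} {b : ℤ}, (a : ℤ) = b → (a : ℚ) = b := fun h => by
    rw [← h, Int.cast_natCast]
  have hc8 := cast (card_conicFam hP (show 7 ≤ 8 by norm_num))
  have hc9 := cast (card_conicFam hP (show 7 ≤ 9 by norm_num))
  have hb := card_baseFam hP (by omega)
  -- Only collinear supports occur here. The last factor, the full-support count for `q²` minus
  -- twice that for `q`, expands to `g3 q m`: the pairs in which neither word is zero.
  have small : ∀ m, 5 ≤ m → m ≤ 7 → B₂ m = 2 * B m +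
      (q ^ 2 + q + 1) * (Nat.choose (q + 1) m : ℚ) *
        (((mdsCount ((q * q : ℕ) : ℤ) m : ℤ) : ℚ) - 2 * ((mdsCount (q : ℤ) m : ℤ) : ℚ)) := by
    intro m h5 h7
    rw [hB₂' m (by omega), hB' m (by omega), cast (relWeight_five_to_seven (W := K × K) hP h5 h7),
      cast (relWeight_five_to_seven (W := K) hP h5 h7), Fintype.card_prod, hq, Fintype.card_fin]
    push_cast
    ring
  rw [hq] at hc8 hc9 hb
  refine ⟨?_, hz 1 (by omega) (by omega), hz 2 (by omega) (by omega), hz 3 (by omega) (by omega),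
    hz 4 (by omega) (by omega), ?_, ?_, ?_, ?_, ?_⟩
  · rw [hB₂' 0 (by omega), relWeight_zero, Nat.cast_one]
  · rw [small 5 (by omega) (by omega)]
    simp only [mdsCount, g3]
    push_cast
    ring
  · rw [small 6 (by omega) (by omega)]
    simp only [mdsCount, g3]
    push_cast
    ring
  · rw [small 7 (by omega) (by omega)]
    simp only [mdsCount, g3]
    push_cast
    ring
  · rw [hB₂' 8 (by omega), hB' 8 (by omega), cast (relWeight_eight (W := K × K) hP),
      cast (relWeight_eight (W := K) hP), Fintype.card_prod, hq, Fintype.card_fin]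
    simp only [mdsCount, g3]
    push_cast at hc8 ⊢
    rw [hc8]
    ring
  · rw [hB₂' 9 (by omega), hB' 9 (by omega), cast (relWeight_nine (W := K × K) hP),
      cast (relWeight_nine (W := K) hP), Fintype.card_prod, hq, Fintype.card_fin]
    simp only [mdsCount, g3]
    push_cast at hc9 ⊢
    rw [hc9, hb]
    ring
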